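/- Let $E$ be an elliptic curve over $\mathbb{C}$ with identity $0$, and let $E^{(3)} = E^3/S_3$ be its symmetric cube, whose points are the effective divisors of degree $3$ on $E$, i.e. the unordered triples $\{P_1,P_2,P_3\}$ of points of $E$. Let $D_0 \subset E^{(3)}$ be the prime divisor of triples containing $0$ (the image of $\{0\}\times E\times E$), and let $G_0 \subset E^{(3)}$ be the fibre over $0$ of the Abel--Jacobi map $E^{(3)}\to E$, $\{P_1,P_2,P_3\}\mapsto P_1\oplus P_2\oplus P_3$. Let $|\mathfrak{D}|$, $\mathfrak{D} = 4D_0-G_0$, be the complete linear system of zero divisors $Z(s)$ of nonzero sections $s\in H^0(E^{(3)},\mathcal{O}(4D_0-G_0))$. Then $|\mathfrak{D}|$ has exactly four base points (points lying on every member of $|\mathfrak D|$). Each of them lies in $G_0$ and is simple, meaning that two general members of $|\mathfrak{D}|$ (that is, $Z(s_1)$ and $Z(s_2)$ for all $(s_1,s_2)$ in some nonempty Zariski open subset of $H^0\times H^0$) are smooth at the point and intersect transversally there. -/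

import Mathlib

noncomputable section

/-! ### Varieties as spaces with a sheaf of regular functions -/

/-- A set of closed points with a (Zariski) topology and, for each open set `V`, the functions
that are regular on `V`. Functions are total; only their values on `V` matter. -/
structure VarietyData (X : Type) where
  top : TopologicalSpace X
  RegularOn : Set X → (X → ℂ) → Prop

namespace VarietyData

variable {X : Type} (𝒳 : VarietyData X)

/-- `V` is open in the Zariski topology. -/
def IsOpn (V : Set X) : Prop := @IsOpen X 𝒳.top V

/-- `u` is a local equation on the open set `V` of the reduced closed subset `Z`: the sheaf of
ideals of functions vanishing on `Z` is generated by `u` over `V`. -/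
structure IsLocalEquation (Z V : Set X) (u : X → ℂ) : Prop where
  regular : 𝒳.RegularOn V u
  vanish : ∀ P ∈ V, P ∈ Z → u P = 0
  generates : ∀ V' : Set X, 𝒳.IsOpn V' → V' ⊆ V → ∀ a : X → ℂ, 𝒳.RegularOn V' a →
    (∀ P ∈ V', P ∈ Z → a P = 0) → ∀ P ∈ V', ∃ V'' : Set X, 𝒳.IsOpn V'' ∧ P ∈ V'' ∧ V'' ⊆ V' ∧
      ∃ b : X → ℂ, 𝒳.RegularOn V'' b ∧ ∀ Q ∈ V'', a Q = u Q * b Q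

/-- The germ of `a` at `p` lies in the square `𝔪_p²` of the maximal ideal of the local ring. -/
def InSqMaxIdeal (p : X) (a : X → ℂ) : Prop :=
  ∃ V : Set X, 𝒳.IsOpn V ∧ p ∈ V ∧ ∃ (n : ℕ) (b c : Fin n → X → ℂ),
    (∀ i, 𝒳.RegularOn V (b i) ∧ 𝒳.RegularOn V (c i) ∧ b i p = 0 ∧ c i p = 0) ∧
    ∀ Q ∈ V, a Q = ∑ i, b i Q * c i Q

end VarietyData

/-! ### The cube and the symmetric cube of an elliptic curve -/

namespace SymmetricCube

open MvPolynomial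

/-- The points of the elliptic curve `E` given by a Weierstrass equation over `ℂ`. -/
abbrev Pt (W : WeierstrassCurve ℂ) : Type := W.toAffine.Point

variable (W : WeierstrassCurve ℂ)

/-- Homogeneous coordinates of a point of `E ⊆ ℙ²`: the zero of the group law is `[0 : 1 : 0]`,
the affine point `(x, y)` is `[x : y : 1]`. -/
def homCoord : Pt W → Fin 3 → ℂ
  | .zero => ![0, 1, 0]
  | .some x y _ => ![x, y, 1]

/-- The multihomogeneous coordinates of a point of `E³ ⊆ ℙ² × ℙ² × ℙ²`. -/
def coords (P : Fin 3 → Pt W) : Fin 3 × Fin 3 → ℂ := fun j => homCoord W (P j.1) j.2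

/-- `N` is homogeneous of degree `d i` in the three coordinates of the `i`-th factor, for
each `i`. -/
def IsMultihom (N : MvPolynomial (Fin 3 × Fin 3) ℂ) (d : Fin 3 → ℕ) : Prop :=
  IsWeightedHomogeneous (fun j : Fin 3 × Fin 3 => (Pi.single j.1 1 : Fin 3 → ℕ)) N d

/-- The Zariski topology of `E³`: the non-vanishing loci of multihomogeneous polynomials form a
basis. -/
@[reducible] def zariskiTopology : TopologicalSpace (Fin 3 → Pt W) :=
  TopologicalSpace.generateFrom
    {U | ∃ (d : Fin 3 → ℕ) (N : MvPolynomial (Fin 3 × Fin 3) ℂ),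
      IsMultihom N d ∧ U = {P | eval (coords W P) N ≠ 0}}

/-- The variety `E³`: a function is regular on an open set if it is locally a quotient of two
multihomogeneous polynomials of equal multidegree with non-vanishing denominator. -/
def cube : VarietyData (Fin 3 → Pt W) where
  top := zariskiTopology W
  RegularOn V f := ∀ P ∈ V, ∃ U : Set (Fin 3 → Pt W),
    @IsOpen _ (zariskiTopology W) U ∧ P ∈ U ∧ U ⊆ V ∧
    ∃ (d : Fin 3 → ℕ) (N D : MvPolynomial (Fin 3 × Fin 3) ℂ), IsMultihom N d ∧ IsMultihom D d ∧
      ∀ Q ∈ U, eval (coords W Q) D ≠ 0 ∧ f Q = eval (coords W Q) N / eval (coords W Q) D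

/-- The points of `E⁽³⁾`: effective divisors of degree three on `E`, that is unordered triples. -/
abbrev SymPt : Type := Sym (Pt W) 3

/-- The quotient map `E³ → E⁽³⁾`, sending `(P₁, P₂, P₃)` to the divisor `P₁ + P₂ + P₃`. -/
def quot (P : Fin 3 → Pt W) : SymPt W := ⟨Finset.univ.val.map P, by simp⟩

/-- The variety `E⁽³⁾ = E³ / S₃`: it has the quotient topology, and a function on an open set is
regular if its pullback to `E³` is (so regular functions on `V` are the `S₃`-invariant regular
functions on the preimage of `V`). -/
def symCube : VarietyData (SymPt W) where
  top := TopologicalSpace.coinduced (quot W) (cube W).top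
  RegularOn V f := (cube W).RegularOn (quot W ⁻¹' V) (f ∘ quot W)

/-- The Abel-Jacobi map `E⁽³⁾ → E`, adding up the three points in the group law. -/
def abelJacobi (D : SymPt W) : Pt W := (D : Multiset (Pt W)).sum

/-- The prime divisor `D₀`, the image of `{0} × E × E`: the triples that contain `0`. -/
def divD0 : Set (SymPt W) := quot W '' {P | P 0 = 0}

/-- The prime divisor `G₀`: the fibre over `0` of the Abel-Jacobi map. -/
def divG0 : Set (SymPt W) := abelJacobi W ⁻¹' {0}

/-! ### The invertible sheaf `𝒪(4D₀ - G₀)` and its global sections -/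

/-- On the open set `V` the functions `u` and `g` are local equations of `D₀` and `G₀`, so that
`g / u⁴` generates `𝒪(4D₀ - G₀)` over `V`. -/
structure IsTrivialization (V : Set (SymPt W)) (u g : SymPt W → ℂ) : Prop where
  isOpn : (symCube W).IsOpn V
  eqD0 : (symCube W).IsLocalEquation (divD0 W) V u
  eqG0 : (symCube W).IsLocalEquation (divG0 W) V g

variable {W} in
/-- On `V` the function `h` is regular and `f = h · (g / u⁴)` away from `D₀`. -/
def IsLocalExpr (f : {D : SymPt W // D ∉ divD0 W} → ℂ) (V : Set (SymPt W))
    (u g h : SymPt W → ℂ) : Prop :=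
  (symCube W).RegularOn V h ∧
    ∀ (D : SymPt W) (hD : D ∉ divD0 W), D ∈ V → f ⟨D, hD⟩ * u D ^ 4 = g D * h D

variable {W}

theorem cube_regularOn_const (V : Set (Fin 3 → Pt W)) (hV : (cube W).IsOpn V) (c : ℂ) :
    (cube W).RegularOn V (fun _ => c) := by
  intro P hP
  refine ⟨V, hV, hP, subset_rfl, 0, C c, C 1, isWeightedHomogeneous_C _ _,
    isWeightedHomogeneous_C _ _, fun Q _ => ?_⟩
  simp

theorem cube_regularOn_mono {V V' : Set (Fin 3 → Pt W)} {f : (Fin 3 → Pt W) → ℂ}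
    (hV' : (cube W).IsOpn V') (h : V' ⊆ V) (hf : (cube W).RegularOn V f) :
    (cube W).RegularOn V' f := by
  intro P hP
  obtain ⟨U, hU, hPU, -, d, N, D, hN, hD, hQ⟩ := hf P (h hP)
  exact ⟨U ∩ V', (zariskiTopology W).isOpen_inter _ _ hU hV', ⟨hPU, hP⟩, Set.inter_subset_right, d, N, D, hN, hD,
    fun Q hQU => hQ Q hQU.1⟩

theorem cube_regularOn_add {V : Set (Fin 3 → Pt W)} {f f' : (Fin 3 → Pt W) → ℂ}
    (hf : (cube W).RegularOn V f) (hf' : (cube W).RegularOn V f') :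
    (cube W).RegularOn V (fun Q => f Q + f' Q) := by
  intro P hP
  obtain ⟨U, hU, hPU, hUV, d, N, D, hN, hD, hQ⟩ := hf P hP
  obtain ⟨U', hU', hPU', -, d', N', D', hN', hD', hQ'⟩ := hf' P hP
  refine ⟨U ∩ U', (zariskiTopology W).isOpen_inter _ _ hU hU', ⟨hPU, hPU'⟩, fun x hx => hUV hx.1, d + d',
    N * D' + D * N', D * D', (hN.mul hD').add (hD.mul hN'), hD.mul hD', fun Q hq => ?_⟩
  have h1 := hQ Q hq.1
  have h2 := hQ' Q hq.2
  refine ⟨by simpa using ⟨h1.1, h2.1⟩, ?_⟩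
  simp only [h1.2, h2.2, map_add, map_mul]
  exact div_add_div _ _ h1.1 h2.1

theorem cube_regularOn_mul {V : Set (Fin 3 → Pt W)} {f f' : (Fin 3 → Pt W) → ℂ}
    (hf : (cube W).RegularOn V f) (hf' : (cube W).RegularOn V f') :
    (cube W).RegularOn V (fun Q => f Q * f' Q) := by
  intro P hP
  obtain ⟨U, hU, hPU, hUV, d, N, D, hN, hD, hQ⟩ := hf P hP
  obtain ⟨U', hU', hPU', -, d', N', D', hN', hD', hQ'⟩ := hf' P hP
  refine ⟨U ∩ U', (zariskiTopology W).isOpen_inter _ _ hU hU', ⟨hPU, hPU'⟩, fun x hx => hUV hx.1, d + d',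
    N * N', D * D', hN.mul hN', hD.mul hD', fun Q hq => ?_⟩
  have h1 := hQ Q hq.1
  have h2 := hQ' Q hq.2
  refine ⟨by simpa using ⟨h1.1, h2.1⟩, ?_⟩
  simp only [h1.2, h2.2, map_mul]
  exact div_mul_div_comm _ _ _ _

variable (W)

/-- The vector space `H⁰(E⁽³⁾, 𝒪(4D₀ - G₀))`: the rational functions `f` with
`div f + 4D₀ - G₀ ≥ 0`. Such an `f` is regular away from `D₀` and is determined by its values
there; the condition says that wherever `𝒪(4D₀ - G₀)` is trivialized by `g / u⁴`, locally `f` is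
a regular multiple of `g / u⁴`. -/
def globalSections : Submodule ℂ ({D : SymPt W // D ∉ divD0 W} → ℂ) where
  carrier := {f | ∀ (V : Set (SymPt W)) (u g : SymPt W → ℂ), IsTrivialization W V u g →
    ∀ p ∈ V, ∃ V' : Set (SymPt W), (symCube W).IsOpn V' ∧ p ∈ V' ∧ V' ⊆ V ∧
      ∃ h : SymPt W → ℂ, IsLocalExpr f V' u g h}
  zero_mem' := by
    intro V u g ht p hp
    refine ⟨V, ht.isOpn, hp, subset_rfl, fun _ => 0, ?_, fun D hD _ => by simp⟩
    exact cube_regularOn_const _ ht.isOpn 0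
  add_mem' := by
    intro f f' hf hf' V u g ht p hp
    obtain ⟨V₁, ho₁, hp₁, hs₁, h₁, hr₁, he₁⟩ := hf V u g ht p hp
    obtain ⟨V₂, ho₂, hp₂, hs₂, h₂, hr₂, he₂⟩ := hf' V u g ht p hp
    have ho : (symCube W).IsOpn (V₁ ∩ V₂) :=
      (symCube W).top.isOpen_inter _ _ ho₁ ho₂
    refine ⟨V₁ ∩ V₂, ho, ⟨hp₁, hp₂⟩, fun x hx => hs₁ hx.1, fun D => h₁ D + h₂ D,
      cube_regularOn_add (cube_regularOn_mono ho (fun x hx => hx.1) hr₁)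
        (cube_regularOn_mono ho (fun x hx => hx.2) hr₂), fun D hD hV => ?_⟩
    have e₁ := he₁ D hD hV.1
    have e₂ := he₂ D hD hV.2
    simp only [Pi.add_apply, add_mul, mul_add, e₁, e₂]
  smul_mem' := by
    intro c f hf V u g ht p hp
    obtain ⟨V₁, ho₁, hp₁, hs₁, h₁, hr₁, he₁⟩ := hf V u g ht p hp
    refine ⟨V₁, ho₁, hp₁, hs₁, fun D => c * h₁ D,
      cube_regularOn_mul (cube_regularOn_const _ ho₁ c) hr₁, fun D hD hV => ?_⟩
    have e₁ := he₁ D hD hV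
    simp only [Pi.smul_apply, smul_eq_mul, mul_assoc, e₁]
    ring

/-! ### Base points of the complete linear system `|4D₀ - G₀|` -/

variable {W}

/-- The section `s` of `𝒪(4D₀ - G₀)` vanishes at `p`, that is `p ∈ Z(s)`. -/
def VanishesAt (s : globalSections W) (p : SymPt W) : Prop :=
  ∃ (V : Set (SymPt W)) (u g h : SymPt W → ℂ), IsTrivialization W V u g ∧ p ∈ V ∧
    IsLocalExpr s.1 V u g h ∧ h p = 0

/-- `p` is a base point of `|4D₀ - G₀|`: it lies on every member of the linear system. -/
def IsBasePoint (p : SymPt W) : Prop := ∀ s : globalSections W, VanishesAt s p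

/-- The divisors `Z(s₁)` and `Z(s₂)` pass through `p`, are smooth there and meet transversally
there: local equations `h₁`, `h₂` of them at `p` are linearly independent in the cotangent space
`𝔪_p / 𝔪_p²` (in particular neither lies in `𝔪_p²`). -/
def SmoothTransverseAt (s₁ s₂ : globalSections W) (p : SymPt W) : Prop :=
  ∃ (V : Set (SymPt W)) (u g h₁ h₂ : SymPt W → ℂ), IsTrivialization W V u g ∧ p ∈ V ∧
    IsLocalExpr s₁.1 V u g h₁ ∧ IsLocalExpr s₂.1 V u g h₂ ∧ h₁ p = 0 ∧ h₂ p = 0 ∧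
    ∀ α β : ℂ, (symCube W).InSqMaxIdeal p (fun D => α * h₁ D + β * h₂ D) → α = 0 ∧ β = 0

/-- Zariski open subsets of a complex vector space: unions of non-vanishing loci of polynomials
in linear functionals. -/
def IsZariskiOpen {M : Type*} [AddCommGroup M] [Module ℂ M] (U : Set M) : Prop :=
  ∃ S : Set (MvPolynomial (Module.Dual ℂ M) ℂ),
    U = {v | ∃ F ∈ S, eval (fun φ : Module.Dual ℂ M => φ v) F ≠ 0}

/-- A base point is simple if two general members of the linear system are smooth at it and
intersect transversally there. -/
def IsSimpleBasePoint (p : SymPt W) : Prop :=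
  IsBasePoint p ∧ ∃ U : Set (globalSections W × globalSections W), IsZariskiOpen U ∧ U.Nonempty ∧
    ∀ s ∈ U, SmoothTransverseAt s.1 s.2 p

end SymmetricCube

end

/-! Pass to a short model Y² = X³ + AX + B. Three points have sum zero exactly when a line cuts them
out, with multiplicities. The pullback of 𝒪(4D₀) to E³ is the box product of three copies of 𝒪(4·0),
and H⁰(E, 𝒪(4·0)) is spanned by 1, X, Y, X². So sections of 𝒪(4D₀ − G₀) should be the symmetric
tensors in three copies of this space that vanish on collinear triples. The base points turn out to
be the triples {0, Q, −Q} with Q of order three: eight points Q in four pairs ±Q, one pair for each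
root of the third division polynomial `psi3`.

No other base points. Five explicit tensors `F₁`, …, `F₅` vanish on G₀, and the first four have no
common zero off G₀ (`sum_eq_zero_of_T`). At a point of G₀ a base point forces the tensor to vanish
to second order, so its derivative must vanish when a single point of the triple moves
(`deriv_H_eq_zero_of_vanishesAt`, `tri_deriv_eq_zero`). These derivatives exclude affine collinear
triples, first without and then with a point of order two, exclude {0, 0, 0}, and force ψ₃(X(Q)) = 0
at {0, Q, −Q}. This is `exists_of_isBasePoint`.

The four points are simple base points. Every section does come from a symmetric tensor
(`exists_tensor`): its one-variable slices lie in the four-dimensional space above, and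
interpolation in two variables reconstructs it. Vanishing on all lines with three distinct points is
a system of linear relations between the coefficients; on D₀ only three parameters κ₁, κ₂, κ₃
survive (`IsSymm.tri_zero_eq`). On {0} × E × E an equation of G₀ is the difference of abscissae.
After division by it, all sections vanish at (Q, −Q) when ψ₃(X(Q)) = 0, and their derivatives along
two curves inside D₀ are explicit in the κᵢ (`exists_derivs`). The two derivatives have nonzero 2 ×
2 determinant on the pair `F₁`, `F₅`, so this determinant defines the required nonempty open set.

Two devices carry the geometry. Local equations of D₀ and G₀ (`exists_div_u0`, `exists_div_g0`) come
from replacing a point by 0, or by the third intersection point of a line, and noting that the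
homogeneous coordinates change by a multiple of the equation. Cotangent vectors are tested by
complex derivatives along curves (`IsParam`), along which regular functions are differentiable and
elements of 𝔪² have derivative zero. -/

open MvPolynomial
noncomputable section
namespace SymmetricCube

variable {W : WeierstrassCurve ℂ}

/-! ### Short Weierstrass coordinates -/

variable (W) in
/-- The coefficient `A` of the short model `Y² = X³ + A X + B`. -/
def sA : ℂ := -W.c₄ / 48

variable (W) in
/-- The coefficient `B` of the short model `Y² = X³ + A X + B`. -/
def sB : ℂ := -W.c₆ / 864

/-- By 1728 Δ = c₄³ − c₆², the discriminant Δ equals −16 (4A³ + 27B²). -/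
theorem disc_ne_zero [W.IsElliptic] : 4 * sA W ^ 3 + 27 * sB W ^ 2 ≠ 0 := by
  have h : W.Δ ≠ 0 := W.isUnit_Δ.ne_zero
  have h2 := W.c_relation
  intro h0
  apply h
  simp only [sA, sB] at h0
  linear_combination (1 / 1728 : ℂ) * h2 - 16 * h0

/-- The short coordinate `X` of an affine point. -/
def pX : Pt W → ℂ
  | .zero => 0
  | .some x _ _ => x + W.b₂ / 12

/-- The short coordinate `Y` of an affine point. -/
def pY : Pt W → ℂ
  | .zero => 0
  | .some x y _ => y + (W.a₁ * x + W.a₃) / 2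

open Classical in
/-- Homogeneous short coordinates. -/
def sc (Q : Pt W) : Fin 3 → ℂ := if Q = 0 then ![0, 1, 0] else ![pX Q, pY Q, 1]

@[simp] theorem sc_zero : sc (0 : Pt W) = ![0, 1, 0] := by simp [sc]

theorem sc_of_ne {Q : Pt W} (h : Q ≠ 0) : sc Q = ![pX Q, pY Q, 1] := by simp [sc, h]

/-- Completing the square in y and then the cube in x removes all coefficients except A and B. -/
theorem curve_eq {Q : Pt W} (h : Q ≠ 0) : pY Q ^ 2 = pX Q ^ 3 + sA W * pX Q + sB W := by
  rcases Q with _ | ⟨x, y, hQ⟩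
  · exact absurd rfl h
  · have := (WeierstrassCurve.Affine.equation_iff _ _).1 hQ.1
    simp only [pX, pY, sA, sB, WeierstrassCurve.c₄, WeierstrassCurve.c₆, WeierstrassCurve.b₂,
      WeierstrassCurve.b₄, WeierstrassCurve.b₆]
    linear_combination this

theorem pt_ext {Q R : Pt W} (hQ : Q ≠ 0) (hR : R ≠ 0) (hX : pX Q = pX R) (hY : pY Q = pY R) :
    Q = R := by
  rcases Q with _ | ⟨x, y, hxy⟩
  · exact absurd rfl hQ
  rcases R with _ | ⟨x', y', hxy'⟩
  · exact absurd rfl hR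
  simp only [pX, pY] at hX hY
  have h1 : x = x' := by linear_combination hX
  subst h1
  have h2 : y = y' := by linear_combination hY
  subst h2
  rfl

theorem exists_pt [W.IsElliptic] {x y : ℂ} (h : y ^ 2 = x ^ 3 + sA W * x + sB W) :
    ∃ Q : Pt W, Q ≠ 0 ∧ pX Q = x ∧ pY Q = y := by
  have : W.toAffine.Equation (x - W.b₂ / 12) (y - (W.a₁ * (x - W.b₂ / 12) + W.a₃) / 2) := by
    rw [WeierstrassCurve.Affine.equation_iff]
    simp only [sA, sB, WeierstrassCurve.c₄, WeierstrassCurve.c₆, WeierstrassCurve.b₂,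
      WeierstrassCurve.b₄, WeierstrassCurve.b₆] at h ⊢
    linear_combination h
  refine ⟨.some _ _ (WeierstrassCurve.Affine.equation_iff_nonsingular.1 this),
    WeierstrassCurve.Affine.Point.some_ne_zero _, ?_, ?_⟩ <;> simp [pX, pY]

theorem pX_neg (Q : Pt W) : pX (-Q) = pX Q := by
  rcases Q with _ | ⟨x, y, h⟩
  · rfl
  · rw [WeierstrassCurve.Affine.Point.neg_some]; rfl

theorem pY_neg (Q : Pt W) : pY (-Q) = -pY Q := by
  rcases Q with _ | ⟨x, y, h⟩
  · change (0 : ℂ) = -0; simp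
  · rw [WeierstrassCurve.Affine.Point.neg_some]
    simp only [pY, WeierstrassCurve.Affine.negY]; ring

/-- The root of the short cubic is simple. -/
theorem deriv_ne_zero_of_root [W.IsElliptic] {r : ℂ} (h : r ^ 3 + sA W * r + sB W = 0) :
    3 * r ^ 2 + sA W ≠ 0 := by
  intro h0
  apply disc_ne_zero (W := W)
  have hA : sA W = -3 * r ^ 2 := by linear_combination h0
  have hB : sB W = 2 * r ^ 3 := by linear_combination h - r * h0
  rw [hA, hB]; ring

/-! ### The group law and collinearity -/

/-- The relations between a line `Y = a X + b` and the abscissae of its three intersection points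
with the curve. -/
structure OnLine (a b : ℂ) (P Q R : Pt W) : Prop where
  y₁ : pY P = a * pX P + b
  y₂ : pY Q = a * pX Q + b
  y₃ : pY R = a * pX R + b
  e₁ : pX P + pX Q + pX R = a ^ 2
  e₂ : pX P * pX Q + pX P * pX R + pX Q * pX R = sA W - 2 * a * b
  e₃ : pX P * pX Q * pX R = b ^ 2 - sB W

/-- The chord and tangent formulas in short coordinates. The slope is described by the equation it
satisfies rather than by a quotient, so both cases share the formulas for the sum. -/
theorem add_formula {P Q : Pt W} (hP : P ≠ 0) (hQ : Q ≠ 0) (h : P + Q ≠ 0) :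
    ∃ a : ℂ, (pX P ≠ pX Q → a * (pX P - pX Q) = pY P - pY Q) ∧
      (pX P = pX Q → P = Q ∧ pY P ≠ 0 ∧ a * (2 * pY P) = 3 * pX P ^ 2 + sA W) ∧
      pX (P + Q) = a ^ 2 - pX P - pX Q ∧ pY (P + Q) = -(a * (pX (P + Q) - pX P) + pY P) := by
  rcases P with _ | ⟨x₁, y₁, h₁⟩
  · exact absurd rfl hP
  rcases Q with _ | ⟨x₂, y₂, h₂⟩
  · exact absurd rfl hQ
  have hxy : ¬(x₁ = x₂ ∧ y₁ = W.toAffine.negY x₂ y₂) := fun hc =>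
    h (WeierstrassCurve.Affine.Point.add_of_Y_eq hc.1 hc.2)
  rw [WeierstrassCurve.Affine.Point.add_some hxy]
  set ℓ := W.toAffine.slope x₁ x₂ y₁ y₂ with hℓ
  -- Passing to Y = y + (a₁x + a₃)/2 adds a₁/2 to the slope of every line.
  refine ⟨ℓ + W.a₁ / 2, ?_, ?_, ?_, ?_⟩
  · simp only [pX, pY]
    intro hx
    have hx' : x₁ ≠ x₂ := fun hc => hx (by rw [hc])
    rw [WeierstrassCurve.Affine.slope_of_X_ne hx'] at hℓ
    have h0 : x₁ - x₂ ≠ 0 := sub_ne_zero.2 hx'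
    have : ℓ * (x₁ - x₂) = y₁ - y₂ := by rw [hℓ]; field_simp
    linear_combination this
  · simp only [pX, pY]
    intro hx
    have hx' : x₁ = x₂ := by linear_combination hx
    have hy' : y₁ ≠ W.toAffine.negY x₂ y₂ := fun hc => hxy ⟨hx', hc⟩
    have hyy := WeierstrassCurve.Affine.Y_eq_of_Y_ne h₁.1 h₂.1 hx' hy'
    subst hx' hyy
    have h0 : y₁ - W.toAffine.negY x₁ y₁ ≠ 0 := sub_ne_zero.2 hy'
    have h1 : ℓ * (y₁ - W.toAffine.negY x₁ y₁) =
        3 * x₁ ^ 2 + 2 * W.a₂ * x₁ + W.a₄ - W.a₁ * y₁ := by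
      rw [hℓ, WeierstrassCurve.Affine.slope_of_Y_ne rfl hy', div_mul_cancel₀ _ h0]
    refine ⟨rfl, fun hc => h0 ?_, ?_⟩
    · simp only [WeierstrassCurve.Affine.negY]; linear_combination 2 * hc
    · simp only [WeierstrassCurve.Affine.negY] at h1
      simp only [sA, WeierstrassCurve.c₄, WeierstrassCurve.b₂, WeierstrassCurve.b₄]
      linear_combination h1
  · simp only [pX, WeierstrassCurve.Affine.addX, WeierstrassCurve.b₂]; ring
  · simp only [pX, pY, WeierstrassCurve.Affine.addX, WeierstrassCurve.Affine.addY,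
      WeierstrassCurve.Affine.negAddY, WeierstrassCurve.Affine.negY, WeierstrassCurve.b₂]; ring

/-- The line is the chord or tangent through P and Q, and R is its third point. The addition formula
gives e₁. The slope equation gives e₂: the tangent condition when P = Q, otherwise the difference of
the two curve equations divided by the difference of abscissae. The curve equation at P then gives
e₃. -/
theorem onLine_of_sum_eq_zero {P Q R : Pt W} (hP : P ≠ 0) (hQ : Q ≠ 0) (hR : R ≠ 0)
    (h : P + Q + R = 0) : ∃ a b, OnLine a b P Q R := by
  have hPQ : P + Q = -R := eq_neg_of_add_eq_zero_left h
  obtain ⟨a, h1, h2, h3, h4⟩ := add_formula hP hQ (by rw [hPQ]; exact neg_ne_zero.2 hR)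
  rw [hPQ, pX_neg] at h3
  rw [hPQ, pX_neg, pY_neg] at h4
  have cP := curve_eq hP
  have cQ := curve_eq hQ
  have cR := curve_eq hR
  have hyR : pY R = a * pX R + (pY P - a * pX P) := by linear_combination -h4
  by_cases hx : pX P = pX Q
  · obtain ⟨rfl, hy, hs⟩ := h2 hx
    refine ⟨a, pY P - a * pX P, by ring, by ring, hyR, by linear_combination h3, ?_, ?_⟩
    · rw [h3]; linear_combination hs
    · rw [h3]; linear_combination -cP + pX P * hs
  · have hs := h1 hx
    have hd : pX P - pX Q ≠ 0 := sub_ne_zero.2 hx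
    have e2 : pX P * pX Q + pX P * pX R + pX Q * pX R =
        sA W - 2 * a * (pY P - a * pX P) := by
      apply mul_left_cancel₀ hd
      have hyQ : pY Q = pY P - a * (pX P - pX Q) := by linear_combination hs
      rw [hyQ] at cQ
      rw [h3]
      linear_combination cP - cQ
    refine ⟨a, pY P - a * pX P, by ring, by linear_combination hs, hyR, by linear_combination h3,
      e2, ?_⟩
    rw [h3] at e2 ⊢
    linear_combination -cP + pX P * e2

/-- The symmetric-function relations encode intersection multiplicities, so the slope found by
`add_formula` has to agree with a even when points coincide. -/
theorem sum_eq_zero_of_onLine [W.IsElliptic] {P Q R : Pt W} (hP : P ≠ 0) (hQ : Q ≠ 0)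
    (hR : R ≠ 0) {a b : ℂ} (h : OnLine a b P Q R) : P + Q + R = 0 := by
  obtain ⟨y1, y2, y3, e1, e2, e3⟩ := h
  have cP := curve_eq hP
  -- If Q = −P, the line through both forces Y(P) = 0, and e₁, e₂ make the abscissa a root of 3X² +
  -- A as well as of the cubic, contradicting smoothness.
  have hPQ : P + Q ≠ 0 := by
    intro h0
    have hQ' : Q = -P := (neg_eq_of_add_eq_zero_right h0).symm
    have hX : pX Q = pX P := by rw [hQ', pX_neg]
    have hY : pY Q = -pY P := by rw [hQ', pY_neg]
    rw [hX] at y2 e1 e2 e3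
    rw [hY] at y2
    have hb : a * pX P + b = 0 := by linear_combination (-1/2) * y1 + (-1/2) * y2
    have hY0 : pY P = 0 := by rw [y1, hb]
    rw [hY0] at cP
    have := deriv_ne_zero_of_root (W := W) (r := pX P) (by linear_combination -cP)
    apply this
    linear_combination -e2 + 2 * pX P * e1 + 2 * a * hb
  obtain ⟨a', h1, h2, h3, h4⟩ := add_formula hP hQ hPQ
  have haa : a' = a := by
    by_cases hx : pX P = pX Q
    · obtain ⟨rfl, hy, hs⟩ := h2 hx
      apply mul_right_cancel₀ (mul_ne_zero two_ne_zero hy)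
      rw [hs]
      linear_combination -e2 + 2 * pX P * e1 - 2 * a * y1
    · apply mul_right_cancel₀ (sub_ne_zero.2 hx)
      rw [h1 hx]
      linear_combination y1 - y2
  subst haa
  have : P + Q = -R := by
    apply pt_ext hPQ (neg_ne_zero.2 hR)
    · rw [pX_neg, h3]; linear_combination -e1
    · rw [pY_neg, h4, h3]; linear_combination -y1 + y3 + a' * e1
  rw [this, neg_add_cancel]

/-- The determinant of three vectors of `ℂ³`. -/
def det3 (a b c : Fin 3 → ℂ) : ℂ :=
  a 0 * (b 1 * c 2 - b 2 * c 1) - a 1 * (b 0 * c 2 - b 2 * c 0) + a 2 * (b 0 * c 1 - b 1 * c 0)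

theorem det_eq_zero_of_sum_eq_zero {P Q R : Pt W} (h : P + Q + R = 0) :
    det3 (sc P) (sc Q) (sc R) = 0 := by
  by_cases hP : P = 0
  · subst hP
    have : R = -Q := by rw [zero_add] at h; exact (neg_eq_of_add_eq_zero_right h).symm
    by_cases hQ : Q = 0
    · subst hQ; simp [det3]
    · rw [this, sc_of_ne hQ, sc_of_ne (neg_ne_zero.2 hQ), pX_neg]; simp [det3]
  by_cases hQ : Q = 0
  · subst hQ
    have : R = -P := by rw [add_zero] at h; exact (neg_eq_of_add_eq_zero_right h).symm
    rw [this, sc_of_ne hP, sc_of_ne (neg_ne_zero.2 hP), pX_neg]; simp [det3]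
  by_cases hR : R = 0
  · subst hR
    have : Q = -P := by rw [add_zero] at h; exact (neg_eq_of_add_eq_zero_right h).symm
    rw [this, sc_of_ne hP, sc_of_ne (neg_ne_zero.2 hP), pX_neg]; simp [det3]
  obtain ⟨a, b, hl⟩ := onLine_of_sum_eq_zero hP hQ hR h
  rw [sc_of_ne hP, sc_of_ne hQ, sc_of_ne hR, hl.y₁, hl.y₂, hl.y₃]
  simp [det3]; ring

theorem eq_or_eq_neg_of_pX_eq {P Q : Pt W} (hP : P ≠ 0) (hQ : Q ≠ 0) (h : pX P = pX Q) :
    P = Q ∨ P = -Q := by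
  have cP := curve_eq hP
  have cQ := curve_eq hQ
  have : (pY P - pY Q) * (pY P + pY Q) = 0 := by rw [h] at cP; linear_combination cP - cQ
  rcases mul_eq_zero.1 this with h0 | h0
  · exact Or.inl (pt_ext hP hQ h (sub_eq_zero.1 h0))
  · refine Or.inr (pt_ext hP (neg_ne_zero.2 hQ) (by rw [pX_neg, h]) ?_)
    rw [pY_neg]; linear_combination h0

/-- With distinct points the Vieta relations follow by divided differences of X³ + AX + B − (aX +
b)². Distinctness is essential: a repeated point makes the determinant vanish without tangency. -/
theorem sum_eq_zero_of_det_eq_zero [W.IsElliptic] {P Q R : Pt W} (hPQ : P ≠ Q) (hPR : P ≠ R)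
    (hQR : Q ≠ R) (h : det3 (sc P) (sc Q) (sc R) = 0) : P + Q + R = 0 := by
  by_cases hP : P = 0
  · subst hP
    have hQ := hPQ.symm
    have hR := hPR.symm
    rw [sc_of_ne hQ, sc_of_ne hR] at h
    have hX : pX Q = pX R := by simp [det3] at h; linear_combination -h
    rcases eq_or_eq_neg_of_pX_eq hQ hR hX with h1 | h1
    · exact absurd h1 hQR
    · rw [h1]; simp
  by_cases hQ : Q = 0
  · subst hQ
    have hR := hQR.symm
    rw [sc_of_ne hP, sc_of_ne hR] at h
    have hX : pX P = pX R := by simp [det3] at h; linear_combination h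
    rcases eq_or_eq_neg_of_pX_eq hP hR hX with h1 | h1
    · exact absurd h1 hPR
    · rw [h1]; simp
  by_cases hR : R = 0
  · subst hR
    rw [sc_of_ne hP, sc_of_ne hQ] at h
    have hX : pX P = pX Q := by simp [det3] at h; linear_combination -h
    rcases eq_or_eq_neg_of_pX_eq hP hQ hX with h1 | h1
    · exact absurd h1 hPQ
    · rw [h1]; simp
  rw [sc_of_ne hP, sc_of_ne hQ, sc_of_ne hR] at h
  simp [det3] at h
  -- A vertical line meets the affine curve only in a point and its negative, so three distinct
  -- collinear affine points have distinct abscissae.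
  have key : ∀ {S T U : Pt W}, S ≠ 0 → T ≠ 0 → U ≠ 0 → S ≠ T → S ≠ U → T ≠ U →
      (pX S * (pY T - pY U) - pY S * (pX T - pX U) + (pX T * pY U - pY T * pX U) = 0) →
      pX S ≠ pX T := by
    intro S T U hS hT hU hST hSU hTU hd hX
    have cS := curve_eq hS
    rcases eq_or_eq_neg_of_pX_eq hS hT hX with h1 | h1
    · exact hST h1
    · have hY : pY S = -pY T := by rw [h1, pY_neg]
      have h2 : pY T * (pX T - pX U) = 0 := by rw [hX, hY] at hd; linear_combination hd / 2
      rcases mul_eq_zero.1 h2 with h3 | h3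
      · exact hST (pt_ext hS hT hX (by rw [hY, h3, neg_zero]))
      · have hX2 : pX T = pX U := sub_eq_zero.1 h3
        rcases eq_or_eq_neg_of_pX_eq hT hU hX2 with h4 | h4
        · exact hTU h4
        · exact hSU (by rw [h1, h4, neg_neg])
  have h12 := key hP hQ hR hPQ hPR hQR h
  have h13 := key hP hR hQ hPR hPQ hQR.symm (by linear_combination -h)
  have h23 := key hQ hR hP hQR hPQ.symm hPR.symm (by linear_combination h)
  have d12 := sub_ne_zero.2 h12
  have d13 := sub_ne_zero.2 h13
  have d23 := sub_ne_zero.2 h23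
  have cP := curve_eq hP
  have cQ := curve_eq hQ
  have cR := curve_eq hR
  obtain ⟨a, ha⟩ : ∃ a, a * (pX P - pX Q) = pY P - pY Q := ⟨_, div_mul_cancel₀ _ d12⟩
  have hyQ : pY Q = a * pX Q + (pY P - a * pX P) := by linear_combination ha
  have hyR : pY R = a * pX R + (pY P - a * pX P) := by
    apply mul_left_cancel₀ d12
    linear_combination -h + (pX P - pX R) * ha
  have yP : pY P = a * pX P + (pY P - a * pX P) := by ring
  generalize pY P - a * pX P = b at *
  rw [yP] at cP
  rw [hyQ] at cQ
  rw [hyR] at cR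
  have q12 : pX P ^ 2 + pX P * pX Q + pX Q ^ 2 - a ^ 2 * (pX P + pX Q) + sA W - 2 * a * b = 0 := by
    apply mul_left_cancel₀ d12; linear_combination cQ - cP
  have q13 : pX P ^ 2 + pX P * pX R + pX R ^ 2 - a ^ 2 * (pX P + pX R) + sA W - 2 * a * b = 0 := by
    apply mul_left_cancel₀ d13; linear_combination cR - cP
  have e1 : pX P + pX Q + pX R = a ^ 2 := by
    apply mul_left_cancel₀ d23; linear_combination q12 - q13
  have e2 : pX P * pX Q + pX P * pX R + pX Q * pX R = sA W - 2 * a * b := by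
    linear_combination -q12 + (pX P + pX Q) * e1
  refine sum_eq_zero_of_onLine hP hQ hR ⟨yP, hyQ, hyR, e1, e2, ?_⟩
  linear_combination pX P * e2 - pX P ^ 2 * e1 - cP

/-! ### Homogeneous coordinates of points in the short model -/

/-- The homogeneous cubic form of the short model. -/
def cubicForm (W : WeierstrassCurve ℂ) (v : Fin 3 → ℂ) : ℂ :=
  v 1 ^ 2 * v 2 - v 0 ^ 3 - sA W * v 0 * v 2 ^ 2 - sB W * v 2 ^ 3

theorem cubicForm_smul (l : ℂ) (v : Fin 3 → ℂ) :
    cubicForm W (l • v) = l ^ 3 * cubicForm W v := by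
  simp [cubicForm]; ring

theorem cubicForm_sc (Q : Pt W) : cubicForm W (sc Q) = 0 := by
  by_cases h : Q = 0
  · subst h; simp [cubicForm]
  · have := curve_eq h
    simp [cubicForm, sc_of_ne h]; linear_combination this

theorem sc_ne_zero (Q : Pt W) : sc Q ≠ 0 := by
  intro h0
  by_cases h : Q = 0
  · subst h; simpa using congrFun h0 1
  · rw [sc_of_ne h] at h0; simpa using congrFun h0 2

theorem exists_sc_eq_smul [W.IsElliptic] {v : Fin 3 → ℂ} (hv : v ≠ 0) (h : cubicForm W v = 0) :
    ∃ (Q : Pt W) (l : ℂ), l ≠ 0 ∧ sc Q = l • v := by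
  by_cases h2 : v 2 = 0
  · have h0 : v 0 = 0 := by simpa [cubicForm, h2] using h
    have h1 : v 1 ≠ 0 := by
      intro h1; apply hv; ext i; fin_cases i <;> simp [h0, h1, h2]
    refine ⟨0, (v 1)⁻¹, inv_ne_zero h1, ?_⟩
    rw [sc_zero]
    ext i; fin_cases i <;> simp [h0, h2, h1]
  · obtain ⟨Q, hQ, hX, hY⟩ := exists_pt (W := W) (x := v 0 / v 2) (y := v 1 / v 2) (by
      simp only [cubicForm] at h
      field_simp
      linear_combination h)
    refine ⟨Q, (v 2)⁻¹, inv_ne_zero h2, ?_⟩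
    rw [sc_of_ne hQ, hX, hY]
    ext i; fin_cases i <;> simp [h2] <;> field_simp

theorem sc_injective_smul {Q R : Pt W} {l : ℂ} (h : sc Q = l • sc R) : Q = R := by
  have hl : l ≠ 0 := by rintro rfl; exact sc_ne_zero Q (by simpa using h)
  by_cases hQ : Q = 0 <;> by_cases hR : R = 0
  · rw [hQ, hR]
  · rw [hQ, sc_zero, sc_of_ne hR] at h
    have := congrFun h 2; simp at this; exact absurd this.symm hl
  · rw [hR, sc_zero, sc_of_ne hQ] at h
    have := congrFun h 2; simp at this
  · rw [sc_of_ne hQ, sc_of_ne hR] at h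
    have h2 := congrFun h 2; simp at h2
    subst h2
    exact pt_ext hQ hR (by simpa using congrFun h 0) (by simpa using congrFun h 1)

theorem sc_apply_two_ne_zero_iff (Q : Pt W) : sc Q 2 ≠ 0 ↔ Q ≠ 0 := by
  by_cases h : Q = 0
  · subst h; simp
  · simp [sc_of_ne h, h]

/-! ### Multihomogeneous polynomials -/

/-- The value of a polynomial in three triples of variables at three vectors. -/
def cev (N : MvPolynomial (Fin 3 × Fin 3) ℂ) (v : Fin 3 → Fin 3 → ℂ) : ℂ :=
  eval (fun j => v j.1 j.2) N

/-- The value of a polynomial at the short coordinates of a point of `E³`. -/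
def sev (N : MvPolynomial (Fin 3 × Fin 3) ℂ) (P : Fin 3 → Pt W) : ℂ := cev N fun i => sc (P i)

theorem sev_mul (N M : MvPolynomial (Fin 3 × Fin 3) ℂ) (P : Fin 3 → Pt W) :
    sev (N * M) P = sev N P * sev M P := by simp [sev, cev]

theorem IsMultihom.sum_eq {N : MvPolynomial (Fin 3 × Fin 3) ℂ} {d : Fin 3 → ℕ}
    (hN : IsMultihom N d) {m : Fin 3 × Fin 3 →₀ ℕ} (hm : coeff m N ≠ 0) (i : Fin 3) :
    ∑ k, m (i, k) = d i := by
  have h := congrFun (hN hm) i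
  rw [← h, Finsupp.weight_apply, Finsupp.sum_fintype _ _ (by simp), Finset.sum_apply,
    Fintype.sum_prod_type]
  simp only [Pi.smul_apply, Pi.single_apply, smul_eq_mul, mul_ite, mul_one, mul_zero]
  simp

theorem cev_smul {N : MvPolynomial (Fin 3 × Fin 3) ℂ} {d : Fin 3 → ℕ} (hN : IsMultihom N d)
    (l : Fin 3 → ℂ) (v : Fin 3 → Fin 3 → ℂ) :
    cev N (fun i => l i • v i) = (∏ i, l i ^ d i) * cev N v := by
  unfold cev
  rw [eval_eq', eval_eq', Finset.mul_sum]
  refine Finset.sum_congr rfl fun m hm => ?_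
  have hm' := hN.sum_eq (mem_support_iff.1 hm)
  simp only [Pi.smul_apply, smul_eq_mul, mul_pow, Finset.prod_mul_distrib]
  have : ∏ j : Fin 3 × Fin 3, l j.1 ^ m j = ∏ i, l i ^ d i := by
    rw [Fintype.prod_prod_type]
    refine Finset.prod_congr rfl fun i _ => ?_
    rw [← hm' i, ← Finset.prod_pow_eq_pow_sum]
  rw [this]; ring

/-- The homomorphism f records how a substitution moves multidegrees: the identity for linear
changes within each factor, a permutation when the factors are exchanged. -/
theorem IsMultihom.aeval {N : MvPolynomial (Fin 3 × Fin 3) ℂ} {d : Fin 3 → ℕ}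
    (hN : IsMultihom N d) (f : (Fin 3 → ℕ) →+ (Fin 3 → ℕ))
    {l : Fin 3 × Fin 3 → MvPolynomial (Fin 3 × Fin 3) ℂ}
    (hl : ∀ j, IsMultihom (l j) (f (Pi.single j.1 1))) :
    IsMultihom (MvPolynomial.aeval l N) (f d) := by
  rw [MvPolynomial.aeval_def, eval₂_eq']
  refine IsWeightedHomogeneous.sum _ _ _ fun m hm => ?_
  have h1 : IsMultihom (∏ j, l j ^ m j) (∑ j, m j • f (Pi.single j.1 1)) :=
    IsWeightedHomogeneous.prod _ _ _ fun j _ => (hl j).pow (m j)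
  have h2 : ∑ j, m j • f (Pi.single j.1 1) = f d := by
    rw [← hN (mem_support_iff.1 hm), Finsupp.weight_apply, Finsupp.sum_fintype _ _ (by simp),
      map_sum]
    simp only [map_nsmul]
  rw [h2] at h1
  exact IsWeightedHomogeneous.C_mul h1 _

theorem eval_aeval {σ τ : Type*} (v : τ → ℂ) (l : σ → MvPolynomial τ ℂ) (N : MvPolynomial σ ℂ) :
    eval v (aeval l N) = eval (fun j => eval v (l j)) N := by
  induction N using MvPolynomial.induction_on with
  | C a => simp
  | add p q hp hq => simp only [map_add, hp, hq]
  | mul_X p j hp => simp only [map_mul, hp, aeval_X, eval_X]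

theorem isMultihom_X (j : Fin 3 × Fin 3) :
    IsMultihom (X j : MvPolynomial (Fin 3 × Fin 3) ℂ) (Pi.single j.1 1) :=
  isWeightedHomogeneous_X _ _ _

theorem isMultihom_linear (i : Fin 3) (L : Fin 3 → ℂ) :
    IsMultihom (∑ k, C (L k) * X (i, k) : MvPolynomial (Fin 3 × Fin 3) ℂ) (Pi.single i 1) :=
  IsWeightedHomogeneous.sum _ _ _ fun k _ => (isMultihom_X (i, k)).C_mul _

variable (W) in
/-- The matrix of the change from the given to the short coordinates. -/
def toShort : Fin 3 → Fin 3 → ℂ :=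
  ![![1, 0, W.b₂ / 12], ![W.a₁ / 2, 1, W.a₃ / 2], ![0, 0, 1]]

variable (W) in
/-- The matrix of the change from the short to the given coordinates. -/
def ofShort : Fin 3 → Fin 3 → ℂ :=
  ![![1, 0, -W.b₂ / 12], ![-W.a₁ / 2, 1, W.a₁ * W.b₂ / 24 - W.a₃ / 2], ![0, 0, 1]]

theorem sc_eq_toShort (Q : Pt W) (k : Fin 3) : sc Q k = ∑ l, toShort W k l * homCoord W Q l := by
  rcases Q with _ | ⟨x, y, h⟩
  · change sc 0 k = _
    fin_cases k <;> simp [toShort, homCoord, Fin.sum_univ_three]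
  · rw [sc_of_ne (WeierstrassCurve.Affine.Point.some_ne_zero _)]
    fin_cases k <;> simp [toShort, homCoord, Fin.sum_univ_three, pX, pY]
    ring

theorem homCoord_eq_ofShort (Q : Pt W) (k : Fin 3) :
    homCoord W Q k = ∑ l, ofShort W k l * sc Q l := by
  rcases Q with _ | ⟨x, y, h⟩
  · change _ = ∑ l, ofShort W k l * sc 0 l
    fin_cases k <;> simp [ofShort, homCoord, Fin.sum_univ_three]
  · rw [sc_of_ne (WeierstrassCurve.Affine.Point.some_ne_zero _)]
    fin_cases k <;> simp [ofShort, homCoord, Fin.sum_univ_three, pX, pY] <;> ring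

variable (W) in
/-- The polynomial in the given coordinates corresponding to one in the short coordinates. -/
def shortPoly (N : MvPolynomial (Fin 3 × Fin 3) ℂ) : MvPolynomial (Fin 3 × Fin 3) ℂ :=
  aeval (fun j : Fin 3 × Fin 3 => ∑ k, C (toShort W j.2 k) * X (j.1, k)) N

variable (W) in
/-- The polynomial in the short coordinates corresponding to one in the given coordinates. -/
def unshortPoly (N : MvPolynomial (Fin 3 × Fin 3) ℂ) : MvPolynomial (Fin 3 × Fin 3) ℂ :=
  aeval (fun j : Fin 3 × Fin 3 => ∑ k, C (ofShort W j.2 k) * X (j.1, k)) N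

theorem isMultihom_shortPoly {N : MvPolynomial (Fin 3 × Fin 3) ℂ} {d : Fin 3 → ℕ}
    (hN : IsMultihom N d) : IsMultihom (shortPoly W N) d :=
  hN.aeval (AddMonoidHom.id _) fun j => isMultihom_linear j.1 _

theorem isMultihom_unshortPoly {N : MvPolynomial (Fin 3 × Fin 3) ℂ} {d : Fin 3 → ℕ}
    (hN : IsMultihom N d) : IsMultihom (unshortPoly W N) d :=
  hN.aeval (AddMonoidHom.id _) fun j => isMultihom_linear j.1 _

theorem eval_shortPoly (N : MvPolynomial (Fin 3 × Fin 3) ℂ) (P : Fin 3 → Pt W) :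
    eval (coords W P) (shortPoly W N) = sev N P := by
  rw [shortPoly, sev, cev, eval_aeval]
  congr 2
  funext j
  simp [sc_eq_toShort, coords]

theorem sev_unshortPoly (N : MvPolynomial (Fin 3 × Fin 3) ℂ) (P : Fin 3 → Pt W) :
    sev (unshortPoly W N) P = eval (coords W P) N := by
  rw [unshortPoly, sev, cev, eval_aeval]
  congr 2
  funext j
  simp [homCoord_eq_ofShort, coords]

/-! ### Open sets and regular functions of the cube -/

/-- Zariski open subsets of `E³`. -/
abbrev Opn (U : Set (Fin 3 → Pt W)) : Prop := (cube W).IsOpn U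

/-- Regular functions on `E³`. -/
abbrev Reg (U : Set (Fin 3 → Pt W)) (f : (Fin 3 → Pt W) → ℂ) : Prop := (cube W).RegularOn U f

theorem Opn.inter {U V : Set (Fin 3 → Pt W)} (hU : Opn U) (hV : Opn V) : Opn (U ∩ V) :=
  (zariskiTopology W).isOpen_inter _ _ hU hV

theorem opn_of_local {U : Set (Fin 3 → Pt W)}
    (h : ∀ P ∈ U, ∃ V, Opn V ∧ P ∈ V ∧ V ⊆ U) : Opn U := by
  have : U = ⋃₀ {V | Opn V ∧ V ⊆ U} := by
    ext P
    constructor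
    · intro hP
      obtain ⟨V, h1, h2, h3⟩ := h P hP
      exact ⟨V, ⟨h1, h3⟩, h2⟩
    · rintro ⟨V, ⟨_, h3⟩, h2⟩
      exact h3 h2
  rw [this]
  exact (zariskiTopology W).isOpen_sUnion _ fun V hV => hV.1

theorem opn_sev {N : MvPolynomial (Fin 3 × Fin 3) ℂ} {d : Fin 3 → ℕ} (hN : IsMultihom N d) :
    Opn {P : Fin 3 → Pt W | sev N P ≠ 0} := by
  refine TopologicalSpace.isOpen_generateFrom_of_mem ⟨d, shortPoly W N, isMultihom_shortPoly hN, ?_⟩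
  simp only [eval_shortPoly]

/-- Non-vanishing loci are stable under intersection, by multiplying the polynomials, so they form a
basis and not merely a subbasis. -/
theorem exists_basic {U : Set (Fin 3 → Pt W)} (hU : Opn U) {P : Fin 3 → Pt W} (hP : P ∈ U) :
    ∃ (d : Fin 3 → ℕ) (M : MvPolynomial (Fin 3 × Fin 3) ℂ), IsMultihom M d ∧ sev M P ≠ 0 ∧
      ∀ Q, sev M Q ≠ 0 → Q ∈ U := by
  let := zariskiTopology W
  have hb := TopologicalSpace.isTopologicalBasis_of_subbasis_of_inter
    (t := zariskiTopology W) (r := {U | ∃ (d : Fin 3 → ℕ) (N : MvPolynomial (Fin 3 × Fin 3) ℂ),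
      IsMultihom N d ∧ U = {P | eval (coords W P) N ≠ 0}}) rfl (by
    rintro _ ⟨d, N, hN, rfl⟩ _ ⟨d', N', hN', rfl⟩
    refine ⟨d + d', N * N', hN.mul hN', ?_⟩
    ext P; simp)
  obtain ⟨V, hV, hPV, hVU⟩ := hb.exists_subset_of_mem_open hP hU
  rcases hV with rfl | ⟨d, N, hN, rfl⟩
  · exact ⟨0, C 1, isWeightedHomogeneous_C _ _, by simp [sev, cev], fun Q _ => hVU trivial⟩
  · refine ⟨d, unshortPoly W N, isMultihom_unshortPoly hN, ?_, fun Q hQ => hVU ?_⟩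
    · rw [sev_unshortPoly]; exact hPV
    · rw [sev_unshortPoly] at hQ; exact hQ

/-- The polynomial M cuts out the neighbourhood on which the fraction is valid. The division lemmas
work with N · M, which vanishes at a substituted point both when that point leaves the neighbourhood
and when it stays and the function vanishes there. -/
theorem Reg.exists_frac {U : Set (Fin 3 → Pt W)} {f : (Fin 3 → Pt W) → ℂ} (hf : Reg U f)
    {P : Fin 3 → Pt W} (hP : P ∈ U) :
    ∃ (e d : Fin 3 → ℕ) (M N D : MvPolynomial (Fin 3 × Fin 3) ℂ), IsMultihom M e ∧
      IsMultihom N d ∧ IsMultihom D d ∧ sev M P ≠ 0 ∧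
      ∀ Q, sev M Q ≠ 0 → Q ∈ U ∧ sev D Q ≠ 0 ∧ f Q = sev N Q / sev D Q := by
  obtain ⟨V, hV, hPV, hVU, d, N, D, hN, hD, h⟩ := hf P hP
  obtain ⟨e, M, hM, hMP, hMV⟩ := exists_basic hV hPV
  refine ⟨e, d, M, unshortPoly W N, unshortPoly W D, hM, isMultihom_unshortPoly hN,
    isMultihom_unshortPoly hD, hMP, fun Q hQ => ⟨hVU (hMV Q hQ), ?_⟩⟩
  simp only [sev_unshortPoly]
  exact h Q (hMV Q hQ)

theorem reg_of_frac {U : Set (Fin 3 → Pt W)} (hU : Opn U) {f : (Fin 3 → Pt W) → ℂ}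
    {d : Fin 3 → ℕ} {N D : MvPolynomial (Fin 3 × Fin 3) ℂ} (hN : IsMultihom N d)
    (hD : IsMultihom D d) (h : ∀ Q ∈ U, sev D Q ≠ 0 ∧ f Q = sev N Q / sev D Q) : Reg U f := by
  intro P hP
  refine ⟨U, hU, hP, subset_rfl, d, shortPoly W N, shortPoly W D, isMultihom_shortPoly hN,
    isMultihom_shortPoly hD, fun Q hQ => ?_⟩
  simp only [eval_shortPoly]
  exact h Q hQ

theorem reg_of_local {U : Set (Fin 3 → Pt W)} {f : (Fin 3 → Pt W) → ℂ}
    (h : ∀ P ∈ U, ∃ V, Opn V ∧ P ∈ V ∧ V ⊆ U ∧ Reg V f) : Reg U f := by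
  intro P hP
  obtain ⟨V, hV, hPV, hVU, hr⟩ := h P hP
  obtain ⟨V', h1, h2, h3, h4⟩ := hr P hPV
  exact ⟨V', h1, h2, h3.trans hVU, h4⟩

theorem Reg.congr {U : Set (Fin 3 → Pt W)} {f f' : (Fin 3 → Pt W) → ℂ} (hf : Reg U f)
    (h : ∀ P ∈ U, f' P = f P) : Reg U f' := by
  intro P hP
  obtain ⟨V, h1, h2, h3, d, N, D, hN, hD, h4⟩ := hf P hP
  exact ⟨V, h1, h2, h3, d, N, D, hN, hD, fun Q hQ => by rw [h Q (h3 hQ)]; exact h4 Q hQ⟩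

theorem Reg.mono {U V : Set (Fin 3 → Pt W)} {f : (Fin 3 → Pt W) → ℂ} (hf : Reg U f)
    (hV : Opn V) (h : V ⊆ U) : Reg V f := cube_regularOn_mono hV h hf

theorem Reg.add {U : Set (Fin 3 → Pt W)} {f f' : (Fin 3 → Pt W) → ℂ} (hf : Reg U f)
    (hf' : Reg U f') : Reg U (fun P => f P + f' P) := cube_regularOn_add hf hf'

theorem Reg.mul {U : Set (Fin 3 → Pt W)} {f f' : (Fin 3 → Pt W) → ℂ} (hf : Reg U f)
    (hf' : Reg U f') : Reg U (fun P => f P * f' P) := cube_regularOn_mul hf hf'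

theorem reg_const {U : Set (Fin 3 → Pt W)} (hU : Opn U) (c : ℂ) : Reg U (fun _ => c) :=
  cube_regularOn_const U hU c

theorem Reg.const_mul {U : Set (Fin 3 → Pt W)} (hU : Opn U) {f : (Fin 3 → Pt W) → ℂ}
    (hf : Reg U f) (c : ℂ) : Reg U (fun P => c * f P) := (reg_const hU c).mul hf

theorem Reg.sub {U : Set (Fin 3 → Pt W)} (hU : Opn U) {f f' : (Fin 3 → Pt W) → ℂ} (hf : Reg U f)
    (hf' : Reg U f') : Reg U (fun P => f P - f' P) :=
  (hf.add (hf'.const_mul hU (-1))).congr fun P _ => by ring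

theorem Reg.pow {U : Set (Fin 3 → Pt W)} (hU : Opn U) {f : (Fin 3 → Pt W) → ℂ} (hf : Reg U f)
    (n : ℕ) : Reg U (fun P => f P ^ n) := by
  induction n with
  | zero => simpa using reg_const hU 1
  | succ n ih => simpa [pow_succ] using ih.mul hf

theorem Reg.sum {ι : Type*} {U : Set (Fin 3 → Pt W)} (hU : Opn U) (s : Finset ι)
    {f : ι → (Fin 3 → Pt W) → ℂ} (hf : ∀ i ∈ s, Reg U (f i)) :
    Reg U (fun P => ∑ i ∈ s, f i P) := by
  classical
  induction s using Finset.induction_on with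
  | empty => simpa using reg_const hU 0
  | insert a s ha ih =>
    simp only [Finset.sum_insert ha]
    exact (hf a (Finset.mem_insert_self _ _)).add
      (ih fun i hi => hf i (Finset.mem_insert_of_mem hi))

theorem Reg.inv {U : Set (Fin 3 → Pt W)} {f : (Fin 3 → Pt W) → ℂ} (hf : Reg U f)
    (h : ∀ P ∈ U, f P ≠ 0) : Reg U (fun P => (f P)⁻¹) := by
  intro P hP
  obtain ⟨V, h1, h2, h3, d, N, D, hN, hD, h4⟩ := hf P hP
  refine ⟨V, h1, h2, h3, d, D, N, hD, hN, fun Q hQ => ?_⟩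
  have h5 := h4 Q hQ
  have h6 := h Q (h3 hQ)
  rw [h5.2] at h6
  exact ⟨(div_ne_zero_iff.1 h6).1, by simp only [h5.2, inv_div]⟩

theorem Reg.div {U : Set (Fin 3 → Pt W)} {f f' : (Fin 3 → Pt W) → ℂ} (hf : Reg U f)
    (hf' : Reg U f') (h : ∀ P ∈ U, f' P ≠ 0) : Reg U (fun P => f P / f' P) := by
  simpa only [div_eq_mul_inv] using hf.mul (hf'.inv h)

theorem Reg.opn_ne {U : Set (Fin 3 → Pt W)} {f : (Fin 3 → Pt W) → ℂ} (hf : Reg U f) :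
    Opn {P | P ∈ U ∧ f P ≠ 0} := by
  refine opn_of_local ?_
  rintro P ⟨hP, hfP⟩
  obtain ⟨e, d, M, N, D, hM, hN, hD, hMP, h⟩ := hf.exists_frac hP
  refine ⟨{Q | sev (M * N) Q ≠ 0}, opn_sev (hM.mul hN), ?_, fun Q hQ => ?_⟩
  · have := (h P hMP).2.2
    rw [this] at hfP
    rw [Set.mem_ofPred_eq, sev_mul]
    exact mul_ne_zero hMP (div_ne_zero_iff.1 hfP).1
  · rw [Set.mem_ofPred_eq, sev_mul] at hQ
    obtain ⟨h1, h2, h3⟩ := h Q (left_ne_zero_of_mul hQ)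
    exact ⟨h1, by rw [h3]; exact div_ne_zero (right_ne_zero_of_mul hQ) h2⟩

/-! ### Permutations of the factors -/

theorem perm_aux (σ : Equiv.Perm (Fin 3)) {N : MvPolynomial (Fin 3 × Fin 3) ℂ} {d : Fin 3 → ℕ}
    (hN : IsMultihom N d) : ∃ N', IsMultihom N' (d ∘ σ.symm) ∧
      ∀ P : Fin 3 → Pt W, sev N' P = sev N (P ∘ σ) := by
  let f : (Fin 3 → ℕ) →+ (Fin 3 → ℕ) :=
    { toFun := fun d => d ∘ σ.symm, map_zero' := rfl, map_add' := fun _ _ => rfl }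
  refine ⟨aeval (fun j : Fin 3 × Fin 3 => X (σ j.1, j.2)) N, hN.aeval f fun j => ?_, fun P => ?_⟩
  · have : f (Pi.single j.1 1) = Pi.single (σ j.1) 1 := by
      funext i
      simp [f, Pi.single_apply, Equiv.symm_apply_eq]
    rw [this]
    exact isMultihom_X (σ j.1, j.2)
  · rw [sev, cev, eval_aeval]
    simp [sev, cev]

theorem Reg.perm {U : Set (Fin 3 → Pt W)} {f : (Fin 3 → Pt W) → ℂ} (hf : Reg U f)
    (σ : Equiv.Perm (Fin 3)) : Reg {P | P ∘ σ ∈ U} (fun P => f (P ∘ σ)) := by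
  refine reg_of_local fun P hP => ?_
  obtain ⟨e, d, M, N, D, hM, hN, hD, hMP, h⟩ := hf.exists_frac hP
  obtain ⟨M', hM', hM2⟩ := perm_aux (W := W) σ hM
  obtain ⟨N', hN', hN2⟩ := perm_aux (W := W) σ hN
  obtain ⟨D', hD', hD2⟩ := perm_aux (W := W) σ hD
  refine ⟨{Q | sev M' Q ≠ 0}, opn_sev hM', by simpa [hM2] using hMP,
    fun Q hQ => (h _ (by simpa [hM2] using hQ)).1, reg_of_frac (opn_sev hM') hN' hD' fun Q hQ => ?_⟩
  rw [hN2, hD2]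
  exact (h _ (by simpa [hM2] using hQ)).2

/-! ### Normalized coordinates -/

/-- The value of a linear form at the short coordinates of a point. -/
def lin (L : Fin 3 → ℂ) (Q : Pt W) : ℂ := ∑ k, L k * sc Q k

/-- Short coordinates normalized by a linear form. -/
def nc (L : Fin 3 → ℂ) (Q : Pt W) : Fin 3 → ℂ := (lin L Q)⁻¹ • sc Q

theorem sev_linear (i : Fin 3) (L : Fin 3 → ℂ) (P : Fin 3 → Pt W) :
    sev (∑ k, C (L k) * X (i, k)) P = lin L (P i) := by
  simp [sev, cev, lin]

theorem opn_lin (L : Fin 3 → ℂ) : Opn {P : Fin 3 → Pt W | ∀ i, lin L (P i) ≠ 0} := by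
  have := opn_sev (W := W) (((isMultihom_linear 0 L).mul (isMultihom_linear 1 L)).mul
    (isMultihom_linear 2 L))
  convert! this using 1
  ext P
  simp [sev_mul, sev_linear, Fin.forall_fin_succ, and_assoc]

theorem reg_nc {U : Set (Fin 3 → Pt W)} (hU : Opn U) {L : Fin 3 → ℂ}
    (h : ∀ P ∈ U, ∀ i, lin L (P i) ≠ 0) (i k : Fin 3) : Reg U (fun P => nc L (P i) k) := by
  refine reg_of_frac hU (isMultihom_X (i, k)) (isMultihom_linear i L) fun Q hQ => ?_
  rw [sev_linear]
  refine ⟨h Q hQ i, ?_⟩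
  simp [sev, cev, nc, div_eq_inv_mul]

theorem cubicForm_nc (L : Fin 3 → ℂ) (Q : Pt W) : cubicForm W (nc L Q) = 0 := by
  rw [nc, cubicForm_smul, cubicForm_sc, mul_zero]

theorem nc_ne_zero {L : Fin 3 → ℂ} {Q : Pt W} (h : lin L Q ≠ 0) : nc L Q ≠ 0 :=
  smul_ne_zero (inv_ne_zero h) (sc_ne_zero Q)

theorem sc_eq_smul_nc {L : Fin 3 → ℂ} {Q : Pt W} (h : lin L Q ≠ 0) :
    sc Q = lin L Q • nc L Q := by rw [nc, smul_inv_smul₀ h]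

theorem nc_smul_injective {L : Fin 3 → ℂ} {Q R : Pt W} {l : ℂ} (hQ : lin L Q ≠ 0)
    (h : nc L Q = l • nc L R) : Q = R := by
  refine sc_injective_smul (l := lin L Q * l * (lin L R)⁻¹) ?_
  rw [sc_eq_smul_nc hQ, h, nc, smul_smul, smul_smul]

theorem sev_div_eq_cev_nc {d : Fin 3 → ℕ} {N D : MvPolynomial (Fin 3 × Fin 3) ℂ}
    (hN : IsMultihom N d) (hD : IsMultihom D d) {L : Fin 3 → ℂ} {P : Fin 3 → Pt W}
    (h : ∀ i, lin L (P i) ≠ 0) :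
    sev N P / sev D P = cev N (fun i => nc L (P i)) / cev D (fun i => nc L (P i)) := by
  have h0 : ∏ i, ((lin L (P i))⁻¹) ^ d i ≠ 0 :=
    Finset.prod_ne_zero_iff.2 fun i _ => pow_ne_zero _ (inv_ne_zero (h i))
  simp only [nc]
  rw [cev_smul hN, cev_smul hD, mul_div_mul_left _ _ h0, sev, sev]

theorem cev_nc_ne_zero_iff {d : Fin 3 → ℕ} {N : MvPolynomial (Fin 3 × Fin 3) ℂ}
    (hN : IsMultihom N d) {L : Fin 3 → ℂ} {P : Fin 3 → Pt W} (h : ∀ i, lin L (P i) ≠ 0) :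
    cev N (fun i => nc L (P i)) ≠ 0 ↔ sev N P ≠ 0 := by
  have h0 : ∏ i, ((lin L (P i))⁻¹) ^ d i ≠ 0 :=
    Finset.prod_ne_zero_iff.2 fun i _ => pow_ne_zero _ (inv_ne_zero (h i))
  simp only [nc]
  rw [cev_smul hN, sev, mul_ne_zero_iff]
  exact and_iff_right h0

/-- Substituting regular functions into a polynomial. -/
theorem reg_cev {U : Set (Fin 3 → Pt W)} (hU : Opn U) (G : MvPolynomial (Fin 3 × Fin 3) ℂ)
    {v : (Fin 3 → Pt W) → Fin 3 → Fin 3 → ℂ} (hv : ∀ i k, Reg U (fun P => v P i k)) :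
    Reg U (fun P => cev G (v P)) := by
  induction G using MvPolynomial.induction_on with
  | C a => simpa [cev] using reg_const hU a
  | add p q hp hq => simpa [cev] using hp.add hq
  | mul_X p j hp => simpa [cev] using hp.mul (hv j.1 j.2)

/-- A polynomial changes by a multiple of `τ` when its arguments do. -/
theorem poly_diff {U : Set (Fin 3 → Pt W)} (hU : Opn U) (G : MvPolynomial (Fin 3 × Fin 3) ℂ)
    {v w β : (Fin 3 → Pt W) → Fin 3 → Fin 3 → ℂ} {τ : (Fin 3 → Pt W) → ℂ}
    (hw : ∀ i k, Reg U (fun P => w P i k)) (hβ : ∀ i k, Reg U (fun P => β P i k))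
    (hτ : Reg U τ) (h : ∀ P ∈ U, ∀ i k, v P i k = w P i k + τ P * β P i k) :
    ∃ b, Reg U b ∧ ∀ P ∈ U, cev G (v P) = cev G (w P) + τ P * b P := by
  induction G using MvPolynomial.induction_on with
  | C a => exact ⟨fun _ => 0, reg_const hU 0, fun P _ => by simp [cev]⟩
  | add p q hp hq =>
    obtain ⟨b, hb, h1⟩ := hp
    obtain ⟨b', hb', h2⟩ := hq
    refine ⟨_, hb.add hb', fun P hP => ?_⟩
    have h1 := h1 P hP
    have h2 := h2 P hP
    simp only [cev, map_add] at h1 h2 ⊢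
    rw [h1, h2]; ring
  | mul_X p j hp =>
    obtain ⟨b, hb, h1⟩ := hp
    refine ⟨_, (hb.mul ((hw j.1 j.2).add (hτ.mul (hβ j.1 j.2)))).add
      ((reg_cev hU p hw).mul (hβ j.1 j.2)), fun P hP => ?_⟩
    have h1 := h1 P hP
    have h2 := h P hP j.1 j.2
    simp only [cev, map_mul, eval_X] at h1 ⊢
    rw [h1, h2]; ring

open Filter Topology

/-! ### Parametrized curves on the elliptic curve -/

/-- A map to `E` which has, near `0`, homogeneous coordinates differentiable at `0`. -/
structure IsParam (γ : ℂ → Pt W) (c : ℂ → Fin 3 → ℂ) (c' : Fin 3 → ℂ) : Prop where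
  prop : ∀ᶠ t in 𝓝 0, ∃ l : ℂ, l ≠ 0 ∧ sc (γ t) = l • c t
  deriv : ∀ k, HasDerivAt (fun t => c t k) (c' k) 0

theorem isParam_const (Q : Pt W) : IsParam (fun _ => Q) (fun _ => sc Q) 0 :=
  ⟨Eventually.of_forall fun _ => ⟨1, one_ne_zero, by simp⟩, fun _ => hasDerivAt_const _ _⟩

theorem differentiableAt_cev {c : Fin 3 → ℂ → Fin 3 → ℂ} {t₀ : ℂ}
    (hc : ∀ i k, DifferentiableAt ℂ (fun t => c i t k) t₀)
    (N : MvPolynomial (Fin 3 × Fin 3) ℂ) :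
    DifferentiableAt ℂ (fun t => cev N (fun i => c i t)) t₀ := by
  induction N using MvPolynomial.induction_on with
  | C a => simp [cev]
  | add p q hp hq =>
    simp only [cev, map_add] at *
    exact hp.add hq
  | mul_X p j hp =>
    simp only [cev, map_mul, eval_X] at *
    exact hp.mul (hc _ _)

theorem IsParam.sev_ne_zero {γ : Fin 3 → ℂ → Pt W} {c : Fin 3 → ℂ → Fin 3 → ℂ}
    {c' : Fin 3 → Fin 3 → ℂ} (h : ∀ i, IsParam (γ i) (c i) (c' i))
    {M : MvPolynomial (Fin 3 × Fin 3) ℂ} {e : Fin 3 → ℕ} (hM : IsMultihom M e)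
    (h0 : sev M (fun i => γ i 0) ≠ 0) : ∀ᶠ t in 𝓝 0, sev M (fun i => γ i t) ≠ 0 := by
  have key : ∀ t, (∀ i, ∃ l : ℂ, l ≠ 0 ∧ sc (γ i t) = l • c i t) →
      (sev M (fun i => γ i t) ≠ 0 ↔ cev M (fun i => c i t) ≠ 0) := by
    intro t ht
    choose l hl hs using ht
    simp only [sev, hs]
    rw [cev_smul hM, mul_ne_zero_iff]
    exact and_iff_right (Finset.prod_ne_zero_iff.2 fun i _ => pow_ne_zero _ (hl i))
  have hev : ∀ᶠ t in 𝓝 0, ∀ i, ∃ l : ℂ, l ≠ 0 ∧ sc (γ i t) = l • c i t :=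
    eventually_all.2 fun i => (h i).prop
  have hc := differentiableAt_cev (fun i k => ((h i).deriv k).differentiableAt) M
  filter_upwards [hev, hc.continuousAt.eventually_ne ((key 0 hev.self_of_nhds).1 h0)] with t h1 h2
  exact (key t h1).2 h2

theorem IsParam.eventually_mem {γ : Fin 3 → ℂ → Pt W} {c : Fin 3 → ℂ → Fin 3 → ℂ}
    {c' : Fin 3 → Fin 3 → ℂ} (h : ∀ i, IsParam (γ i) (c i) (c' i)) {U : Set (Fin 3 → Pt W)}
    (hU : Opn U) (h0 : (fun i => γ i 0) ∈ U) : ∀ᶠ t in 𝓝 0, (fun i => γ i t) ∈ U := by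
  obtain ⟨d, M, hM, hMP, hMU⟩ := exists_basic hU h0
  filter_upwards [IsParam.sev_ne_zero h hM hMP] with t ht using hMU _ ht

/-- The unknown scalars relating `sc (γ i t)` to `c i t` cancel, because numerator and denominator
have the same multidegree. Hence regular functions can be differentiated along curves whose
representing coordinates are only known up to scale. -/
theorem IsParam.differentiableAt {γ : Fin 3 → ℂ → Pt W} {c : Fin 3 → ℂ → Fin 3 → ℂ}
    {c' : Fin 3 → Fin 3 → ℂ} (h : ∀ i, IsParam (γ i) (c i) (c' i)) {U : Set (Fin 3 → Pt W)}
    {f : (Fin 3 → Pt W) → ℂ} (hf : Reg U f) (h0 : (fun i => γ i 0) ∈ U) :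
    DifferentiableAt ℂ (fun t => f (fun i => γ i t)) 0 := by
  obtain ⟨e, d, M, N, D, hM, hN, hD, hMP, hfr⟩ := hf.exists_frac h0
  have hev : ∀ᶠ t in 𝓝 0, ∀ i, ∃ l : ℂ, l ≠ 0 ∧ sc (γ i t) = l • c i t :=
    eventually_all.2 fun i => (h i).prop
  have hcN := differentiableAt_cev (fun i k => ((h i).deriv k).differentiableAt) N
  have hcD := differentiableAt_cev (fun i k => ((h i).deriv k).differentiableAt) D
  have hD0 : cev D (fun i => c i 0) ≠ 0 := by
    have h1 := (hfr _ hMP).2.1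
    choose l hl hs using hev.self_of_nhds
    simp only [sev, hs] at h1
    rw [cev_smul hD] at h1
    exact right_ne_zero_of_mul h1
  refine (hcN.div hcD hD0).congr_of_eventuallyEq ?_
  filter_upwards [hev, IsParam.sev_ne_zero h hM hMP] with t ht hMt
  rw [(hfr _ hMt).2.2]
  choose l hl hs using ht
  simp only [sev, hs]
  rw [cev_smul hN, cev_smul hD, mul_div_mul_left]
  · rfl
  · exact Finset.prod_ne_zero_iff.2 fun i _ => pow_ne_zero _ (hl i)

/-- The points are chosen separately for each t. This is harmless, since only the coordinate curve
is asked to be differentiable. A coordinate that is nonzero at t = 0 keeps the vector nonzero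
nearby. -/
theorem exists_param [W.IsElliptic] {c : ℂ → Fin 3 → ℂ} {c' : Fin 3 → ℂ}
    (hc : ∀ k, HasDerivAt (fun t => c t k) (c' k) 0) (hF : ∀ᶠ t in 𝓝 0, cubicForm W (c t) = 0)
    {Q : Pt W} {l : ℂ} (hQ : sc Q = l • c 0) : ∃ γ : ℂ → Pt W, γ 0 = Q ∧ IsParam γ c c' := by
  have h0 : c 0 ≠ 0 := by
    intro h0; rw [h0, smul_zero] at hQ; exact sc_ne_zero Q hQ
  obtain ⟨k, hk⟩ := Function.ne_iff.1 h0
  have h1 : ∀ᶠ t in 𝓝 0, c t k ≠ 0 := (hc k).continuousAt.eventually_ne hk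
  have h2 : ∀ t, ∃ R : Pt W, c t k ≠ 0 ∧ cubicForm W (c t) = 0 →
      ∃ l : ℂ, l ≠ 0 ∧ sc R = l • c t := by
    intro t
    by_cases ht : c t k ≠ 0 ∧ cubicForm W (c t) = 0
    · obtain ⟨R, l, hl, hR⟩ := exists_sc_eq_smul (fun h => ht.1 (by rw [h]; rfl)) ht.2
      exact ⟨R, fun _ => ⟨l, hl, hR⟩⟩
    · exact ⟨0, fun h => absurd h ht⟩
  choose γ hγ using h2
  have hev := h1.and hF
  refine ⟨γ, ?_, ?_, hc⟩
  · obtain ⟨l', hl', h3⟩ := hγ 0 hev.self_of_nhds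
    refine sc_injective_smul (l := l' * l⁻¹) ?_
    have hl : l ≠ 0 := by rintro rfl; exact sc_ne_zero Q (by simpa using hQ)
    rw [h3, hQ, smul_smul, mul_assoc, inv_mul_cancel₀ hl, mul_one]
  · filter_upwards [hev] with t ht using hγ t ht

/-- The principal branch exp(log w / 2) is used: differentiability is only needed at 1, while the
square identity holds for every nonzero w. -/
theorem exists_sqrt : ∃ s : ℂ → ℂ, s 1 = 1 ∧ HasDerivAt s (1 / 2) 1 ∧ ∀ w ≠ 0, s w ^ 2 = w := by
  refine ⟨fun w => Complex.exp (Complex.log w / 2), by simp, ?_, fun w hw => ?_⟩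
  · have h1 := ((Complex.hasDerivAt_log Complex.one_mem_slitPlane).div_const 2).cexp
    exact h1.congr_deriv (by simp)
  · rw [← Complex.exp_nat_mul]
    have : ((2 : ℕ) : ℂ) * (Complex.log w / 2) = Complex.log w := by push_cast; ring
    rw [this, Complex.exp_log hw]

/-- A map to the affine part of `E` whose coordinates are differentiable at `0`. -/
structure IsAffParam (γ : ℂ → Pt W) (x' y' : ℂ) : Prop where
  ne_zero : ∀ᶠ t in 𝓝 0, γ t ≠ 0
  derivX : HasDerivAt (fun t => pX (γ t)) x' 0
  derivY : HasDerivAt (fun t => pY (γ t)) y' 0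

theorem IsAffParam.isParam {γ : ℂ → Pt W} {x' y' : ℂ} (h : IsAffParam γ x' y') :
    IsParam γ (fun t => ![pX (γ t), pY (γ t), 1]) ![x', y', 0] := by
  refine ⟨?_, fun k => ?_⟩
  · filter_upwards [h.ne_zero] with t ht
    exact ⟨1, one_ne_zero, by rw [sc_of_ne ht, one_smul]⟩
  · fin_cases k
    · exact h.derivX
    · exact h.derivY
    · exact hasDerivAt_const _ _

theorem IsParam.isAffParam {γ : ℂ → Pt W} {c : ℂ → Fin 3 → ℂ} {c' : Fin 3 → ℂ}
    (h : IsParam γ c c') (h2 : ∀ t, c t 2 = 1) : IsAffParam γ (c' 0) (c' 1) := by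
  have key : ∀ᶠ t in 𝓝 0, γ t ≠ 0 ∧ pX (γ t) = c t 0 ∧ pY (γ t) = c t 1 := by
    filter_upwards [h.prop] with t ht
    obtain ⟨l, hl, hs⟩ := ht
    have h0 : γ t ≠ 0 := by
      rw [← sc_apply_two_ne_zero_iff, hs]; simpa [h2] using hl
    rw [sc_of_ne h0] at hs
    have e2 := congrFun hs 2
    have hl1 : l = 1 := by simpa [h2] using e2.symm
    have e0 := congrFun hs 0
    have e1 := congrFun hs 1
    rw [hl1] at e0 e1
    exact ⟨h0, by simpa using e0, by simpa using e1⟩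
  exact ⟨key.mono fun t ht => ht.1,
    (h.deriv 0).congr_of_eventuallyEq (key.mono fun t ht => ht.2.1),
    (h.deriv 1).congr_of_eventuallyEq (key.mono fun t ht => ht.2.2)⟩

/-- Where Y ≠ 0 the abscissa is a local parameter. At a point of order two it is not: there X = x +
t² and Y is t times a unit, so the velocity is purely in the Y-direction and its square is the
derivative of the cubic. -/
theorem exists_affParam [W.IsElliptic] {Q : Pt W} (hQ : Q ≠ 0) :
    ∃ (γ : ℂ → Pt W) (x' y' : ℂ), γ 0 = Q ∧ IsAffParam γ x' y' ∧
      2 * pY Q * y' = (3 * pX Q ^ 2 + sA W) * x' ∧ (pY Q ≠ 0 → x' = 1) ∧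
      (pY Q = 0 → x' = 0 ∧ y' ^ 2 = 3 * pX Q ^ 2 + sA W) := by
  obtain ⟨s, s1, s2, s3⟩ := exists_sqrt
  have hc := curve_eq hQ
  set x := pX Q with hx
  set y := pY Q with hy
  by_cases h0 : y = 0
  · have hq := deriv_ne_zero_of_root (W := W) (r := x) (by rw [← hc, h0]; ring)
    obtain ⟨ρ, hρ⟩ := IsAlgClosed.exists_pow_nat_eq (3 * x ^ 2 + sA W) (n := 2) two_pos
    have hρ0 : ρ ≠ 0 := by rintro rfl; exact hq (by rw [← hρ]; ring)
    -- With f the cubic, f(x + t²) = f(x + t²) − f(x) = t² ρ² g(t), so Y = tρ√g solves the equation.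
    set g : ℂ → ℂ := fun t => ((x + t ^ 2) ^ 2 + (x + t ^ 2) * x + x ^ 2 + sA W) / ρ ^ 2 with hg
    have hg0 : g 0 = 1 := by
      simp only [hg]; rw [div_eq_one_iff_eq (pow_ne_zero 2 hρ0), hρ]; ring
    have hgd : DifferentiableAt ℂ g 0 := by
      simp only [hg]; fun_prop
    have hs' : HasDerivAt (fun t => s (g t)) (1 / 2 * _) 0 :=
      HasDerivAt.comp (0 : ℂ) (by rw [hg0]; exact s2) hgd.hasDerivAt
    have hF : ∀ᶠ t in 𝓝 0, cubicForm W ![x + t ^ 2, t * (ρ * s (g t)), 1] = 0 := by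
      filter_upwards [hgd.continuousAt.eventually_ne (show g 0 ≠ 0 by rw [hg0]; simp)] with t ht
      have h1 := s3 _ ht
      have h2 : ρ ^ 2 * g t = (x + t ^ 2) ^ 2 + (x + t ^ 2) * x + x ^ 2 + sA W := by
        simp only [hg]; field_simp
      rw [h0] at hc
      simp [cubicForm]
      linear_combination t ^ 2 * ρ ^ 2 * h1 + t ^ 2 * h2 + hc
    obtain ⟨γ, hγ, hp⟩ := exists_param (W := W) (Q := Q) (l := 1)
      (c := fun t => ![x + t ^ 2, t * (ρ * s (g t)), 1]) (c' := ![0, ρ, 0]) (by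
        intro k
        fin_cases k
        · simpa using ((hasDerivAt_id (0 : ℂ)).pow 2).const_add x
        · exact ((hasDerivAt_id (0 : ℂ)).mul (hs'.const_mul ρ)).congr_deriv (by simp [hg0, s1])
        · exact hasDerivAt_const _ _) hF (by rw [sc_of_ne hQ]; simp [← hx, ← hy, h0])
    exact ⟨γ, _, _, hγ, hp.isAffParam fun t => rfl, by simp [h0], fun h => absurd h0 h,
      fun _ => ⟨rfl, hρ⟩⟩
  · set g : ℂ → ℂ := fun t => ((x + t) ^ 3 + sA W * (x + t) + sB W) / y ^ 2 with hg
    have hg0 : g 0 = 1 := by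
      simp only [hg]; rw [div_eq_one_iff_eq (pow_ne_zero 2 h0), hc]; ring
    have hgd : HasDerivAt g ((3 * x ^ 2 + sA W) / y ^ 2) 0 := by
      have hi := (hasDerivAt_id (0 : ℂ)).const_add x
      have := (((hi.pow 3).add (hi.const_mul (sA W))).add_const (sB W)).div_const (y ^ 2)
      simpa using this
    have hs' : HasDerivAt (fun t => s (g t)) (1 / 2 * ((3 * x ^ 2 + sA W) / y ^ 2)) 0 :=
      HasDerivAt.comp (0 : ℂ) (by rw [hg0]; exact s2) hgd
    have hF : ∀ᶠ t in 𝓝 0, cubicForm W ![x + t, y * s (g t), 1] = 0 := by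
      filter_upwards [hgd.continuousAt.eventually_ne (show g 0 ≠ 0 by rw [hg0]; simp)] with t ht
      have h1 := s3 _ ht
      have h2 : y ^ 2 * g t = (x + t) ^ 3 + sA W * (x + t) + sB W := by
        simp only [hg]; field_simp
      simp [cubicForm]
      linear_combination y ^ 2 * h1 + h2
    obtain ⟨γ, hγ, hp⟩ := exists_param (W := W) (Q := Q) (l := 1)
      (c := fun t => ![x + t, y * s (g t), 1]) (c' := ![1, (3 * x ^ 2 + sA W) / (2 * y), 0]) (by
        intro k
        fin_cases k
        · simpa using (hasDerivAt_id (0 : ℂ)).const_add x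
        · have := hs'.const_mul y
          convert! this using 1
          simp; field_simp
        · exact hasDerivAt_const _ _) hF
      (by rw [sc_of_ne hQ]; simp [← hx, ← hy, hg0, s1])
    refine ⟨γ, _, _, hγ, hp.isAffParam fun t => rfl, ?_, fun _ => rfl, fun h => absurd h h0⟩
    simp; field_simp

/-- A parametrization of `E` near its zero. -/
theorem exists_zeroParam [W.IsElliptic] : ∃ (γ : ℂ → Pt W) (w : ℂ → ℂ), γ 0 = 0 ∧ w 0 = 1 ∧
    HasDerivAt w 0 0 ∧ (∀ t, w (-t) = w t) ∧ IsParam γ (fun t => ![t, w t, t ^ 3]) ![1, 0, 0] ∧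
    ∀ᶠ t in 𝓝[≠] 0, γ t ≠ 0 ∧ pX (γ t) = (t ^ 2)⁻¹ ∧ pY (γ t) = w t * (t ^ 3)⁻¹ := by
  obtain ⟨s, s1, s2, s3⟩ := exists_sqrt
  -- Substituting [t : w : t³] into the cubic form and dividing by t³ leaves w² = 1 + At⁴ + Bt⁶. The
  -- right side is even, hence so is w.
  set g : ℂ → ℂ := fun t => 1 + sA W * t ^ 4 + sB W * t ^ 6 with hg
  have hg0 : g 0 = 1 := by simp [hg]
  have hgd : HasDerivAt g 0 0 := by
    have hi := hasDerivAt_id (0 : ℂ)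
    have := (((hi.pow 4).const_mul (sA W)).const_add 1).add ((hi.pow 6).const_mul (sB W))
    exact this.congr_deriv (by simp)
  have hs' : HasDerivAt (fun t => s (g t)) 0 0 := by
    have := HasDerivAt.comp (0 : ℂ) (h₂ := s) (by rw [hg0]; exact s2) hgd
    exact this.congr_deriv (by simp)
  have hF : ∀ᶠ t in 𝓝 0, cubicForm W ![t, s (g t), t ^ 3] = 0 := by
    filter_upwards [hgd.continuousAt.eventually_ne (show g 0 ≠ 0 by rw [hg0]; simp)] with t ht
    have h1 := s3 _ ht
    simp [cubicForm]
    rw [h1]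
    simp only [hg]; ring
  obtain ⟨γ, hγ, hp⟩ := exists_param (W := W) (Q := 0) (l := 1)
    (c := fun t => ![t, s (g t), t ^ 3]) (c' := ![1, 0, 0]) (by
      intro k
      fin_cases k
      · exact hasDerivAt_id (0 : ℂ)
      · exact hs'
      · exact ((hasDerivAt_id (0 : ℂ)).pow 3).congr_deriv (by simp)) hF (by simp [hg0, s1])
  refine ⟨γ, fun t => s (g t), hγ, by simp only [hg0, s1], hs', fun t => ?_, hp, ?_⟩
  · simp only [hg]; congr 1; ring
  · filter_upwards [hp.prop.filter_mono nhdsWithin_le_nhds, self_mem_nhdsWithin] with t ht ht0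
    have ht0 : t ≠ 0 := ht0
    obtain ⟨l, hl, hs⟩ := ht
    have h0 : γ t ≠ 0 := by
      rw [← sc_apply_two_ne_zero_iff, hs]; simp [hl, ht0]
    rw [sc_of_ne h0] at hs
    have e2 := congrFun hs 2
    have e0 := congrFun hs 0
    have e1 := congrFun hs 1
    simp at e0 e1 e2
    have hl1 : l = (t ^ 3)⁻¹ := eq_inv_of_mul_eq_one_left e2.symm
    refine ⟨h0, ?_, ?_⟩
    · rw [e0, hl1]; field_simp
    · rw [e1, hl1]; ring

/-! ### Polynomial functions on the affine curve -/

theorem finite_pX_eq (x : ℂ) : {Q : Pt W | Q ≠ 0 ∧ pX Q = x}.Finite := by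
  by_cases h : ∃ Q : Pt W, Q ≠ 0 ∧ pX Q = x
  · obtain ⟨Q, hQ, hx⟩ := h
    refine (Set.toFinite {Q, -Q}).subset fun R hR => ?_
    exact eq_or_eq_neg_of_pX_eq hR.1 hQ (hR.2.trans hx.symm)
  · convert! Set.finite_empty
    ext Q
    exact ⟨fun hQ => h ⟨Q, hQ⟩, False.elim⟩

variable (W) in
/-- The cubic polynomial of the short model. -/
def shortCubic : Polynomial ℂ :=
  Polynomial.X ^ 3 + (Polynomial.C (sA W) * Polynomial.X + Polynomial.C (sB W))

theorem eval_shortCubic (x : ℂ) : (shortCubic W).eval x = x ^ 3 + sA W * x + sB W := by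
  simp [shortCubic]; ring

theorem natDegree_shortCubic : (shortCubic W).natDegree = 3 := by
  unfold shortCubic
  rw [Polynomial.natDegree_add_eq_left_of_natDegree_lt]
  · simp
  · refine lt_of_le_of_lt Polynomial.natDegree_linear_le ?_
    simp

/-- A zero of p + qY has its abscissa among the roots of the norm p² − q² f. The norm is nonzero
because deg p² is even while deg q² f is odd. -/
theorem finite_zeros {p q : Polynomial ℂ} (h : ¬(p = 0 ∧ q = 0)) :
    {Q : Pt W | Q ≠ 0 ∧ p.eval (pX Q) + q.eval (pX Q) * pY Q = 0}.Finite := by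
  have hf : shortCubic W ≠ 0 := by
    intro h0; have := natDegree_shortCubic (W := W); rw [h0] at this; simp at this
  have hn : p ^ 2 - q ^ 2 * shortCubic W ≠ 0 := by
    intro h0
    have h1 : p ^ 2 = q ^ 2 * shortCubic W := sub_eq_zero.1 h0
    by_cases hq : q = 0
    · refine h ⟨?_, hq⟩
      rw [hq] at h1; simpa using h1
    · have := congrArg Polynomial.natDegree h1
      rw [Polynomial.natDegree_pow, Polynomial.natDegree_mul (pow_ne_zero 2 hq) hf,
        Polynomial.natDegree_pow, natDegree_shortCubic] at this
      omega
  refine ((p ^ 2 - q ^ 2 * shortCubic W).roots.toFinset.finite_toSet.biUnion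
    fun x _ => finite_pX_eq (W := W) x).subset ?_
  rintro Q ⟨hQ, h1⟩
  refine Set.mem_biUnion (x := pX Q) ?_ ⟨hQ, rfl⟩
  rw [Finset.mem_coe, Multiset.mem_toFinset, Polynomial.mem_roots hn, Polynomial.IsRoot]
  have := curve_eq hQ
  simp only [Polynomial.eval_sub, Polynomial.eval_mul, Polynomial.eval_pow, eval_shortCubic]
  rw [← this]
  linear_combination (p.eval (pX Q) - q.eval (pX Q) * pY Q) * h1

theorem poly_form (W : WeierstrassCurve ℂ) (G : MvPolynomial (Fin 2) ℂ) : ∃ p q : Polynomial ℂ, ∀ Q : Pt W, Q ≠ 0 →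
    eval ![pX Q, pY Q] G = p.eval (pX Q) + q.eval (pX Q) * pY Q := by
  induction G using MvPolynomial.induction_on with
  | C a => exact ⟨Polynomial.C a, 0, fun Q _ => by simp⟩
  | add G H hG hH =>
    obtain ⟨p, q, h1⟩ := hG
    obtain ⟨p', q', h2⟩ := hH
    refine ⟨p + p', q + q', fun Q hQ => ?_⟩
    rw [map_add, h1 Q hQ, h2 Q hQ, Polynomial.eval_add, Polynomial.eval_add]; ring
  | mul_X G j hG =>
    obtain ⟨p, q, h1⟩ := hG
    fin_cases j
    · refine ⟨p * Polynomial.X, q * Polynomial.X, fun Q hQ => ?_⟩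
      rw [map_mul, h1 Q hQ]; simp; ring
    · refine ⟨q * shortCubic W, p, fun Q hQ => ?_⟩
      have := curve_eq hQ
      rw [map_mul, h1 Q hQ, Polynomial.eval_mul, eval_shortCubic, ← this]; simp; ring

theorem infinite_pt [W.IsElliptic] : (Set.univ : Set (Pt W)).Infinite := by
  intro hf
  have : (Set.univ : Set ℂ) ⊆ pX '' (Set.univ : Set (Pt W)) := by
    intro x _
    obtain ⟨y, hy⟩ := IsAlgClosed.exists_pow_nat_eq (x ^ 3 + sA W * x + sB W) (n := 2) two_pos
    obtain ⟨Q, -, hX, -⟩ := exists_pt hy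
    exact ⟨Q, trivial, hX⟩
  exact Set.infinite_univ ((hf.image _).subset this)

/-- Restriction of a polynomial to a slice of `E³`. -/
theorem exists_slice (N : MvPolynomial (Fin 3 × Fin 3) ℂ) (i : Fin 3) (P : Fin 3 → Pt W) :
    ∃ G : MvPolynomial (Fin 2) ℂ, ∀ Q : Pt W, Q ≠ 0 →
      sev N (Function.update P i Q) = eval ![pX Q, pY Q] G := by
  refine ⟨aeval (fun j : Fin 3 × Fin 3 => if j.1 = i then ![X 0, X 1, C 1] j.2
    else C (sc (P j.1) j.2)) N, fun Q hQ => ?_⟩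
  rw [eval_aeval, sev, cev]
  congr 2
  funext j
  rcases j with ⟨j, k⟩
  by_cases hj : j = i
  · subst hj
    simp only [Function.update_self, sc_of_ne hQ, if_true]
    fin_cases k <;> simp
  · simp [hj]

/-- On the affine curve the slice has the form p(X) + q(X)Y, so it suffices that it is not
identically zero there. If the given witness is the zero of E, continuity along `exists_zeroParam`
moves it to an affine point. -/
theorem finite_slice [W.IsElliptic] {N : MvPolynomial (Fin 3 × Fin 3) ℂ} {d : Fin 3 → ℕ}
    (hN : IsMultihom N d) (i : Fin 3) (P : Fin 3 → Pt W) {Q₀ : Pt W}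
    (h : sev N (Function.update P i Q₀) ≠ 0) : {Q | sev N (Function.update P i Q) = 0}.Finite := by
  obtain ⟨G, hG⟩ := exists_slice N i P
  obtain ⟨p, q, hpq⟩ := poly_form W G
  obtain ⟨R, hR, hNR⟩ : ∃ R : Pt W, R ≠ 0 ∧ sev N (Function.update P i R) ≠ 0 := by
    by_cases h0 : Q₀ = 0
    · subst h0
      obtain ⟨γ, w, hγ, -, -, -, hp, hne⟩ := exists_zeroParam (W := W)
      have := IsParam.sev_ne_zero (γ := fun j => if j = i then γ else fun _ => P j)
        (c := fun j => if j = i then fun t => ![t, w t, t ^ 3] else fun _ => sc (P j))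
        (c' := fun j => if j = i then ![1, 0, 0] else 0) (by
          intro j
          by_cases hj : j = i
          · simpa [hj] using hp
          · simpa [hj] using isParam_const _) hN (by
          convert! h using 2
          funext j
          by_cases hj : j = i
          · subst hj; simp [hγ]
          · simp [hj])
      obtain ⟨t, h1, h2⟩ := ((this.filter_mono nhdsWithin_le_nhds).and hne).exists
      refine ⟨γ t, h2.1, ?_⟩
      convert! h1 using 2
      funext j
      by_cases hj : j = i
      · subst hj; simp
      · simp [hj]
    · exact ⟨Q₀, h0, h⟩
  have hne : ¬(p = 0 ∧ q = 0) := by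
    rintro ⟨rfl, rfl⟩
    rw [hG R hR, hpq R hR] at hNR
    simp at hNR
  refine ((finite_zeros (W := W) hne).union (Set.finite_singleton 0)).subset fun Q hQ => ?_
  by_cases h0 : Q = 0
  · exact Or.inr h0
  · refine Or.inl ⟨h0, ?_⟩
    rw [← hpq Q h0, ← hG Q h0]; exact hQ

/-- The cube `E³` is irreducible. -/
theorem opn_inter_nonempty [W.IsElliptic] {U V : Set (Fin 3 → Pt W)} (hU : Opn U) (hV : Opn V)
    (hUn : U.Nonempty) (hVn : V.Nonempty) : (U ∩ V).Nonempty := by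
  obtain ⟨P, hP⟩ := hUn
  obtain ⟨Q, hQ⟩ := hVn
  obtain ⟨d, M, hM, hMP, hMU⟩ := exists_basic hU hP
  obtain ⟨e, N, hN, hNQ, hNV⟩ := exists_basic hV hQ
  -- One coordinate of both points is moved to a common value: each polynomial excludes only
  -- finitely many values, and E is infinite. Three such moves produce a common point.
  have step : ∀ (i : Fin 3) (S T : Fin 3 → Pt W), sev M S ≠ 0 → sev N T ≠ 0 →
      ∃ R, sev M (Function.update S i R) ≠ 0 ∧ sev N (Function.update T i R) ≠ 0 := by
    intro i S T hS hT
    have h1 := finite_slice hM i S (Q₀ := S i) (by rwa [Function.update_eq_self])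
    have h2 := finite_slice hN i T (Q₀ := T i) (by rwa [Function.update_eq_self])
    by_contra! hc
    refine infinite_pt (W := W) ((h1.union h2).subset fun R _ => ?_)
    by_cases h3 : sev M (Function.update S i R) = 0
    · exact Or.inl h3
    · exact Or.inr (hc R h3)
  obtain ⟨R0, a0, b0⟩ := step 0 P Q hMP hNQ
  obtain ⟨R1, a1, b1⟩ := step 1 _ _ a0 b0
  obtain ⟨R2, a2, b2⟩ := step 2 _ _ a1 b1
  refine ⟨_, hMU _ a2, hNV _ ?_⟩
  convert! b2 using 2
  funext j
  fin_cases j <;> simp [Function.update]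

/-- A regular function vanishing on a nonempty open set vanishes. -/
theorem Reg.eq_zero [W.IsElliptic] {U O : Set (Fin 3 → Pt W)} {f : (Fin 3 → Pt W) → ℂ}
    (hf : Reg U f) (hO : Opn O) (hOn : O.Nonempty) (h : ∀ P ∈ U, P ∈ O → f P = 0) :
    ∀ P ∈ U, f P = 0 := by
  intro P hP
  by_contra hne
  obtain ⟨Q, hQ, hQO⟩ := opn_inter_nonempty hf.opn_ne hO ⟨P, hP, hne⟩ hOn
  exact hQ.2 (h Q hQ.1 hQO)

/-! ### The quotient map -/

theorem quot_eq_iff {P Q : Fin 3 → Pt W} :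
    quot W P = quot W Q ↔ ∃ σ : Equiv.Perm (Fin 3), P = Q ∘ σ := by
  classical
  constructor
  · intro h
    have h1 : Finset.univ.val.map P = Finset.univ.val.map Q := congrArg Subtype.val h
    have h2 : ∀ R, Nonempty ({i // P i = R} ≃ {i // Q i = R}) := by
      intro R
      refine ⟨Fintype.equivOfCardEq ?_⟩
      have h3 := congrArg (Multiset.count R) h1
      rw [Multiset.count_map, Multiset.count_map] at h3
      rw [Fintype.card_subtype, Fintype.card_subtype]
      simpa only [Finset.card, Finset.filter_val, eq_comm] using h3
    let e := fun R => Classical.choice (h2 R)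
    exact ⟨Equiv.ofFiberEquiv e, funext fun i => (Equiv.ofFiberEquiv_map e i).symm⟩
  · rintro ⟨σ, rfl⟩
    refine Subtype.ext ?_
    change Finset.univ.val.map (Q ∘ σ) = Finset.univ.val.map Q
    rw [← Multiset.map_map, show Finset.univ.val.map σ = Finset.univ.val from
      congrArg Finset.val (Finset.map_univ_equiv σ)]

theorem quot_comp (P : Fin 3 → Pt W) (σ : Equiv.Perm (Fin 3)) : quot W (P ∘ σ) = quot W P :=
  quot_eq_iff.2 ⟨σ, rfl⟩

theorem quot_surjective : Function.Surjective (quot W) := by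
  rintro ⟨s, hs⟩
  obtain ⟨a, b, c, rfl⟩ := Multiset.card_eq_three.1 hs
  exact ⟨![a, b, c], Subtype.ext rfl⟩

theorem mem_divD0 {P : Fin 3 → Pt W} : quot W P ∈ divD0 W ↔ ∃ i, P i = 0 := by
  constructor
  · rintro ⟨Q, hQ, h⟩
    obtain ⟨σ, rfl⟩ := quot_eq_iff.1 h.symm
    exact ⟨σ.symm 0, by simpa using hQ⟩
  · rintro ⟨i, hi⟩
    exact ⟨P ∘ Equiv.swap 0 i, by simpa using hi, quot_comp _ _⟩

theorem mem_divG0 {P : Fin 3 → Pt W} : quot W P ∈ divG0 W ↔ P 0 + P 1 + P 2 = 0 := by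
  have : abelJacobi W (quot W P) = ∑ i, P i := rfl
  rw [divG0, Set.mem_preimage, this, Fin.sum_univ_three, Set.mem_singleton_iff]

/-- The function on `E⁽³⁾` induced by a symmetric function on `E³`. -/
def descend (f : (Fin 3 → Pt W) → ℂ) (D : SymPt W) : ℂ :=
  f (Function.surjInv quot_surjective D)

theorem descend_quot {f : (Fin 3 → Pt W) → ℂ} {P : Fin 3 → Pt W}
    (hf : ∀ σ : Equiv.Perm (Fin 3), f (P ∘ σ) = f P) : descend f (quot W P) = f P := by
  obtain ⟨σ, hσ⟩ := quot_eq_iff.1 (Function.surjInv_eq quot_surjective (quot W P))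
  rw [descend, hσ, hf]

theorem symOpn_iff {V : Set (SymPt W)} : (symCube W).IsOpn V ↔ Opn (quot W ⁻¹' V) :=
  Iff.rfl

theorem symReg_iff {V : Set (SymPt W)} {f : SymPt W → ℂ} :
    (symCube W).RegularOn V f ↔ Reg (quot W ⁻¹' V) (f ∘ quot W) := Iff.rfl

theorem preimage_image_quot {O : Set (Fin 3 → Pt W)}
    (hO : ∀ P ∈ O, ∀ σ : Equiv.Perm (Fin 3), P ∘ σ ∈ O) : quot W ⁻¹' (quot W '' O) = O := by
  ext P
  constructor
  · rintro ⟨Q, hQ, h⟩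
    obtain ⟨σ, rfl⟩ := quot_eq_iff.1 h.symm
    exact hO Q hQ σ
  · exact fun h => ⟨P, h, rfl⟩

/-- Reduces divisibility on the quotient to divisibility on E³. Since u is nonzero on a dense open
set, local quotients are unique; hence they glue, and they are invariant under S₃ and descend. -/
theorem isLocalEquation_of [W.IsElliptic] {Z V : Set (SymPt W)} {u : SymPt W → ℂ}
    (hu : (symCube W).RegularOn V u) (hvan : ∀ P ∈ V, P ∈ Z → u P = 0)
    (hne : ∃ P, quot W P ∈ V ∧ u (quot W P) ≠ 0)
    (hgen : ∀ (O : Set (Fin 3 → Pt W)) (a : (Fin 3 → Pt W) → ℂ), Opn O → O ⊆ quot W ⁻¹' V →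
      Reg O a → (∀ P ∈ O, quot W P ∈ Z → a P = 0) → ∀ P ∈ O, ∃ O' ⊆ O, Opn O' ∧ P ∈ O' ∧
        ∃ b, Reg O' b ∧ ∀ Q ∈ O', a Q = u (quot W Q) * b Q) :
    (symCube W).IsLocalEquation Z V u := by
  refine ⟨hu, hvan, fun V' hV' hVV a ha hav p hp => ?_⟩
  set O := quot W ⁻¹' V' with hO
  have hOo : Opn O := symOpn_iff.1 hV'
  have hOV : O ⊆ quot W ⁻¹' V := fun P hP => hVV hP
  set S : Set (Fin 3 → Pt W) := {P | P ∈ quot W ⁻¹' V ∧ (u ∘ quot W) P ≠ 0} with hS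
  have hSo : Opn S := Reg.opn_ne (symReg_iff.1 hu)
  have hSn : S.Nonempty := hne
  have h1 := hgen O (a ∘ quot W) hOo hOV (symReg_iff.1 ha) fun P hP hPZ => hav _ hP hPZ
  choose! O' hO'O hO'o hPO' b hb hab using h1
  -- The glued quotient is Q ↦ `b Q Q`, each point using its own local quotient; this says it agrees
  -- near P with the regular function `b P`.
  have key : ∀ P ∈ O, ∀ Q ∈ O' P, b Q Q = b P Q := by
    intro P hP Q hQ
    have hQO : Q ∈ O := hO'O P hP hQ
    have ho : Opn (O' P ∩ O' Q) := (hO'o P hP).inter (hO'o Q hQO)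
    have hr : Reg (O' P ∩ O' Q) (fun R => b Q R - b P R) :=
      ((hb Q hQO).mono ho Set.inter_subset_right).sub ho ((hb P hP).mono ho Set.inter_subset_left)
    have := hr.eq_zero hSo hSn (fun R hR hRS => by
      have e1 := hab P hP R hR.1
      have e2 := hab Q hQO R hR.2
      have e3 : u (quot W R) ≠ 0 := hRS.2
      apply mul_left_cancel₀ e3
      linear_combination e1 - e2) Q ⟨hQ, hPO' Q hQO⟩
    exact sub_eq_zero.1 this
  have hβ : Reg O (fun Q => b Q Q) := reg_of_local fun P hP =>
    ⟨O' P, hO'o P hP, hPO' P hP, hO'O P hP, (hb P hP).congr fun Q hQ => key P hP Q hQ⟩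
  have hβu : ∀ Q ∈ O, a (quot W Q) = u (quot W Q) * b Q Q := fun Q hQ => hab Q hQ Q (hPO' Q hQ)
  have hinv : ∀ Q ∈ O, ∀ σ : Equiv.Perm (Fin 3), b (Q ∘ σ) (Q ∘ σ) = b Q Q := by
    intro Q hQ σ
    have hOσ : {P : Fin 3 → Pt W | P ∘ σ ∈ O} = O := by
      ext P
      simp only [hO, Set.mem_preimage, Set.mem_ofPred_eq, quot_comp]
    have h2 := hβ.perm σ
    rw [hOσ] at h2
    have := (h2.sub hOo hβ).eq_zero hSo hSn (fun R hR hRS => by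
      have hRσ : R ∘ σ ∈ O := by rw [← hOσ] at hR; exact hR
      have e1 := hβu R hR
      have e2 := hβu _ hRσ
      rw [quot_comp] at e2
      have e3 : u (quot W R) ≠ 0 := hRS.2
      apply mul_left_cancel₀ e3
      linear_combination e1 - e2) Q hQ
    exact sub_eq_zero.1 this
  have hd : ∀ Q ∈ O, descend (fun Q => b Q Q) (quot W Q) = b Q Q :=
    fun Q hQ => descend_quot fun σ => hinv Q hQ σ
  refine ⟨V', hV', hp, subset_rfl, descend fun Q => b Q Q, symReg_iff.2 (hβ.congr hd), ?_⟩
  intro D hD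
  obtain ⟨Q, rfl⟩ := quot_surjective D
  rw [hd Q hD]
  exact hβu Q hD

/-! ### Local equations of `D₀` -/

/-- The linear form `X - c Z`. -/
def xp (c : ℂ) (v : Fin 3 → ℂ) : ℂ := v 0 - c * v 2

/-- The quadratic form with `κ Z = (X - c Z) q` on the curve. -/
def kap (W : WeierstrassCurve ℂ) (c : ℂ) (v : Fin 3 → ℂ) : ℂ :=
  v 1 ^ 2 - (c ^ 3 + sA W * c + sB W) * v 2 ^ 2

/-- The quadratic form with `κ Z = (X - c Z) q` on the curve. -/
def qd (W : WeierstrassCurve ℂ) (c : ℂ) (v : Fin 3 → ℂ) : ℂ :=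
  xp c v ^ 2 + v 2 * (3 * c * xp c v + (3 * c ^ 2 + sA W) * v 2)

/-- Subtracting f(c)Z³ from both sides of the curve equation makes the right side divisible by X −
cZ. So Z is a multiple of X − cZ wherever κ ≠ 0, and discarding κ = 0 removes the zeros of X − cZ
other than the origin. -/
theorem kap_mul {c : ℂ} {v : Fin 3 → ℂ} (h : cubicForm W v = 0) :
    kap W c v * v 2 = xp c v * qd W c v := by
  simp only [cubicForm, kap, qd, xp] at *
  linear_combination h

/-- Points where `L` and `κ` do not vanish. -/
def InDom (c : ℂ) (L : Fin 3 → ℂ) (Q : Pt W) : Prop := lin L Q ≠ 0 ∧ kap W c (nc L Q) ≠ 0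

/-- Triples of points where `L` and `κ` do not vanish. -/
def dom (W : WeierstrassCurve ℂ) (c : ℂ) (L : Fin 3 → ℂ) : Set (Fin 3 → Pt W) :=
  {P | ∀ i, InDom c L (P i)}

/-- The local equation `(X - c Z) / L` of the zero of `E`. -/
def zf (c : ℂ) (L : Fin 3 → ℂ) (Q : Pt W) : ℂ := xp c (nc L Q)

/-- The local equation of `D₀`. -/
def u0 (c : ℂ) (L : Fin 3 → ℂ) (P : Fin 3 → Pt W) : ℂ := ∏ i, zf c L (P i)

theorem reg_kap {U : Set (Fin 3 → Pt W)} (hU : Opn U) {L : Fin 3 → ℂ} (c : ℂ)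
    (h : ∀ P ∈ U, ∀ i, lin L (P i) ≠ 0) (i : Fin 3) :
    Reg U (fun P => kap W c (nc L (P i))) :=
  ((reg_nc hU h i 1).pow hU 2).sub hU (((reg_nc hU h i 2).pow hU 2).const_mul hU _)

theorem reg_zf {U : Set (Fin 3 → Pt W)} (hU : Opn U) {L : Fin 3 → ℂ} (c : ℂ)
    (h : ∀ P ∈ U, ∀ i, lin L (P i) ≠ 0) (i : Fin 3) : Reg U (fun P => zf c L (P i)) :=
  (reg_nc hU h i 0).sub hU ((reg_nc hU h i 2).const_mul hU _)

theorem reg_qd {U : Set (Fin 3 → Pt W)} (hU : Opn U) {L : Fin 3 → ℂ} (c : ℂ)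
    (h : ∀ P ∈ U, ∀ i, lin L (P i) ≠ 0) (i : Fin 3) :
    Reg U (fun P => qd W c (nc L (P i))) :=
  ((reg_zf hU c h i).pow hU 2).add ((reg_nc hU h i 2).mul
    (((reg_zf hU c h i).const_mul hU _).add ((reg_nc hU h i 2).const_mul hU _)))

theorem reg_u0 {U : Set (Fin 3 → Pt W)} (hU : Opn U) {L : Fin 3 → ℂ} (c : ℂ)
    (h : ∀ P ∈ U, ∀ i, lin L (P i) ≠ 0) : Reg U (u0 c L) := by
  exact (((reg_zf hU c h 0).mul (reg_zf hU c h 1)).mul (reg_zf hU c h 2)).congr fun P _ => by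
    simp only [u0, Fin.prod_univ_three]

theorem opn_dom (c : ℂ) (L : Fin 3 → ℂ) : Opn (dom W c L) := by
  have h := opn_lin (W := W) L
  have h1 := (((reg_kap h c (fun P hP => hP) 0).mul (reg_kap h c (fun P hP => hP) 1)).mul
    (reg_kap h c (fun P hP => hP) 2)).opn_ne
  convert! h1 using 1
  ext P
  simp only [dom, InDom, Set.mem_ofPred_eq, Fin.forall_fin_succ, mul_ne_zero_iff, Fin.succ_zero_eq_one,
    Fin.succ_one_eq_two]
  simp
  tauto

theorem zf_eq_zero_iff {c : ℂ} {L : Fin 3 → ℂ} {Q : Pt W} (h : InDom c L Q) :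
    zf c L Q = 0 ↔ Q = 0 := by
  constructor
  · intro h0
    have h1 := kap_mul (c := c) (cubicForm_nc L Q)
    rw [zf] at h0
    rw [h0, zero_mul, mul_eq_zero] at h1
    have h2 := h1.resolve_left h.2
    by_contra hQ
    rw [nc, Pi.smul_apply, smul_eq_mul, mul_eq_zero] at h2
    exact ((sc_apply_two_ne_zero_iff Q).2 hQ) (h2.resolve_left (inv_ne_zero h.1))
  · rintro rfl
    simp [zf, xp, nc]

theorem u0_eq_zero_iff {c : ℂ} {L : Fin 3 → ℂ} {P : Fin 3 → Pt W} (h : P ∈ dom W c L) :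
    u0 c L P = 0 ↔ ∃ i, P i = 0 := by
  rw [u0, Finset.prod_eq_zero_iff]
  simp only [Finset.mem_univ, true_and, fun i => zf_eq_zero_iff (h i)]

theorem u0_comp (c : ℂ) (L : Fin 3 → ℂ) (P : Fin 3 → Pt W) (σ : Equiv.Perm (Fin 3)) :
    u0 c L (P ∘ σ) = u0 c L P := Equiv.prod_comp σ fun i => zf c L (P i)

/-- Along the forms (1, t, t²) a nonzero vector gives a nonzero polynomial in t, so finitely many
vectors exclude finitely many t. -/
theorem exists_form {ι : Type*} [Finite ι] (v : ι → Fin 3 → ℂ) (hv : ∀ i, v i ≠ 0) :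
    ∃ L : Fin 3 → ℂ, ∀ i, ∑ k, L k * v i k ≠ 0 := by
  let p : ι → Polynomial ℂ := fun i => Polynomial.C (v i 0) + Polynomial.C (v i 1) * Polynomial.X +
    Polynomial.C (v i 2) * Polynomial.X ^ 2
  have hp : ∀ i, p i ≠ 0 := by
    intro i h0
    apply hv i
    ext k
    have h1 := congrArg (fun q => Polynomial.coeff q k) h0
    fin_cases k <;> simpa [p, Polynomial.coeff_X, Polynomial.coeff_one, Polynomial.coeff_C] using h1
  have hfin : (⋃ i, {t | t ∈ (p i).roots.toFinset}).Finite :=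
    Set.finite_iUnion fun i => (p i).roots.toFinset.finite_toSet
  obtain ⟨t, ht⟩ := hfin.exists_notMem
  refine ⟨![1, t, t ^ 2], fun i h0 => ht (Set.mem_iUnion.2 ⟨i, ?_⟩)⟩
  rw [Set.mem_ofPred_eq, Multiset.mem_toFinset, Polynomial.mem_roots (hp i), Polynomial.IsRoot]
  simp [p]
  simp [Fin.sum_univ_three] at h0
  linear_combination h0

/-- At an affine point κ vanishes only if f(c) = Y², which excludes finitely many c; at the origin κ
is a nonzero multiple of Y². -/
theorem exists_mem_dom (P : Fin 3 → Pt W) : ∃ c L, P ∈ dom W c L := by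
  obtain ⟨L, hL⟩ := exists_form (fun i => sc (P i)) fun i => sc_ne_zero _
  have hp : ∀ i, shortCubic W - Polynomial.C (pY (P i) ^ 2) ≠ 0 := by
    intro i h0
    have := congrArg Polynomial.natDegree h0
    rw [Polynomial.natDegree_sub_C, natDegree_shortCubic] at this
    simp at this
  have hfin : (⋃ i, {t | t ∈ (shortCubic W - Polynomial.C (pY (P i) ^ 2)).roots.toFinset}).Finite :=
    Set.finite_iUnion fun i => Finset.finite_toSet _
  obtain ⟨c, hc⟩ := hfin.exists_notMem
  refine ⟨c, L, fun i => ⟨hL i, fun h0 => hc (Set.mem_iUnion.2 ⟨i, ?_⟩)⟩⟩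
  rw [Set.mem_ofPred_eq, Multiset.mem_toFinset, Polynomial.mem_roots (hp i), Polynomial.IsRoot,
    Polynomial.eval_sub, eval_shortCubic, Polynomial.eval_C]
  have hl : (lin L (P i))⁻¹ ≠ 0 := inv_ne_zero (hL i)
  have h1 : (lin L (P i))⁻¹ ^ 2 * kap W c (sc (P i)) = 0 := by
    rw [← h0]; simp [kap, nc]; ring
  have h2 := (mul_eq_zero.1 h1).resolve_left (pow_ne_zero 2 hl)
  by_cases hi : P i = 0
  · rw [hi] at h2; simp [kap] at h2
  · rw [sc_of_ne hi] at h2; simp [kap] at h2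
    linear_combination -h2

/-- A regular function is continuous along the parametrization of E at 0, so vanishing at the nearby
affine values of one coordinate passes to the limit. -/
theorem Reg.eq_zero_of_slice [W.IsElliptic] {O : Set (Fin 3 → Pt W)} {b : (Fin 3 → Pt W) → ℂ} (hb : Reg O b)
    (hO : Opn O) {Q : Fin 3 → Pt W} (hQ : Q ∈ O) {i : Fin 3} (hi : Q i = 0)
    (h : ∀ R : Pt W, R ≠ 0 → Function.update Q i R ∈ O → b (Function.update Q i R) = 0) :
    b Q = 0 := by
  obtain ⟨γ, w, hγ, -, -, -, hp, hne⟩ := exists_zeroParam (W := W)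
  have hP : ∀ j, IsParam ((fun j => if j = i then γ else fun _ => Q j) j)
      ((fun j => if j = i then fun t => ![t, w t, t ^ 3] else fun _ => sc (Q j)) j)
      ((fun j => if j = i then ![1, 0, 0] else 0) j) := by
    intro j
    by_cases hj : j = i
    · simpa [hj] using hp
    · simpa [hj] using isParam_const _
  have hup : ∀ t, (fun j => (if j = i then γ else fun _ => Q j) t) = Function.update Q i (γ t) := by
    intro t; funext j
    by_cases hj : j = i
    · subst hj; simp
    · simp [hj]
  have h0 : (fun j => (if j = i then γ else fun _ => Q j) 0) = Q := by
    rw [hup, hγ, ← hi, Function.update_eq_self]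
  have hd := IsParam.differentiableAt hP hb (by rw [h0]; exact hQ)
  have hm := IsParam.eventually_mem hP hO (by rw [h0]; exact hQ)
  have hc := hd.continuousAt.tendsto.mono_left (nhdsWithin_le_nhds (s := {0}ᶜ))
  rw [h0] at hc
  refine tendsto_nhds_unique hc (tendsto_const_nhds.congr' ?_)
  filter_upwards [hm.filter_mono nhdsWithin_le_nhds, hne] with t ht1 ht2
  rw [hup] at ht1 ⊢
  exact (h _ ht2.1 ht1).symm

/-- Replacing the i-th point by 0 changes its normalized coordinates from [X : Y : Z] to [0 : Y :
0]. Both X and Z are multiples of `zf`, so by `poly_diff` the numerator changes by a multiple of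
`zf`, and after the replacement it vanishes. -/
theorem exists_div_zf [W.IsElliptic] {c : ℂ} {L : Fin 3 → ℂ} {O : Set (Fin 3 → Pt W)} (hO : Opn O)
    (hd : O ⊆ dom W c L) {a : (Fin 3 → Pt W) → ℂ} (ha : Reg O a) (i : Fin 3)
    (hv : ∀ Q ∈ O, Q i = 0 → a Q = 0) {P : Fin 3 → Pt W} (hP : P ∈ O) :
    ∃ O' ⊆ O, Opn O' ∧ P ∈ O' ∧ ∃ b, Reg O' b ∧ ∀ Q ∈ O', a Q = zf c L (Q i) * b Q := by
  have hl : ∀ Q ∈ O, ∀ j, lin L (Q j) ≠ 0 := fun Q hQ j => (hd hQ j).1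
  by_cases hi : P i = 0
  · obtain ⟨e, d, M, N, D, hM, hN, hD, hMP, hfr⟩ := ha.exists_frac hP
    have hO' := opn_sev (W := W) hM
    have hsub : {Q : Fin 3 → Pt W | sev M Q ≠ 0} ⊆ O := fun Q hQ => (hfr Q hQ).1
    have hl' : ∀ Q ∈ {Q : Fin 3 → Pt W | sev M Q ≠ 0}, ∀ j, lin L (Q j) ≠ 0 :=
      fun Q hQ => hl Q (hsub hQ)
    have hk' : ∀ Q ∈ {Q : Fin 3 → Pt W | sev M Q ≠ 0}, kap W c (nc L (Q i)) ≠ 0 :=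
      fun Q hQ => (hd (hsub hQ) i).2
    have hn := reg_nc hO' hl'
    have hq := (reg_qd hO' c hl' i).div (reg_kap hO' c hl' i) hk'
    -- The coefficients in β express Z = zf · (qd/kap) and X = zf + cZ.
    obtain ⟨b, hb, hdiff⟩ := poly_diff hO' (N * M) (v := fun Q j => nc L (Q j))
      (w := fun Q j => if j = i then ![0, nc L (Q i) 1, 0] else nc L (Q j))
      (β := fun Q j => if j = i then ![1 + c * (qd W c (nc L (Q i)) / kap W c (nc L (Q i))), 0,
        qd W c (nc L (Q i)) / kap W c (nc L (Q i))] else 0) (τ := fun Q => zf c L (Q i))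
      (by
        intro j k
        by_cases hj : j = i
        · simp only [hj, if_true]
          fin_cases k
          · exact reg_const hO' 0
          · exact hn i 1
          · exact reg_const hO' 0
        · simpa only [hj, if_false] using hn j k)
      (by
        intro j k
        by_cases hj : j = i
        · simp only [hj, if_true]
          fin_cases k
          · exact (reg_const hO' 1).add (hq.const_mul hO' c)
          · exact reg_const hO' 0
          · exact hq
        · simp only [hj, if_false]
          exact reg_const hO' 0)
      (reg_zf hO' c hl' i)
      (by
        intro Q hQ j k
        by_cases hj : j = i
        · simp only [hj, if_true]
          have h2 : nc L (Q i) 2 = zf c L (Q i) * (qd W c (nc L (Q i)) / kap W c (nc L (Q i))) := by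
            rw [← mul_div_assoc, eq_div_iff (hk' Q hQ), zf, ← kap_mul (cubicForm_nc L (Q i))]
            ring
          have h0 : nc L (Q i) 0 = zf c L (Q i) + c * nc L (Q i) 2 := by simp [zf, xp]
          fin_cases k
          · simp only [Fin.zero_eta, Matrix.cons_val_zero, zero_add]
            rw [h0, h2]; ring
          · simp
          · simpa using h2
        · simp [hj])
    have hw : ∀ Q ∈ {Q : Fin 3 → Pt W | sev M Q ≠ 0},
        cev (N * M) (fun j => if j = i then ![0, nc L (Q i) 1, 0] else nc L (Q j)) = 0 := by
      intro Q hQ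
      have h1 : (fun j => if j = i then ![0, nc L (Q i) 1, 0] else nc L (Q j)) =
          fun j => (if j = i then nc L (Q i) 1 else (lin L (Q j))⁻¹) •
            sc (Function.update Q i 0 j) := by
        funext j
        by_cases hj : j = i
        · subst hj; simp
        · simp [hj, nc]
      rw [h1, cev_smul (hN.mul hM)]
      apply mul_eq_zero_of_right
      change sev (N * M) (Function.update Q i 0) = 0
      rw [sev_mul]
      -- Replacing a coordinate by 0 may leave the neighbourhood, in which case M vanishes;
      -- otherwise a vanishes by hypothesis.
      by_cases hMR : sev M (Function.update Q i 0) = 0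
      · rw [hMR, mul_zero]
      · obtain ⟨h3, h4, h5⟩ := hfr _ hMR
        rw [hv _ h3 (by simp), eq_comm, div_eq_zero_iff] at h5
        rw [h5.resolve_right h4, zero_mul]
    have hM0 : ∀ Q ∈ {Q : Fin 3 → Pt W | sev M Q ≠ 0}, cev M (fun j => nc L (Q j)) ≠ 0 :=
      fun Q hQ => (cev_nc_ne_zero_iff hM (hl' Q hQ)).2 hQ
    have hD0 : ∀ Q ∈ {Q : Fin 3 → Pt W | sev M Q ≠ 0}, cev D (fun j => nc L (Q j)) ≠ 0 :=
      fun Q hQ => (cev_nc_ne_zero_iff hD (hl' Q hQ)).2 (hfr Q hQ).2.1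
    refine ⟨_, hsub, hO', hMP, _, hb.div ((reg_cev hO' D hn).mul (reg_cev hO' M hn))
      fun Q hQ => mul_ne_zero (hD0 Q hQ) (hM0 Q hQ), fun Q hQ => ?_⟩
    rw [(hfr Q hQ).2.2, sev_div_eq_cev_nc hN hD (hl' Q hQ)]
    have h6 := hdiff Q hQ
    rw [hw Q hQ, zero_add] at h6
    have h7 : cev (N * M) (fun j => nc L (Q j)) =
      cev N (fun j => nc L (Q j)) * cev M (fun j => nc L (Q j)) := by simp [cev]
    rw [h7] at h6
    have := hM0 Q hQ
    have := hD0 Q hQ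
    field_simp
    linear_combination h6
  · have hz := reg_zf hO c hl i
    have hO' := hz.opn_ne
    refine ⟨_, fun Q hQ => hQ.1, hO', ⟨hP, fun h => hi ((zf_eq_zero_iff (hd hP i)).1 h)⟩, _,
      (ha.mono hO' fun Q hQ => hQ.1).div (hz.mono hO' fun Q hQ => hQ.1) fun Q hQ => hQ.2,
      fun Q hQ => ?_⟩
    rw [mul_div_cancel₀ _ hQ.2]

/-- The three factors of `u0` are divided out one at a time. After division by the i-th factor the
quotient still vanishes along Qⱼ = 0: directly where Qᵢ ≠ 0, and by `Reg.eq_zero_of_slice` where Qᵢ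
= 0. -/
theorem exists_div_u0 [W.IsElliptic] {c : ℂ} {L : Fin 3 → ℂ} {O : Set (Fin 3 → Pt W)} (hO : Opn O)
    (hd : O ⊆ dom W c L) {a : (Fin 3 → Pt W) → ℂ} (ha : Reg O a)
    (hv : ∀ Q ∈ O, (∃ i, Q i = 0) → a Q = 0) {P : Fin 3 → Pt W} (hP : P ∈ O) :
    ∃ O' ⊆ O, Opn O' ∧ P ∈ O' ∧ ∃ b, Reg O' b ∧ ∀ Q ∈ O', a Q = u0 c L Q * b Q := by
  have step : ∀ {O' : Set (Fin 3 → Pt W)} {b : (Fin 3 → Pt W) → ℂ} {a' : (Fin 3 → Pt W) → ℂ}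
      (i j : Fin 3), i ≠ j → O' ⊆ O → Opn O' → Reg O' b →
      (∀ Q ∈ O', Q j = 0 → a' Q = 0) → (∀ Q ∈ O', a' Q = zf c L (Q i) * b Q) →
      ∀ Q ∈ O', Q j = 0 → b Q = 0 := by
    intro O' b a' i j hij hs ho hb hva hab Q hQ hj
    have main : ∀ R ∈ O', R j = 0 → R i ≠ 0 → b R = 0 := by
      intro R hR hRj hRi
      have := hab R hR
      rw [hva R hR hRj, eq_comm, mul_eq_zero] at this
      exact this.resolve_left fun h => hRi ((zf_eq_zero_iff (hd (hs hR) i)).1 h)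
    by_cases hi : Q i = 0
    · refine hb.eq_zero_of_slice ho hQ hi fun R hR hRO => main _ hRO ?_ (by simpa using hR)
      rw [Function.update_of_ne hij.symm]; exact hj
    · exact main Q hQ hj hi
  obtain ⟨O0, hs0, ho0, hP0, b0, hb0, e0⟩ :=
    exists_div_zf hO hd ha 0 (fun Q hQ h => hv Q hQ ⟨0, h⟩) hP
  have v1 := step 0 1 (by decide) hs0 ho0 hb0 (fun Q hQ h => hv Q (hs0 hQ) ⟨1, h⟩) e0
  have v2 := step 0 2 (by decide) hs0 ho0 hb0 (fun Q hQ h => hv Q (hs0 hQ) ⟨2, h⟩) e0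
  obtain ⟨O1, hs1, ho1, hP1, b1, hb1, e1⟩ := exists_div_zf ho0 (hs0.trans hd) hb0 1 v1 hP0
  have v2' := step 1 2 (by decide) (hs1.trans hs0) ho1 hb1 (fun Q hQ h => v2 Q (hs1 hQ) h) e1
  obtain ⟨O2, hs2, ho2, hP2, b2, hb2, e2⟩ :=
    exists_div_zf ho1 ((hs1.trans hs0).trans hd) hb1 2 v2' hP1
  refine ⟨O2, (hs2.trans hs1).trans hs0, ho2, hP2, b2, hb2, fun Q hQ => ?_⟩
  rw [e0 Q (hs1 (hs2 hQ)), e1 Q (hs2 hQ), e2 Q hQ, u0, Fin.prod_univ_three]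
  ring

theorem opn_ne_zero : Opn {P : Fin 3 → Pt W | ∀ i, P i ≠ 0} := by
  have := opn_lin (W := W) ![0, 0, 1]
  convert! this using 1
  ext P
  simp [lin, Fin.sum_univ_three, ← sc_apply_two_ne_zero_iff]

theorem exists_ne_zero [W.IsElliptic] : ∃ P : Fin 3 → Pt W, ∀ i, P i ≠ 0 := by
  obtain ⟨Q, -, hQ⟩ := (infinite_pt (W := W)).exists_notMem_finite (Set.finite_singleton 0)
  exact ⟨fun _ => Q, fun _ => hQ⟩

theorem isLocalEquation_divD0 [W.IsElliptic] {c : ℂ} {L : Fin 3 → ℂ} {V : Set (SymPt W)}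
    (hV : (symCube W).IsOpn V) (hd : quot W ⁻¹' V ⊆ dom W c L) (hne : V.Nonempty) :
    (symCube W).IsLocalEquation (divD0 W) V (descend (u0 c L)) := by
  have hdq : ∀ P : Fin 3 → Pt W, descend (u0 c L) (quot W P) = u0 c L P :=
    fun P => descend_quot (u0_comp c L P)
  have hVo := symOpn_iff.1 hV
  refine isLocalEquation_of (symReg_iff.2 ?_) ?_ ?_ ?_
  · exact (reg_u0 hVo c fun P hP i => (hd hP i).1).congr fun P _ => hdq P
  · intro D hD hDZ
    obtain ⟨P, rfl⟩ := quot_surjective D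
    rw [hdq, u0_eq_zero_iff (hd hD)]
    exact mem_divD0.1 hDZ
  · obtain ⟨D, hD⟩ := hne
    obtain ⟨P, rfl⟩ := quot_surjective D
    obtain ⟨Q, hQ1, hQ2⟩ := opn_inter_nonempty hVo opn_ne_zero ⟨P, hD⟩ exists_ne_zero
    refine ⟨Q, hQ1, ?_⟩
    rw [hdq, Ne, u0_eq_zero_iff (hd hQ1)]
    simpa using hQ2
  · intro O a hO hOV ha hav P hP
    obtain ⟨O', h1, h2, h3, b, hb, h4⟩ := exists_div_u0 hO (hOV.trans hd) ha
      (fun Q hQ h => hav Q hQ (mem_divD0.2 h)) hP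
    exact ⟨O', h1, h2, h3, b, hb, fun Q hQ => by rw [h4 Q hQ, hdq]⟩

/-! ### Local equations of `G₀` at triples of distinct points -/

theorem symmetric_of_swaps {α : Type*} {f : (Fin 3 → Pt W) → α}
    (h₁ : ∀ P, f (P ∘ Equiv.swap 0 1) = f P) (h₂ : ∀ P, f (P ∘ Equiv.swap 1 2) = f P)
    (σ : Equiv.Perm (Fin 3)) (P : Fin 3 → Pt W) : f (P ∘ σ) = f P := by
  have : ∀ σ : Equiv.Perm (Fin 3), σ = 1 ∨ σ = Equiv.swap 0 1 ∨ σ = Equiv.swap 1 2 ∨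
      σ = Equiv.swap 0 1 * Equiv.swap 1 2 ∨ σ = Equiv.swap 1 2 * Equiv.swap 0 1 ∨
      σ = Equiv.swap 0 1 * Equiv.swap 1 2 * Equiv.swap 0 1 := by decide
  rcases this σ with rfl | rfl | rfl | rfl | rfl | rfl
  · rfl
  · exact h₁ P
  · exact h₂ P
  · rw [Equiv.Perm.coe_mul, ← Function.comp_assoc, h₂, h₁]
  · rw [Equiv.Perm.coe_mul, ← Function.comp_assoc, h₁, h₂]
  · rw [Equiv.Perm.coe_mul, Equiv.Perm.coe_mul, ← Function.comp_assoc, ← Function.comp_assoc, h₁, h₂,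
      h₁]

theorem comp_swap01 (P : Fin 3 → Pt W) :
    (P ∘ Equiv.swap 0 1) 0 = P 1 ∧ (P ∘ Equiv.swap 0 1) 1 = P 0 ∧ (P ∘ Equiv.swap 0 1) 2 = P 2 :=
  ⟨rfl, rfl, rfl⟩

theorem comp_swap12 (P : Fin 3 → Pt W) :
    (P ∘ Equiv.swap 1 2) 0 = P 0 ∧ (P ∘ Equiv.swap 1 2) 1 = P 2 ∧ (P ∘ Equiv.swap 1 2) 2 = P 1 :=
  ⟨rfl, rfl, rfl⟩

/-- The function on `E` with values the ratio of the linear forms `ℓ` and `L`. -/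
def ratio (L l : Fin 3 → ℂ) (Q : Pt W) : ℂ := ∑ k, l k * nc L Q k

/-- The Vandermonde determinant of the values of `ratio L l`. -/
def vander (L l : Fin 3 → ℂ) (P : Fin 3 → Pt W) : ℂ :=
  (ratio L l (P 1) - ratio L l (P 0)) * (ratio L l (P 2) - ratio L l (P 0)) *
    (ratio L l (P 2) - ratio L l (P 1))

/-- The triples of points on which `ratio L l` is defined and has distinct values. -/
def ddom (W : WeierstrassCurve ℂ) (L l : Fin 3 → ℂ) : Set (Fin 3 → Pt W) :=
  {P | (∀ i, lin L (P i) ≠ 0) ∧ vander L l P ≠ 0}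

/-- The local equation of `G₀`. -/
def g0 (L l : Fin 3 → ℂ) (P : Fin 3 → Pt W) : ℂ :=
  det3 (nc L (P 0)) (nc L (P 1)) (nc L (P 2)) / vander L l P

/-- The determinant and the Vandermonde product are both alternating, so their quotient is
symmetric. -/
theorem g0_comp (L l : Fin 3 → ℂ) (P : Fin 3 → Pt W) (σ : Equiv.Perm (Fin 3)) :
    g0 L l (P ∘ σ) = g0 L l P := by
  refine symmetric_of_swaps (f := g0 L l) (fun P => ?_) (fun P => ?_) σ P
  · obtain ⟨h0, h1, h2⟩ := comp_swap01 P
    simp only [g0, vander, h0, h1, h2]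
    rw [← neg_div_neg_eq]
    congr 1
    · simp only [det3]; ring
    · ring
  · obtain ⟨h0, h1, h2⟩ := comp_swap12 P
    simp only [g0, vander, h0, h1, h2]
    rw [← neg_div_neg_eq]
    congr 1
    · simp only [det3]; ring
    · ring

theorem reg_ratio {U : Set (Fin 3 → Pt W)} (hU : Opn U) {L : Fin 3 → ℂ} (l : Fin 3 → ℂ)
    (h : ∀ P ∈ U, ∀ i, lin L (P i) ≠ 0) (i : Fin 3) : Reg U (fun P => ratio L l (P i)) :=
  Reg.sum hU _ fun k _ => (reg_nc hU h i k).const_mul hU _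

theorem reg_vander {U : Set (Fin 3 → Pt W)} (hU : Opn U) {L : Fin 3 → ℂ} (l : Fin 3 → ℂ)
    (h : ∀ P ∈ U, ∀ i, lin L (P i) ≠ 0) : Reg U (vander L l) :=
  (((reg_ratio hU l h 1).sub hU (reg_ratio hU l h 0)).mul
    ((reg_ratio hU l h 2).sub hU (reg_ratio hU l h 0))).mul
    ((reg_ratio hU l h 2).sub hU (reg_ratio hU l h 1))

theorem reg_det3 {U : Set (Fin 3 → Pt W)} (hU : Opn U) {a b c : (Fin 3 → Pt W) → Fin 3 → ℂ}
    (ha : ∀ k, Reg U fun P => a P k) (hb : ∀ k, Reg U fun P => b P k)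
    (hc : ∀ k, Reg U fun P => c P k) : Reg U (fun P => det3 (a P) (b P) (c P)) :=
  (((ha 0).mul (((hb 1).mul (hc 2)).sub hU ((hb 2).mul (hc 1)))).sub hU
    ((ha 1).mul (((hb 0).mul (hc 2)).sub hU ((hb 2).mul (hc 0))))).add
    ((ha 2).mul (((hb 0).mul (hc 1)).sub hU ((hb 1).mul (hc 0))))

theorem opn_ddom (L l : Fin 3 → ℂ) : Opn (ddom W L l) :=
  (reg_vander (opn_lin (W := W) L) l fun _ h => h).opn_ne

theorem reg_g0 {U : Set (Fin 3 → Pt W)} (hU : Opn U) {L l : Fin 3 → ℂ} (h : U ⊆ ddom W L l) :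
    Reg U (g0 L l) := by
  have hl := fun P hP => (h hP : P ∈ ddom W L l).1
  exact (reg_det3 hU (reg_nc hU hl 0) (reg_nc hU hl 1) (reg_nc hU hl 2)).div
    (reg_vander hU l hl) fun P hP => (h hP).2

theorem det3_nc {L : Fin 3 → ℂ} (P : Fin 3 → Pt W) :
    det3 (nc L (P 0)) (nc L (P 1)) (nc L (P 2)) =
      (lin L (P 0))⁻¹ * (lin L (P 1))⁻¹ * (lin L (P 2))⁻¹ *
        det3 (sc (P 0)) (sc (P 1)) (sc (P 2)) := by
  simp only [det3, nc, Pi.smul_apply, smul_eq_mul]; ring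

theorem g0_eq_zero_iff [W.IsElliptic] {L l : Fin 3 → ℂ} {P : Fin 3 → Pt W} (h : P ∈ ddom W L l) :
    g0 L l P = 0 ↔ P 0 + P 1 + P 2 = 0 := by
  obtain ⟨hl, hv⟩ := h
  rw [g0, div_eq_zero_iff, or_iff_left hv, det3_nc]
  have h0 : (lin L (P 0))⁻¹ * (lin L (P 1))⁻¹ * (lin L (P 2))⁻¹ ≠ 0 :=
    mul_ne_zero (mul_ne_zero (inv_ne_zero (hl 0)) (inv_ne_zero (hl 1))) (inv_ne_zero (hl 2))
  rw [mul_eq_zero, or_iff_right h0]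
  refine ⟨fun h => ?_, det_eq_zero_of_sum_eq_zero⟩
  simp only [vander, mul_ne_zero_iff, sub_ne_zero] at hv
  exact sum_eq_zero_of_det_eq_zero (fun h => hv.1.1 (by rw [h])) (fun h => hv.1.2 (by rw [h]))
    (fun h => hv.2 (by rw [h])) h

/-! ### Polar forms, residual intersection points and division by the equation of G₀ -/

/-- The derivative of the cubic form at `a` in the direction `b`. -/
def polar (W : WeierstrassCurve ℂ) (a b : Fin 3 → ℂ) : ℂ :=
  2 * a 1 * a 2 * b 1 + a 1 ^ 2 * b 2 - 3 * a 0 ^ 2 * b 0 -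
    sA W * (a 2 ^ 2 * b 0 + 2 * a 0 * a 2 * b 2) - 3 * sB W * a 2 ^ 2 * b 2

theorem cubicForm_add (p v : Fin 3 → ℂ) (r : ℂ) : cubicForm W (p + r • v) =
    cubicForm W p + r * polar W p v + r ^ 2 * polar W v p + r ^ 3 * cubicForm W v := by
  simp only [cubicForm, polar, Pi.add_apply, Pi.smul_apply, smul_eq_mul]; ring

theorem polar_smul_left (s : ℂ) (a b : Fin 3 → ℂ) : polar W (s • a) b = s ^ 2 * polar W a b := by
  simp only [polar, Pi.smul_apply, smul_eq_mul]; ring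

theorem polar_smul_right (s : ℂ) (a b : Fin 3 → ℂ) : polar W a (s • b) = s * polar W a b := by
  simp only [polar, Pi.smul_apply, smul_eq_mul]; ring

/-- Two of the three intersections of the line through a and b with the cubic are known, which gives
the factor st. The remaining linear factor puts the third at β a − α b, with α = `polar W a b` and β
= `polar W b a`. -/
theorem cubicForm_line {a b : Fin 3 → ℂ} (ha : cubicForm W a = 0) (hb : cubicForm W b = 0)
    (s t : ℂ) :
    cubicForm W (s • a + t • b) = s * t * (s * polar W a b + t * polar W b a) := by
  rw [cubicForm_add, cubicForm_smul, ha, hb, polar_smul_left, polar_smul_right]; ring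

/-- If both polars vanished, the cubic would contain the whole line through two of its points. For
affine points this gives (X(Q) − X(P))³ = 0 and then (Y(Q) − Y(P))² = 0. -/
theorem polar_sc_ne_zero {P Q : Pt W} (h : P ≠ Q) :
    ¬(polar W (sc P) (sc Q) = 0 ∧ polar W (sc Q) (sc P) = 0) := by
  rintro ⟨h1, h2⟩
  by_cases hP : P = 0
  · subst hP
    rw [sc_of_ne h.symm] at h1
    simp [polar] at h1
  by_cases hQ : Q = 0
  · subst hQ
    rw [sc_of_ne h] at h2
    simp [polar] at h2
  have cP := curve_eq hP
  have cQ := curve_eq hQ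
  rw [sc_of_ne hP, sc_of_ne hQ] at h1 h2
  simp [polar] at h1 h2
  have h3 : (pX Q - pX P) ^ 3 = 0 := by linear_combination h2 - h1 - cQ + cP
  have hX : pX Q = pX P := sub_eq_zero.1 (pow_eq_zero_iff three_ne_zero |>.1 h3)
  rw [hX] at h1 h2 cQ
  have h4 : (pY Q - pY P) ^ 2 = 0 := by linear_combination cQ + 2 * cP - h1
  exact h (pt_ext hP hQ hX.symm (sub_eq_zero.1 (pow_eq_zero_iff two_ne_zero |>.1 h4)).symm)

theorem polar_nc_ne_zero {L : Fin 3 → ℂ} {P Q : Pt W} (h : P ≠ Q) (hP : lin L P ≠ 0)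
    (hQ : lin L Q ≠ 0) : ¬(polar W (nc L P) (nc L Q) = 0 ∧ polar W (nc L Q) (nc L P) = 0) := by
  simp only [nc, polar_smul_left, polar_smul_right, mul_eq_zero, inv_eq_zero, pow_eq_zero_iff,
    hP, hQ, ne_eq, OfNat.ofNat_ne_zero, not_false_eq_true, false_or]
  exact polar_sc_ne_zero h

/-- Otherwise the cross product of the two coordinate vectors vanishes, they are proportional, and
the points coincide. -/
theorem exists_det3_ne_zero {L : Fin 3 → ℂ} {P Q : Pt W} (h : P ≠ Q) (hP : lin L P ≠ 0)
    (hQ : lin L Q ≠ 0) : ∃ v, det3 (nc L P) (nc L Q) v ≠ 0 := by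
  by_contra! hc
  have h0 := hc ![1, 0, 0]
  have h1 := hc ![0, 1, 0]
  have h2 := hc ![0, 0, 1]
  simp [det3] at h0 h1 h2
  obtain ⟨k, hk⟩ := Function.ne_iff.1 (nc_ne_zero hQ)
  refine h (nc_smul_injective (l := nc L P k / nc L Q k) hP ?_)
  have hk' : nc L Q k ≠ 0 := hk
  funext j
  rw [Pi.smul_apply, smul_eq_mul, div_mul_eq_mul_div, eq_div_iff hk']
  fin_cases k <;> fin_cases j <;> simp <;>
    first
    | ring1
    | linear_combination h0
    | linear_combination h1
    | linear_combination h2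
    | linear_combination -h0
    | linear_combination -h1
    | linear_combination -h2

theorem cramer (a b w v : Fin 3 → ℂ) :
    det3 a b v • w = det3 w b v • a + det3 a w v • b + det3 a b w • v := by
  funext k
  simp only [det3, Pi.add_apply, Pi.smul_apply, smul_eq_mul]
  fin_cases k <;> simp <;> ring

/-- The multiples of the third intersection point of the line through two points. -/
theorem sum_eq_zero_of_third [W.IsElliptic] {L : Fin 3 → ℂ} {P Q R : Pt W} (hP : lin L P ≠ 0)
    (hQ : lin L Q ≠ 0) {v : Fin 3 → ℂ} (hv : det3 (nc L P) (nc L Q) v ≠ 0) {l : ℂ}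
    (hl : l ≠ 0) (hα : polar W (nc L P) (nc L Q) ≠ 0) (hβ : polar W (nc L Q) (nc L P) ≠ 0)
    (hR : sc R = l • (polar W (nc L Q) (nc L P) • nc L P - polar W (nc L P) (nc L Q) • nc L Q)) :
    P + Q + R = 0 := by
  set a := nc L P with ha
  set b := nc L Q with hb
  set α := polar W a b
  set β := polar W b a
  have hsP : sc P = lin L P • a := sc_eq_smul_nc hP
  have hsQ : sc Q = lin L Q • b := sc_eq_smul_nc hQ
  refine sum_eq_zero_of_det_eq_zero ?_ ?_ ?_ ?_
  · rintro rfl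
    apply hv; simp only [det3, ha, hb]; ring
  · rintro rfl
    rw [hsP] at hR
    have : l * α * det3 a b v = 0 := by
      have h1 : det3 a (lin L P • a) v = 0 := by
        simp only [det3, Pi.smul_apply, smul_eq_mul]; ring
      rw [hR] at h1
      simp only [det3, Pi.smul_apply, smul_eq_mul, Pi.sub_apply] at h1 ⊢
      linear_combination -h1
    exact mul_ne_zero (mul_ne_zero hl hα) hv this
  · rintro rfl
    rw [hsQ] at hR
    have : l * β * det3 a b v = 0 := by
      have h1 : det3 (lin L Q • b) b v = 0 := by
        simp only [det3, Pi.smul_apply, smul_eq_mul]; ring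
      rw [hR] at h1
      simp only [det3, Pi.smul_apply, smul_eq_mul, Pi.sub_apply] at h1 ⊢
      linear_combination h1
    exact mul_ne_zero (mul_ne_zero hl hβ) hv this
  · rw [hsP, hsQ, hR]
    simp only [det3, Pi.smul_apply, smul_eq_mul, Pi.sub_apply]; ring

/-- The replacement argument of `exists_div_zf`, now moving the third point to the residual
intersection of the curve with the line through the first two. Up to scale, the coordinates of the
third point differ from those of the residual point by a multiple of the determinant r. The
numerator vanishes at the residual triple, which has sum zero, so it is divisible by r, hence by
`g0`, whose denominator is a unit here. -/
theorem exists_div_g0 [W.IsElliptic] {L l : Fin 3 → ℂ} {O : Set (Fin 3 → Pt W)} (hO : Opn O)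
    (hd : O ⊆ ddom W L l) {a : (Fin 3 → Pt W) → ℂ} (ha : Reg O a)
    (hv : ∀ Q ∈ O, Q 0 + Q 1 + Q 2 = 0 → a Q = 0) {P : Fin 3 → Pt W} (hP : P ∈ O) :
    ∃ O' ⊆ O, Opn O' ∧ P ∈ O' ∧ ∃ b, Reg O' b ∧ ∀ Q ∈ O', a Q = g0 L l Q * b Q := by
  by_cases hsum : P 0 + P 1 + P 2 = 0
  swap
  · have hg := reg_g0 hO hd
    refine ⟨_, fun Q hQ => hQ.1, hg.opn_ne, ⟨hP, fun h => hsum ((g0_eq_zero_iff (hd hP)).1 h)⟩, _,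
      (ha.mono hg.opn_ne fun Q hQ => hQ.1).div (hg.mono hg.opn_ne fun Q hQ => hQ.1)
        fun Q hQ => hQ.2, fun Q hQ => ?_⟩
    rw [mul_div_cancel₀ _ hQ.2]
  obtain ⟨e, d, M, N, D, hM, hN, hD, hMP, hfr⟩ := ha.exists_frac hP
  have hO1 := opn_sev (W := W) hM
  have hsub1 : {Q : Fin 3 → Pt W | sev M Q ≠ 0} ⊆ O := fun Q hQ => (hfr Q hQ).1
  have hl1 : ∀ Q ∈ {Q : Fin 3 → Pt W | sev M Q ≠ 0}, ∀ j, lin L (Q j) ≠ 0 :=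
    fun Q hQ => (hd (hsub1 hQ)).1
  have hlP := (hd hP).1
  have hdist := (hd hP).2
  simp only [vander, mul_ne_zero_iff, sub_ne_zero] at hdist
  have h01 : P 0 ≠ P 1 := fun h => hdist.1.1 (by rw [h])
  have h02 : P 0 ≠ P 2 := fun h => hdist.1.2 (by rw [h])
  have h12 : P 1 ≠ P 2 := fun h => hdist.2 (by rw [h])
  obtain ⟨v, hδP⟩ := exists_det3_ne_zero h01 (hlP 0) (hlP 1)
  let n : Fin 3 → (Fin 3 → Pt W) → Fin 3 → ℂ := fun i Q => nc L (Q i)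
  let δ : (Fin 3 → Pt W) → ℂ := fun Q => det3 (n 0 Q) (n 1 Q) v
  let s : (Fin 3 → Pt W) → ℂ := fun Q => det3 (n 2 Q) (n 1 Q) v
  let t : (Fin 3 → Pt W) → ℂ := fun Q => det3 (n 0 Q) (n 2 Q) v
  let r : (Fin 3 → Pt W) → ℂ := fun Q => det3 (n 0 Q) (n 1 Q) (n 2 Q)
  let α : (Fin 3 → Pt W) → ℂ := fun Q => polar W (n 0 Q) (n 1 Q)
  let β : (Fin 3 → Pt W) → ℂ := fun Q => polar W (n 1 Q) (n 0 Q)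
  -- The third vector is expanded in the basis n₀, n₁, v, with r as the component transverse to the
  -- line.
  have hcr : ∀ Q, δ Q • n 2 Q = s Q • n 0 Q + t Q • n 1 Q + r Q • v := fun Q => cramer _ _ _ _
  let p : (Fin 3 → Pt W) → Fin 3 → ℂ := fun Q => s Q • n 0 Q + t Q • n 1 Q
  let c1 : (Fin 3 → Pt W) → ℂ := fun Q =>
    polar W (p Q) v + r Q * polar W v (p Q) + r Q ^ 2 * cubicForm W v
  -- The cubic vanishes at the third point. Modulo r this is the equation of the residual point, sα
  -- + tβ = 0, times st.
  have hrel : ∀ Q, s Q * t Q * (s Q * α Q + t Q * β Q) + r Q * c1 Q = 0 := by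
    intro Q
    have h1 : cubicForm W (δ Q • n 2 Q) = 0 := by
      rw [cubicForm_smul]; simp only [n]; rw [cubicForm_nc, mul_zero]
    rw [hcr, cubicForm_add, cubicForm_line (cubicForm_nc L _) (cubicForm_nc L _)] at h1
    simp only [c1, p, α, β]
    linear_combination h1
  -- the values at `P`
  have hrP : r P = 0 := by
    change det3 (nc L (P 0)) (nc L (P 1)) (nc L (P 2)) = 0
    rw [det3_nc, det_eq_zero_of_sum_eq_zero hsum, mul_zero]
  -- Since r(P) = 0, a vanishing s or t would make the third point proportional to one of the other
  -- two.
  have hsP : s P ≠ 0 := by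
    intro h0
    have h1 := hcr P
    rw [h0, hrP, zero_smul, zero_smul, zero_add, add_zero] at h1
    refine h12.symm (nc_smul_injective (l := (δ P)⁻¹ * t P) (hlP 2) ?_)
    rw [mul_smul, ← h1, inv_smul_smul₀ hδP]
  have htP : t P ≠ 0 := by
    intro h0
    have h1 := hcr P
    rw [h0, hrP, zero_smul, zero_smul, add_zero, add_zero] at h1
    refine h02.symm (nc_smul_injective (l := (δ P)⁻¹ * s P) (hlP 2) ?_)
    rw [mul_smul, ← h1, inv_smul_smul₀ hδP]
  have hlin : s P * α P + t P * β P = 0 := by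
    have h1 := hrel P
    rw [hrP, zero_mul, add_zero] at h1
    exact (mul_eq_zero.1 h1).resolve_left (mul_ne_zero hsP htP)
  have hαβ := polar_nc_ne_zero h01 (hlP 0) (hlP 1)
  have hαP : α P ≠ 0 := by
    intro h0
    rw [h0, mul_zero, zero_add, mul_eq_zero] at hlin
    exact hαβ ⟨h0, hlin.resolve_left htP⟩
  have hβP : β P ≠ 0 := by
    intro h0
    rw [h0, mul_zero, add_zero, mul_eq_zero] at hlin
    exact hαβ ⟨hlin.resolve_left hsP, h0⟩
  -- regularity
  have reg_polar : ∀ {U : Set (Fin 3 → Pt W)} (_ : Opn U) {a b : (Fin 3 → Pt W) → Fin 3 → ℂ}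
      (_ : ∀ k, Reg U fun P => a P k) (_ : ∀ k, Reg U fun P => b P k),
      Reg U (fun P => polar W (a P) (b P)) := by
    intro U hU a b ha hb
    have hc := reg_const (W := W) hU
    exact ((((((hc 2).mul (ha 1)).mul (ha 2)).mul (hb 1)).add (((ha 1).pow hU 2).mul (hb 2))).sub hU
      (((hc 3).mul ((ha 0).pow hU 2)).mul (hb 0))).sub hU
      ((hc (sA W)).mul ((((ha 2).pow hU 2).mul (hb 0)).add
        ((((hc 2).mul (ha 0)).mul (ha 2)).mul (hb 2)))) |>.sub hU
      ((((hc 3).mul (hc (sB W))).mul ((ha 2).pow hU 2)).mul (hb 2))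
  set O1 : Set (Fin 3 → Pt W) := {Q | sev M Q ≠ 0} with hO1def
  have rn : ∀ i k, Reg O1 (fun Q => n i Q k) := fun i k => reg_nc hO1 hl1 i k
  have rv : ∀ k, Reg O1 (fun _ => v k) := fun k => reg_const hO1 _
  have rδ : Reg O1 δ := reg_det3 hO1 (rn 0) (rn 1) rv
  have rs : Reg O1 s := reg_det3 hO1 (rn 2) (rn 1) rv
  have rt : Reg O1 t := reg_det3 hO1 (rn 0) (rn 2) rv
  have rr : Reg O1 r := reg_det3 hO1 (rn 0) (rn 1) (rn 2)
  have rα : Reg O1 α := reg_polar hO1 (rn 0) (rn 1)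
  have rβ : Reg O1 β := reg_polar hO1 (rn 1) (rn 0)
  have rp : ∀ k, Reg O1 (fun Q => p Q k) := fun k => (rs.mul (rn 0 k)).add (rt.mul (rn 1 k))
  have rc1 : Reg O1 c1 := ((reg_polar hO1 rp rv).add (rr.mul (reg_polar hO1 rv rp))).add
    ((rr.pow hO1 2).mul (reg_const hO1 _))
  have rprod := (((rδ.mul rs).mul rt).mul rα).mul rβ
  have hO2 := rprod.opn_ne
  set O2 : Set (Fin 3 → Pt W) := {Q | Q ∈ O1 ∧ δ Q * s Q * t Q * α Q * β Q ≠ 0} with hO2def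
  have hs21 : O2 ⊆ O1 := fun Q hQ => hQ.1
  have hne : ∀ Q ∈ O2, δ Q ≠ 0 ∧ s Q ≠ 0 ∧ t Q ≠ 0 ∧ α Q ≠ 0 ∧ β Q ≠ 0 := by
    rintro Q ⟨-, hQ⟩
    simp only [mul_ne_zero_iff] at hQ
    tauto
  let Rv : (Fin 3 → Pt W) → Fin 3 → ℂ := fun Q => β Q • n 0 Q - α Q • n 1 Q
  -- From `hcr` and `hrel`, αδ n₂ = −t(β n₀ − α n₁) + r(αv − (c₁/st) n₀). The first term represents
  -- the residual point.
  obtain ⟨b, hb, hdiff⟩ := poly_diff hO2 (N * M)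
    (v := fun Q j => if j = 2 then (α Q * δ Q) • n 2 Q else n j Q)
    (w := fun Q j => if j = 2 then (-t Q) • Rv Q else n j Q)
    (β := fun Q j => if j = 2 then α Q • v - (c1 Q / (s Q * t Q)) • n 0 Q else 0) (τ := r)
    (by
      intro j k
      by_cases hj : j = 2
      · simp only [hj, if_true]
        refine Reg.mono ?_ hO2 hs21
        exact (rt.const_mul hO1 (-1)).mul ((rβ.mul (rn 0 k)).sub hO1 (rα.mul (rn 1 k))) |>.congr
          fun Q _ => by simp [Rv]
      · simp only [hj, if_false]
        exact (rn j k).mono hO2 hs21)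
    (by
      intro j k
      by_cases hj : j = 2
      · simp only [hj, if_true]
        exact ((rα.mul (rv k)).mono hO2 hs21).sub hO2
          (((rc1.mono hO2 hs21).div ((rs.mul rt).mono hO2 hs21)
            fun Q hQ => mul_ne_zero (hne Q hQ).2.1 (hne Q hQ).2.2.1).mul ((rn 0 k).mono hO2 hs21))
      · simp only [hj, if_false]
        exact reg_const hO2 0)
    (rr.mono hO2 hs21)
    (by
      intro Q hQ j k
      by_cases hj : j = 2
      · simp only [hj, if_true]
        obtain ⟨h1, h2, h3, h4, h5⟩ := hne Q hQ
        have e1 := congrFun (hcr Q) k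
        have e2 := hrel Q
        simp only [Rv, Pi.smul_apply, Pi.add_apply, Pi.sub_apply, smul_eq_mul] at e1 ⊢
        field_simp
        linear_combination α Q * s Q * t Q * e1 + n 0 Q k * e2
      · simp [hj])
  have hw : ∀ Q ∈ O2, cev (N * M) (fun j => if j = 2 then (-t Q) • Rv Q else n j Q) = 0 := by
    intro Q hQ
    obtain ⟨h1, h2, h3, h4, h5⟩ := hne Q hQ
    have hlQ := hl1 Q (hs21 hQ)
    have hRv : Rv Q ≠ 0 := by
      intro h0
      have e : det3 (Rv Q) (n 1 Q) v = β Q * δ Q := by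
        simp only [det3, Rv, δ, Pi.smul_apply, Pi.sub_apply, smul_eq_mul]; ring
      rw [h0] at e
      exact mul_ne_zero h5 h1 (by rw [← e]; simp [det3])
    have hFR : cubicForm W (Rv Q) = 0 := by
      have : Rv Q = β Q • n 0 Q + (-α Q) • n 1 Q := by
        simp only [Rv, neg_smul, sub_eq_add_neg]
      rw [this, cubicForm_line (cubicForm_nc L _) (cubicForm_nc L _)]
      simp only [α, β, n]; ring
    obtain ⟨R, m, hm, hR⟩ := exists_sc_eq_smul hRv hFR
    have hsumR : Q 0 + Q 1 + R = 0 := sum_eq_zero_of_third (hlQ 0) (hlQ 1) h1 hm h4 h5 hR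
    have h6 : (fun j => if j = 2 then (-t Q) • Rv Q else n j Q) =
        fun j => (if j = 2 then -t Q * m⁻¹ else (lin L (Q j))⁻¹) •
          sc (Function.update Q 2 R j) := by
      funext j
      by_cases hj : j = 2
      · subst hj; simp [hR, smul_smul, hm]
      · simp [hj, n, nc]
    rw [h6, cev_smul (hN.mul hM)]
    apply mul_eq_zero_of_right
    change sev (N * M) (Function.update Q 2 R) = 0
    rw [sev_mul]
    by_cases hMR : sev M (Function.update Q 2 R) = 0
    · rw [hMR, mul_zero]
    · obtain ⟨h7, h8, h9⟩ := hfr _ hMR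
      rw [hv _ h7 (by simpa using hsumR), eq_comm, div_eq_zero_iff] at h9
      rw [h9.resolve_right h8, zero_mul]
  have hM0 : ∀ Q ∈ O2, cev M (fun j => nc L (Q j)) ≠ 0 :=
    fun Q hQ => (cev_nc_ne_zero_iff hM (hl1 Q (hs21 hQ))).2 (hs21 hQ)
  have hD0 : ∀ Q ∈ O2, cev D (fun j => nc L (Q j)) ≠ 0 :=
    fun Q hQ => (cev_nc_ne_zero_iff hD (hl1 Q (hs21 hQ))).2 (hfr Q (hs21 hQ)).2.1
  have hl2 : ∀ Q ∈ O2, ∀ j, lin L (Q j) ≠ 0 := fun Q hQ => hl1 Q (hs21 hQ)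
  have hn2 := reg_nc hO2 hl2
  -- The exponent d 2 + e 2 is the degree of N · M in the third factor: it undoes the scaling of n₂
  -- by αδ.
  refine ⟨O2, hs21.trans hsub1, hO2, ⟨hMP, ?_⟩, _,
    ((reg_vander hO2 l hl2).mul hb).div (((((rα.mul rδ).mono hO2 hs21).pow hO2 (d 2 + e 2)).mul
      (reg_cev hO2 D hn2)).mul (reg_cev hO2 M hn2)) fun Q hQ => ?_, fun Q hQ => ?_⟩
  · exact mul_ne_zero (mul_ne_zero (mul_ne_zero (mul_ne_zero hδP hsP) htP) hαP) hβP
  · exact mul_ne_zero (mul_ne_zero (pow_ne_zero _ (mul_ne_zero (hne Q hQ).2.2.2.1 (hne Q hQ).1))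
      (hD0 Q hQ)) (hM0 Q hQ)
  · rw [(hfr Q (hs21 hQ)).2.2, sev_div_eq_cev_nc hN hD (hl2 Q hQ)]
    have h6 := hdiff Q hQ
    rw [hw Q hQ, zero_add] at h6
    have h7 : (fun j => if j = 2 then (α Q * δ Q) • n 2 Q else n j Q) =
        fun j => (if j = 2 then α Q * δ Q else 1) • nc L (Q j) := by
      funext j
      by_cases hj : j = 2
      · subst hj; simp [n]
      · simp [hj, n]
    have h8 : cev (N * M) (fun j => nc L (Q j)) =
      cev N (fun j => nc L (Q j)) * cev M (fun j => nc L (Q j)) := by simp [cev]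
    rw [h7, cev_smul (hN.mul hM), h8] at h6
    simp at h6
    have i1 := hM0 Q hQ
    have i2 := hD0 Q hQ
    have i3 := (hd (hsub1 (hs21 hQ))).2
    have i4 := pow_ne_zero (d 2 + e 2) (mul_ne_zero (hne Q hQ).2.2.2.1 (hne Q hQ).1)
    rw [g0, div_mul_div_comm, div_eq_div_iff i2
      (mul_ne_zero i3 (mul_ne_zero (mul_ne_zero i4 i2) i1))]
    change _ = r Q * _ * _
    linear_combination vander L l Q * cev D (fun j => nc L (Q j)) * h6

/-- Three points which are not collinear. -/
theorem exists_sum_ne_zero [W.IsElliptic] : ∃ P : Fin 3 → Pt W, (∀ i, P i ≠ 0) ∧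
    P 0 + P 1 + P 2 ≠ 0 := by
  obtain ⟨Q, -, hQ⟩ := (infinite_pt (W := W)).exists_notMem_finite (Set.finite_singleton 0)
  obtain ⟨R, -, hR⟩ := (infinite_pt (W := W)).exists_notMem_finite (Set.toFinite {0, -(Q + Q)})
  simp only [Set.mem_insert_iff, Set.mem_singleton_iff, not_or] at hR
  refine ⟨![Q, Q, R], ?_, fun h => hR.2 ?_⟩
  · intro i; fin_cases i
    · exact hQ
    · exact hQ
    · exact hR.1
  · have h : Q + Q + R = 0 := h
    exact (neg_eq_of_add_eq_zero_right h).symm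

theorem isLocalEquation_divG0 [W.IsElliptic] {L l : Fin 3 → ℂ} {V : Set (SymPt W)}
    (hV : (symCube W).IsOpn V) (hd : quot W ⁻¹' V ⊆ ddom W L l) (hne : V.Nonempty) :
    (symCube W).IsLocalEquation (divG0 W) V (descend (g0 L l)) := by
  have hdq : ∀ P : Fin 3 → Pt W, descend (g0 L l) (quot W P) = g0 L l P :=
    fun P => descend_quot fun σ => g0_comp L l P σ
  have hVo := symOpn_iff.1 hV
  refine isLocalEquation_of (symReg_iff.2 ?_) ?_ ?_ ?_
  · exact (reg_g0 hVo hd).congr fun P _ => hdq P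
  · intro D hD hDZ
    obtain ⟨P, rfl⟩ := quot_surjective D
    rw [hdq, g0_eq_zero_iff (hd hD)]
    exact mem_divG0.1 hDZ
  · obtain ⟨D, hD⟩ := hne
    obtain ⟨P, rfl⟩ := quot_surjective D
    obtain ⟨a, b, h⟩ : ∃ a b : Pt W, a ≠ 0 ∧ b ≠ 0 ∧ a ≠ b ∧ a + b ≠ 0 := by
      obtain ⟨a, -, ha⟩ := (infinite_pt (W := W)).exists_notMem_finite (Set.finite_singleton 0)
      obtain ⟨b, -, hb⟩ := (infinite_pt (W := W)).exists_notMem_finite (Set.toFinite {0, a, -a})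
      simp only [Set.mem_insert_iff, Set.mem_singleton_iff, not_or] at hb
      exact ⟨a, b, ha, hb.1, Ne.symm hb.2.1, fun h => hb.2.2 (neg_eq_of_add_eq_zero_right h).symm⟩
    have hopn := (reg_det3 (opn_lin (W := W) L) (reg_nc (opn_lin L) (fun _ h => h) 0)
      (reg_nc (opn_lin L) (fun _ h => h) 1) (reg_nc (opn_lin L) (fun _ h => h) 2)).opn_ne
    obtain ⟨L', hL'⟩ := exists_form (fun i => sc ((![0, a, b] : Fin 3 → Pt W) i))
      fun i => sc_ne_zero _
    have hopn' := (reg_det3 (opn_lin (W := W) L') (reg_nc (opn_lin L') (fun _ h => h) 0)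
      (reg_nc (opn_lin L') (fun _ h => h) 1) (reg_nc (opn_lin L') (fun _ h => h) 2)).opn_ne
    obtain ⟨Q, hQ1, hQ2⟩ := opn_inter_nonempty hVo hopn' ⟨P, hD⟩ ⟨![0, a, b], hL', by
      have h3 : lin L' (0 : Pt W) ≠ 0 ∧ lin L' a ≠ 0 ∧ lin L' b ≠ 0 := ⟨hL' 0, hL' 1, hL' 2⟩
      rw [det3_nc]
      refine mul_ne_zero (mul_ne_zero (mul_ne_zero (inv_ne_zero (hL' 0)) (inv_ne_zero (hL' 1)))
        (inv_ne_zero (hL' 2))) fun h0 => h.2.2.2 ?_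
      have := sum_eq_zero_of_det_eq_zero (P := 0) (Q := a) (R := b) h.1.symm h.2.1.symm h.2.2.1 h0
      rwa [zero_add] at this⟩
    refine ⟨Q, hQ1, ?_⟩
    rw [hdq, Ne, g0_eq_zero_iff (hd hQ1)]
    intro hs
    apply hQ2.2
    rw [det3_nc, det_eq_zero_of_sum_eq_zero hs, mul_zero]
  · intro O a hO hOV ha hav P hP
    obtain ⟨O', h1, h2, h3, b, hb, h4⟩ := exists_div_g0 hO (hOV.trans hd) ha
      (fun Q hQ h => hav Q hQ (mem_divG0.2 h)) hP
    exact ⟨O', h1, h2, h3, b, hb, fun Q hQ => by rw [h4 Q hQ, hdq]⟩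

/-! ### Shrinking trivializations and symmetric open sets -/

theorem isLocalEquation_mono {Z V V' : Set (SymPt W)} {u : SymPt W → ℂ}
    (h : (symCube W).IsLocalEquation Z V u) (hV' : (symCube W).IsOpn V') (hs : V' ⊆ V) :
    (symCube W).IsLocalEquation Z V' u where
  regular := Reg.mono h.regular (symOpn_iff.1 hV') fun _ hP => hs hP
  vanish P hP := h.vanish P (hs hP)
  generates V'' hV'' hs' := h.generates V'' hV'' (hs'.trans hs)

theorem isTrivialization_mono {V V' : Set (SymPt W)} {u g : SymPt W → ℂ}
    (h : IsTrivialization W V u g) (hV' : (symCube W).IsOpn V') (hs : V' ⊆ V) :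
    IsTrivialization W V' u g :=
  ⟨hV', isLocalEquation_mono h.eqD0 hV' hs, isLocalEquation_mono h.eqG0 hV' hs⟩

theorem symOpn_inter {V V' : Set (SymPt W)} (h : (symCube W).IsOpn V)
    (h' : (symCube W).IsOpn V') : (symCube W).IsOpn (V ∩ V') :=
  (symCube W).top.isOpen_inter _ _ h h'

theorem symOpn_image {O : Set (Fin 3 → Pt W)} (hO : Opn O)
    (hs : ∀ P ∈ O, ∀ σ : Equiv.Perm (Fin 3), P ∘ σ ∈ O) : (symCube W).IsOpn (quot W '' O) := by
  rw [symOpn_iff, preimage_image_quot hs]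
  exact hO

theorem dom_comp {c : ℂ} {L : Fin 3 → ℂ} (P : Fin 3 → Pt W) (hP : P ∈ dom W c L)
    (σ : Equiv.Perm (Fin 3)) : P ∘ σ ∈ dom W c L := fun i => hP (σ i)

theorem ddom_comp {L l : Fin 3 → ℂ} (P : Fin 3 → Pt W) (hP : P ∈ ddom W L l)
    (σ : Equiv.Perm (Fin 3)) : P ∘ σ ∈ ddom W L l := by
  refine ⟨fun i => hP.1 (σ i), ?_⟩
  have h : vander L l (P ∘ σ) ^ 2 = vander L l P ^ 2 := by
    refine symmetric_of_swaps (f := fun P => vander L l P ^ 2) (fun P => ?_) (fun P => ?_) σ P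
    · obtain ⟨h0, h1, h2⟩ := comp_swap01 P
      simp only [vander, h0, h1, h2]; ring
    · obtain ⟨h0, h1, h2⟩ := comp_swap12 P
      simp only [vander, h0, h1, h2]; ring
  intro h0
  rw [h0, zero_pow two_ne_zero] at h
  exact hP.2 (pow_eq_zero_iff two_ne_zero |>.1 h.symm)

/-! ### Sections given by symmetric tensors -/

/-- The trilinear form with coefficients `C`. -/
def tri (C : Fin 4 → Fin 4 → Fin 4 → ℂ) (x y z : Fin 4 → ℂ) : ℂ :=
  ∑ i, ∑ j, ∑ k, C i j k * x i * y j * z k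

theorem tri_add (C C' : Fin 4 → Fin 4 → Fin 4 → ℂ) (x y z : Fin 4 → ℂ) :
    tri (C + C') x y z = tri C x y z + tri C' x y z := by
  simp only [tri, Pi.add_apply, add_mul, Finset.sum_add_distrib]

theorem tri_smul (s : ℂ) (C : Fin 4 → Fin 4 → Fin 4 → ℂ) (x y z : Fin 4 → ℂ) :
    tri (s • C) x y z = s * tri C x y z := by
  simp only [tri, Pi.smul_apply, smul_eq_mul, Finset.mul_sum, mul_assoc]

theorem tri_smul_args (C : Fin 4 → Fin 4 → Fin 4 → ℂ) (r s t : ℂ) (x y z : Fin 4 → ℂ) :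
    tri C (r • x) (s • y) (t • z) = r * s * t * tri C x y z := by
  simp only [tri, Pi.smul_apply, smul_eq_mul, Finset.mul_sum]
  refine Finset.sum_congr rfl fun i _ => Finset.sum_congr rfl fun j _ =>
    Finset.sum_congr rfl fun k _ => ?_
  ring

/-- Symmetric tensors. -/
structure IsSymm (C : Fin 4 → Fin 4 → Fin 4 → ℂ) : Prop where
  swap₁ : ∀ i j k, C i j k = C j i k
  swap₂ : ∀ i j k, C i j k = C i k j

theorem IsSymm.tri_swap₁ {C : Fin 4 → Fin 4 → Fin 4 → ℂ} (h : IsSymm C) (x y z : Fin 4 → ℂ) :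
    tri C x y z = tri C y x z := by
  simp only [tri]
  rw [Finset.sum_comm]
  refine Finset.sum_congr rfl fun i _ => Finset.sum_congr rfl fun j _ =>
    Finset.sum_congr rfl fun k _ => ?_
  rw [h.swap₁]; ring

theorem IsSymm.tri_swap₂ {C : Fin 4 → Fin 4 → Fin 4 → ℂ} (h : IsSymm C) (x y z : Fin 4 → ℂ) :
    tri C x y z = tri C x z y := by
  simp only [tri]
  refine Finset.sum_congr rfl fun i _ => ?_
  rw [Finset.sum_comm]
  refine Finset.sum_congr rfl fun j _ => Finset.sum_congr rfl fun k _ => ?_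
  rw [h.swap₂]; ring

theorem IsSymm.add {C C' : Fin 4 → Fin 4 → Fin 4 → ℂ} (h : IsSymm C) (h' : IsSymm C') :
    IsSymm (C + C') :=
  ⟨fun i j k => by simp only [Pi.add_apply]; rw [h.swap₁, h'.swap₁],
    fun i j k => by simp only [Pi.add_apply]; rw [h.swap₂, h'.swap₂]⟩

theorem IsSymm.smul {C : Fin 4 → Fin 4 → Fin 4 → ℂ} (h : IsSymm C) (s : ℂ) : IsSymm (s • C) :=
  ⟨fun i j k => by simp only [Pi.smul_apply]; rw [h.swap₁],
    fun i j k => by simp only [Pi.smul_apply]; rw [h.swap₂]⟩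

/-- The values of `1, X, Y, X²` at a point of `E`, as sections of `𝒪(4 · 0)`. -/
def e4 (Q : Pt W) : Fin 4 → ℂ :=
  open Classical in if Q = 0 then ![0, 0, 0, 1] else ![1, pX Q, pY Q, pX Q ^ 2]

@[simp] theorem e4_zero : e4 (0 : Pt W) = ![0, 0, 0, 1] := by simp [e4]

theorem e4_of_ne {Q : Pt W} (h : Q ≠ 0) : e4 Q = ![1, pX Q, pY Q, pX Q ^ 2] := by simp [e4, h]

/-- The section of `𝒪(4 · 0)^{⊠3}` given by a tensor. -/
def T (C : Fin 4 → Fin 4 → Fin 4 → ℂ) (P : Fin 3 → Pt W) : ℂ :=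
  tri C (e4 (P 0)) (e4 (P 1)) (e4 (P 2))

/-- The quadratic form with `μ Z = (X - c Z)³` on the curve. -/
def mu (W : WeierstrassCurve ℂ) (c : ℂ) (v : Fin 3 → ℂ) : ℂ :=
  kap W c v - 3 * c * xp c v ^ 2 - (3 * c ^ 2 + sA W) * xp c v * v 2

/-- The products of `1, X, Y, X²` with the fourth power of the local equation of the zero. -/
def eps (c : ℂ) (L : Fin 3 → ℂ) (Q : Pt W) : Fin 4 → ℂ :=
  ![zf c L Q ^ 4, zf c L Q ^ 2 * mu W c (nc L Q) + c * zf c L Q ^ 4,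
    zf c L Q * nc L Q 1 * mu W c (nc L Q),
    mu W c (nc L Q) ^ 2 + 2 * c * (zf c L Q ^ 2 * mu W c (nc L Q)) + c ^ 2 * zf c L Q ^ 4]

/-- The ratio between `eps` and `e4`. -/
def sfac (c : ℂ) (L : Fin 3 → ℂ) (Q : Pt W) : ℂ :=
  open Classical in if Q = 0 then (lin L Q)⁻¹ ^ 4 else zf c L Q ^ 4

theorem sfac_ne_zero {c : ℂ} {L : Fin 3 → ℂ} {Q : Pt W} (h : InDom c L Q) : sfac c L Q ≠ 0 := by
  unfold sfac
  split_ifs with h0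
  · exact pow_ne_zero _ (inv_ne_zero h.1)
  · exact pow_ne_zero _ fun h1 => h0 ((zf_eq_zero_iff h).1 h1)

/-- On the affine curve zf = (X − c)/L and μ/L² = (X − c)³/L², so the entries of `eps` are zf⁴ times
1, X, Y, X². Written with μ they are regular at the origin as well, where only the X² entry
survives. -/
theorem eps_eq {c : ℂ} {L : Fin 3 → ℂ} {Q : Pt W} (h : lin L Q ≠ 0) :
    eps c L Q = sfac c L Q • e4 Q := by
  by_cases h0 : Q = 0
  · subst h0
    funext k
    fin_cases k <;> simp [eps, sfac, zf, xp, nc, mu, kap]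
    ring
  · have hz : nc L Q 2 = (lin L Q)⁻¹ := by rw [nc, sc_of_ne h0]; simp
    have hx : nc L Q 0 = (lin L Q)⁻¹ * pX Q := by rw [nc, sc_of_ne h0]; simp
    have hy : nc L Q 1 = (lin L Q)⁻¹ * pY Q := by rw [nc, sc_of_ne h0]; simp
    have hzf : zf c L Q = (lin L Q)⁻¹ * (pX Q - c) := by rw [zf, xp, hx, hz]; ring
    have hmu : mu W c (nc L Q) = (lin L Q)⁻¹ ^ 2 * (pX Q - c) ^ 3 := by
      have := curve_eq h0
      rw [mu, kap, xp, hx, hy, hz]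
      linear_combination (lin L Q)⁻¹ ^ 2 * this
    rw [e4_of_ne h0]
    funext k
    fin_cases k <;> simp [eps, sfac, h0, hzf, hmu, hy] <;> ring

/-- The regular function given by a tensor on the domain of a chart. -/
def H (C : Fin 4 → Fin 4 → Fin 4 → ℂ) (c : ℂ) (L : Fin 3 → ℂ) (P : Fin 3 → Pt W) : ℂ :=
  tri C (eps c L (P 0)) (eps c L (P 1)) (eps c L (P 2))

theorem reg_tri {U : Set (Fin 3 → Pt W)} (hU : Opn U) (C : Fin 4 → Fin 4 → Fin 4 → ℂ)
    {x y z : (Fin 3 → Pt W) → Fin 4 → ℂ} (hx : ∀ k, Reg U fun P => x P k)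
    (hy : ∀ k, Reg U fun P => y P k) (hz : ∀ k, Reg U fun P => z P k) :
    Reg U (fun P => tri C (x P) (y P) (z P)) :=
  Reg.sum hU _ fun i _ => Reg.sum hU _ fun j _ => Reg.sum hU _ fun k _ =>
    (((reg_const hU _).mul (hx i)).mul (hy j)).mul (hz k)

theorem reg_eps {U : Set (Fin 3 → Pt W)} (hU : Opn U) {L : Fin 3 → ℂ} (c : ℂ)
    (h : ∀ P ∈ U, ∀ i, lin L (P i) ≠ 0) (i : Fin 3) (k : Fin 4) :
    Reg U (fun P => eps c L (P i) k) := by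
  have hz := reg_zf hU c h i
  have hm : Reg U fun P => mu W c (nc L (P i)) :=
    ((reg_kap hU c h i).sub hU ((hz.pow hU 2).const_mul hU _)).sub hU
      ((hz.const_mul hU (3 * c ^ 2 + sA W)).mul (reg_nc hU h i 2))
  fin_cases k
  · exact hz.pow hU 4
  · exact ((hz.pow hU 2).mul hm).add ((hz.pow hU 4).const_mul hU c)
  · exact (hz.mul (reg_nc hU h i 1)).mul hm
  · exact ((hm.pow hU 2).add (((hz.pow hU 2).mul hm).const_mul hU (2 * c))).add
      ((hz.pow hU 4).const_mul hU (c ^ 2))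

theorem reg_H {U : Set (Fin 3 → Pt W)} (hU : Opn U) {L : Fin 3 → ℂ} (c : ℂ)
    (h : ∀ P ∈ U, ∀ i, lin L (P i) ≠ 0) (C : Fin 4 → Fin 4 → Fin 4 → ℂ) : Reg U (H C c L) :=
  reg_tri hU C (reg_eps hU c h 0) (reg_eps hU c h 1) (reg_eps hU c h 2)

theorem H_eq {C : Fin 4 → Fin 4 → Fin 4 → ℂ} {c : ℂ} {L : Fin 3 → ℂ} {P : Fin 3 → Pt W}
    (h : ∀ i, lin L (P i) ≠ 0) :
    H C c L P = sfac c L (P 0) * sfac c L (P 1) * sfac c L (P 2) * T C P := by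
  rw [H, eps_eq (h 0), eps_eq (h 1), eps_eq (h 2), tri_smul_args, T]

theorem H_eq_of_ne {C : Fin 4 → Fin 4 → Fin 4 → ℂ} {c : ℂ} {L : Fin 3 → ℂ} {P : Fin 3 → Pt W}
    (h : ∀ i, lin L (P i) ≠ 0) (h0 : ∀ i, P i ≠ 0) : H C c L P = T C P * u0 c L P ^ 4 := by
  rw [H_eq h, u0, Fin.prod_univ_three]
  simp only [sfac, h0, if_false]
  ring

theorem IsSymm.T_comp {C : Fin 4 → Fin 4 → Fin 4 → ℂ} (h : IsSymm C) (P : Fin 3 → Pt W)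
    (σ : Equiv.Perm (Fin 3)) : T C (P ∘ σ) = T C P := by
  refine symmetric_of_swaps (f := T C) (fun P => ?_) (fun P => ?_) σ P
  · obtain ⟨h0, h1, h2⟩ := comp_swap01 P
    simp only [T, h0, h1, h2]
    exact h.tri_swap₁ _ _ _
  · obtain ⟨h0, h1, h2⟩ := comp_swap12 P
    simp only [T, h0, h1, h2]
    exact h.tri_swap₂ _ _ _

theorem IsSymm.H_comp {C : Fin 4 → Fin 4 → Fin 4 → ℂ} (h : IsSymm C) (c : ℂ) (L : Fin 3 → ℂ)
    (P : Fin 3 → Pt W) (σ : Equiv.Perm (Fin 3)) : H C c L (P ∘ σ) = H C c L P := by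
  refine symmetric_of_swaps (f := H C c L) (fun P => ?_) (fun P => ?_) σ P
  · obtain ⟨h0, h1, h2⟩ := comp_swap01 P
    simp only [H, h0, h1, h2]
    exact h.tri_swap₁ _ _ _
  · obtain ⟨h0, h1, h2⟩ := comp_swap12 P
    simp only [H, h0, h1, h2]
    exact h.tri_swap₂ _ _ _

/-- The rational function on `E⁽³⁾` given by a symmetric tensor. -/
def sec (W : WeierstrassCurve ℂ) (C : Fin 4 → Fin 4 → Fin 4 → ℂ) (D : {D : SymPt W // D ∉ divD0 W}) : ℂ :=
  descend (T C) D.1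

theorem exists_eq_u0_mul [W.IsElliptic] {V : Set (SymPt W)} (hV : (symCube W).IsOpn V) {p : SymPt W} (hp : p ∈ V)
    {c : ℂ} {L : Fin 3 → ℂ} (hd : quot W ⁻¹' V ⊆ dom W c L) {u : SymPt W → ℂ}
    (hu : (symCube W).RegularOn V u) (hv : ∀ D ∈ V, D ∈ divD0 W → u D = 0) :
    ∃ V' ⊆ V, (symCube W).IsOpn V' ∧ p ∈ V' ∧ ∃ b, (symCube W).RegularOn V' b ∧
      ∀ D ∈ V', u D = descend (u0 c L) D * b D := by
  obtain ⟨V', h1, h2, h3, b, hb, h4⟩ :=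
    (isLocalEquation_divD0 hV hd ⟨p, hp⟩).generates V hV subset_rfl u hu hv p hp
  exact ⟨V', h3, h1, h2, b, hb, h4⟩

/-- In a chart any admissible equation of D₀ is u = u₀b with b regular, so T · u⁴ extends to the
regular function H · b⁴. It vanishes on G₀ and is therefore locally divisible by g. -/
theorem sec_mem [W.IsElliptic] {C : Fin 4 → Fin 4 → Fin 4 → ℂ} (hC : IsSymm C)
    (hG : ∀ P : Fin 3 → Pt W, P 0 + P 1 + P 2 = 0 → T C P = 0) :
    sec W C ∈ globalSections W := by
  intro V u g ht p hp
  obtain ⟨P, rfl⟩ := quot_surjective p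
  obtain ⟨c, L, hPd⟩ := exists_mem_dom P
  have hV0 := symOpn_image (opn_dom (W := W) c L) dom_comp
  have hpre := preimage_image_quot (dom_comp (W := W) (c := c) (L := L))
  have hV1 := symOpn_inter ht.isOpn hV0
  have hd1 : quot W ⁻¹' (V ∩ quot W '' dom W c L) ⊆ dom W c L := by
    intro Q hQ; rw [← hpre]; exact hQ.2
  have ht1 := isTrivialization_mono ht hV1 Set.inter_subset_left
  obtain ⟨V2, hs2, ho2, hp2, b, hb, hub⟩ := exists_eq_u0_mul hV1 ⟨hp, P, hPd, rfl⟩ hd1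
    ht1.eqD0.regular ht1.eqD0.vanish
  have hd2 : ∀ Q, quot W Q ∈ V2 → ∀ i, lin L (Q i) ≠ 0 := fun Q hQ i => (hd1 (hs2 hQ) i).1
  have hHq : ∀ Q : Fin 3 → Pt W, descend (H C c L) (quot W Q) = H C c L Q :=
    fun Q => descend_quot (hC.H_comp c L Q)
  have huq : ∀ Q : Fin 3 → Pt W, descend (u0 c L) (quot W Q) = u0 c L Q :=
    fun Q => descend_quot (u0_comp c L Q)
  have hreg : (symCube W).RegularOn V2 fun D => descend (H C c L) D * b D ^ 4 := by
    have ho := symOpn_iff.1 ho2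
    exact Reg.mul ((reg_H ho c hd2 C).congr fun Q _ => hHq Q) (Reg.pow ho (symReg_iff.1 hb) 4)
  obtain ⟨V3, h31, h32, h33, h, hh, hgh⟩ := ht1.eqG0.generates V2 ho2 hs2 _ hreg (by
    intro D hD hDG
    obtain ⟨Q, rfl⟩ := quot_surjective D
    rw [hHq, H_eq (hd2 Q hD), hG Q (mem_divG0.1 hDG), mul_zero, zero_mul]) _ hp2
  refine ⟨V3, h31, h32, (h33.trans hs2).trans Set.inter_subset_left, h, hh, fun D hD hDV => ?_⟩
  obtain ⟨Q, rfl⟩ := quot_surjective D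
  have hQ0 : ∀ i, Q i ≠ 0 := fun i hi => hD (mem_divD0.2 ⟨i, hi⟩)
  rw [← hgh _ hDV, hHq, H_eq_of_ne (hd2 Q (h33 hDV)) hQ0, hub _ (h33 hDV), huq, sec,
    descend_quot (hC.T_comp Q)]
  ring

/-- If the section given by a tensor vanishes at a point, its expression in a chart is locally a
multiple of the product of an equation of `G₀` and a function vanishing at the point. -/
theorem exists_factor_of_vanishesAt [W.IsElliptic] {C : Fin 4 → Fin 4 → Fin 4 → ℂ} (hC : IsSymm C)
    {s : globalSections W} (hs : s.1 = sec W C) {P : Fin 3 → Pt W} (hv : VanishesAt s (quot W P))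
    {c : ℂ} {L : Fin 3 → ℂ} (hP : P ∈ dom W c L) :
    ∃ (O : Set (Fin 3 → Pt W)) (g h : (Fin 3 → Pt W) → ℂ), Opn O ∧ P ∈ O ∧ Reg O g ∧ Reg O h ∧
      (∀ Q ∈ O, H C c L Q = g Q * h Q) ∧ h P = 0 ∧ (P 0 + P 1 + P 2 = 0 → g P = 0) := by
  obtain ⟨V, u, g, h, ht, hpV, ⟨hh, he⟩, hhp⟩ := hv
  have hV0 := symOpn_image (opn_dom (W := W) c L) dom_comp
  have hpre := preimage_image_quot (dom_comp (W := W) (c := c) (L := L))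
  have hV1 := symOpn_inter ht.isOpn hV0
  have hd1 : quot W ⁻¹' (V ∩ quot W '' dom W c L) ⊆ dom W c L := by
    intro Q hQ; rw [← hpre]; exact hQ.2
  have huq : ∀ Q : Fin 3 → Pt W, descend (u0 c L) (quot W Q) = u0 c L Q :=
    fun Q => descend_quot (u0_comp c L Q)
  have ho1 := symOpn_iff.1 hV1
  have hreg : (symCube W).RegularOn (V ∩ quot W '' dom W c L) (descend (u0 c L)) :=
    (reg_u0 ho1 c fun Q hQ i => (hd1 hQ i).1).congr fun Q _ => huq Q
  -- Here u is the given generator, so divisibility is used in the other direction: u₀ = u b.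
  obtain ⟨V2, ho2, hp2, hs2, b, hb, hub⟩ := ht.eqD0.generates _ hV1 Set.inter_subset_left _ hreg (by
    intro D hD hD0
    obtain ⟨Q, rfl⟩ := quot_surjective D
    rw [huq, u0_eq_zero_iff (hd1 hD)]
    exact mem_divD0.1 hD0) _ ⟨hpV, P, hP, rfl⟩
  have ho2' := symOpn_iff.1 ho2
  have hs2' : ∀ Q, quot W Q ∈ V2 → Q ∈ dom W c L := fun Q hQ => hd1 (hs2 hQ)
  have rg : Reg (quot W ⁻¹' V2) (g ∘ quot W) :=
    Reg.mono (symReg_iff.1 ht.eqG0.regular) ho2' fun Q hQ => (hs2 hQ).1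
  have rh : Reg (quot W ⁻¹' V2) fun Q => h (quot W Q) * b (quot W Q) ^ 4 :=
    (Reg.mono (symReg_iff.1 hh) ho2' fun Q hQ => (hs2 hQ).1).mul
      (Reg.pow ho2' (symReg_iff.1 hb) 4)
  have rH := reg_H ho2' c (fun Q hQ i => (hs2' Q hQ i).1) C
  refine ⟨quot W ⁻¹' V2, g ∘ quot W, fun Q => h (quot W Q) * b (quot W Q) ^ 4, ho2', hp2, rg, rh,
    fun Q hQ => ?_, by simp [hhp], fun hsum => ht.eqG0.vanish _ hpV (mem_divG0.2 hsum)⟩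
  refine sub_eq_zero.1 ((rH.sub ho2' (rg.mul rh)).eq_zero opn_ne_zero exists_ne_zero
    (fun R hR hR0 => ?_) Q hQ)
  have hRD : quot W R ∉ divD0 W := fun hc => by
    obtain ⟨i, hi⟩ := mem_divD0.1 hc; exact hR0 i hi
  have e1 := he _ hRD (hs2 hR).1
  have e2 := hub _ hR
  rw [huq] at e2
  rw [hs, sec, descend_quot (hC.T_comp R)] at e1
  rw [H_eq_of_ne (fun i => (hs2' R hR i).1) hR0, e2]
  simp only [Function.comp]
  linear_combination b (quot W R) ^ 4 * e1

theorem not_vanishesAt_of_T_ne_zero [W.IsElliptic] {C : Fin 4 → Fin 4 → Fin 4 → ℂ} (hC : IsSymm C)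
    {s : globalSections W} (hs : s.1 = sec W C) {P : Fin 3 → Pt W} (hT : T C P ≠ 0) :
    ¬VanishesAt s (quot W P) := by
  intro hv
  obtain ⟨c, L, hP⟩ := exists_mem_dom P
  obtain ⟨O, g, h, hO, hPO, -, -, he, hh, -⟩ := exists_factor_of_vanishesAt hC hs hv hP
  have := he P hPO
  rw [hh, mul_zero, H_eq fun i => (hP i).1] at this
  exact mul_ne_zero (mul_ne_zero (mul_ne_zero (sfac_ne_zero (hP 0)) (sfac_ne_zero (hP 1)))
    (sfac_ne_zero (hP 2))) hT this

/-- At a point of G₀ where the section vanishes, H is a product of two functions both vanishing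
there, so its derivative along every curve is zero. -/
theorem deriv_H_eq_zero_of_vanishesAt [W.IsElliptic] {C : Fin 4 → Fin 4 → Fin 4 → ℂ} (hC : IsSymm C)
    {s : globalSections W} (hs : s.1 = sec W C) {γ : Fin 3 → ℂ → Pt W}
    {cc : Fin 3 → ℂ → Fin 3 → ℂ} {c' : Fin 3 → Fin 3 → ℂ} (hγ : ∀ i, IsParam (γ i) (cc i) (c' i))
    (hsum : γ 0 0 + γ 1 0 + γ 2 0 = 0) (hv : VanishesAt s (quot W fun i => γ i 0))
    {c : ℂ} {L : Fin 3 → ℂ} (hP : (fun i => γ i 0) ∈ dom W c L) :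
    HasDerivAt (fun t => H C c L (fun i => γ i t)) 0 0 := by
  obtain ⟨O, g, h, hO, hPO, hg, hh, he, h0, g0⟩ := exists_factor_of_vanishesAt hC hs hv hP
  have d1 := (IsParam.differentiableAt hγ hg hPO).hasDerivAt
  have d2 := (IsParam.differentiableAt hγ hh hPO).hasDerivAt
  refine ((d1.mul d2).congr_of_eventuallyEq ?_).congr_deriv ?_
  · filter_upwards [IsParam.eventually_mem hγ hO hPO] with t ht using he _ ht
  · rw [h0, g0 hsum]; ring

/-! ### Explicit symmetric tensors vanishing on G₀ -/

/-- The elementary tensors. -/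
def el (a b d : Fin 4) : Fin 4 → Fin 4 → Fin 4 → ℂ :=
  fun i j k => if i = a ∧ j = b ∧ k = d then 1 else 0

theorem tri_el (a b d : Fin 4) (x y z : Fin 4 → ℂ) : tri (el a b d) x y z = x a * y b * z d := by
  simp only [tri, el]
  rw [Finset.sum_eq_single a, Finset.sum_eq_single b, Finset.sum_eq_single d]
  · simp
  · intro k _ hk; simp [hk]
  · simp
  · intro j _ hj; simp [hj]
  · simp
  · intro i _ hi; simp [hi]
  · simp

/-- The symmetrized elementary tensors. -/
def ms (a b d : Fin 4) : Fin 4 → Fin 4 → Fin 4 → ℂ :=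
  el a b d + el a d b + el b a d + el b d a + el d a b + el d b a

theorem tri_ms (a b d : Fin 4) (x y z : Fin 4 → ℂ) : tri (ms a b d) x y z =
    x a * y b * z d + x a * y d * z b + x b * y a * z d + x b * y d * z a + x d * y a * z b +
      x d * y b * z a := by
  simp only [ms, tri_add, tri_el]

theorem isSymm_ms (a b d : Fin 4) : IsSymm (ms a b d) := by
  have h1 : ∀ a b d i j k, el a b d i j k = el b a d j i k := by
    intro a b d i j k; simp only [el]; congr 1; simp; tauto
  have h2 : ∀ a b d i j k, el a b d i j k = el a d b i k j := by
    intro a b d i j k; simp only [el]; congr 1; simp; tauto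
  refine ⟨fun i j k => ?_, fun i j k => ?_⟩
  · simp only [ms, Pi.add_apply]
    linear_combination h1 a b d i j k + h1 a d b i j k + h1 b a d i j k + h1 b d a i j k +
      h1 d a b i j k + h1 d b a i j k
  · simp only [ms, Pi.add_apply]
    linear_combination h2 a b d i j k + h2 a d b i j k + h2 b a d i j k + h2 b d a i j k +
      h2 d a b i j k + h2 d b a i j k

variable (W) in
/-- Five tensors vanishing on `G₀`. -/
def F₁ : Fin 4 → Fin 4 → Fin 4 → ℂ :=
  (1 / 2 : ℂ) • ms 3 3 0 + (-1 : ℂ) • ms 3 1 1 + (-sA W) • ms 1 1 0 + (sA W ^ 2 / 6) • ms 0 0 0 +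
    (-2 * sB W) • ms 1 0 0

-- Let eᵢ be the elementary symmetric functions of the abscissae. On affine triples `F₁` is (e₂ −
-- A)² − 4e₁(e₃ + B), obtained by eliminating a, b from e₁ = a², e₂ = A − 2ab, e₃ = b² − B. The
-- tensor below is Σ YᵢYⱼ minus the value of this sum on a line, namely Ae₁ + 3e₃ + 3B.
variable (W) in
def F₂ : Fin 4 → Fin 4 → Fin 4 → ℂ :=
  (1 / 2 : ℂ) • ms 2 2 0 + (-sA W / 2) • ms 1 0 0 + (-1 / 2 : ℂ) • ms 1 1 1 +
    (-sB W / 2) • ms 0 0 0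

variable (W) in
def F₃ : Fin 4 → Fin 4 → Fin 4 → ℂ :=
  (1 / 2 : ℂ) • ms 2 2 1 + (3 * sB W / 2) • ms 1 0 0 + (-sA W ^ 2 / 6) • ms 0 0 0 +
    (sA W / 2) • ms 1 1 0

-- `F₂` and `F₃` have no X² component and hence vanish identically on D₀. The tensor below separates
-- triples {0, Q, R} there, where it equals YY' + B + A(X + X')/2 + XX'(X + X')/2.
variable (W) in
def F₄ : Fin 4 → Fin 4 → Fin 4 → ℂ :=
  (1 / 2 : ℂ) • ms 3 2 2 + (sB W / 2) • ms 3 0 0 + (sA W / 2) • ms 3 1 0 + (1 / 4 : ℂ) • ms 3 3 1 +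
    (2 * sB W) • ms 1 1 0 + (sA W / 2) • ms 1 1 1 + (-sA W ^ 2 / 4) • ms 1 0 0

-- Odd in Y, unlike the four tensors above; on {0, Q, R} it equals A(Y + Y') + 3(YX'² + X²Y'). It is
-- needed for first-order information on G₀, at triples containing 0 and at the triple of points of
-- order two.
variable (W) in
def F₅ : Fin 4 → Fin 4 → Fin 4 → ℂ :=
  (-sA W ^ 2 / 2) • ms 2 0 0 + (6 * sB W) • ms 2 1 0 + (2 * sA W) • ms 2 1 1 + sA W • ms 2 3 0 +
    (3 / 2 : ℂ) • ms 2 3 3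

theorem isSymm_F₁ : IsSymm (F₁ W) :=
  (((((isSymm_ms _ _ _).smul _).add ((isSymm_ms _ _ _).smul _)).add ((isSymm_ms _ _ _).smul _)).add
    ((isSymm_ms _ _ _).smul _)).add ((isSymm_ms _ _ _).smul _)

theorem isSymm_F₂ : IsSymm (F₂ W) :=
  ((((isSymm_ms _ _ _).smul _).add ((isSymm_ms _ _ _).smul _)).add ((isSymm_ms _ _ _).smul _)).add
    ((isSymm_ms _ _ _).smul _)

theorem isSymm_F₃ : IsSymm (F₃ W) :=
  ((((isSymm_ms _ _ _).smul _).add ((isSymm_ms _ _ _).smul _)).add ((isSymm_ms _ _ _).smul _)).add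
    ((isSymm_ms _ _ _).smul _)

theorem isSymm_F₄ : IsSymm (F₄ W) :=
  (((((((isSymm_ms _ _ _).smul _).add ((isSymm_ms _ _ _).smul _)).add
    ((isSymm_ms _ _ _).smul _)).add ((isSymm_ms _ _ _).smul _)).add ((isSymm_ms _ _ _).smul _)).add
    ((isSymm_ms _ _ _).smul _)).add ((isSymm_ms _ _ _).smul _)

theorem isSymm_F₅ : IsSymm (F₅ W) :=
  (((((isSymm_ms _ _ _).smul _).add ((isSymm_ms _ _ _).smul _)).add ((isSymm_ms _ _ _).smul _)).add
    ((isSymm_ms _ _ _).smul _)).add ((isSymm_ms _ _ _).smul _)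

/-- A permutation moving a coordinate with a given property to the front. -/
theorem exists_perm_front {p : Pt W → Prop} {P : Fin 3 → Pt W} (h : ∃ i, p (P i)) :
    ∃ σ : Equiv.Perm (Fin 3), p ((P ∘ σ) 0) := by
  obtain ⟨i, hi⟩ := h
  exact ⟨Equiv.swap 0 i, by simpa using hi⟩

theorem sum_comp (P : Fin 3 → Pt W) (σ : Equiv.Perm (Fin 3)) :
    (P ∘ σ) 0 + (P ∘ σ) 1 + (P ∘ σ) 2 = P 0 + P 1 + P 2 := by
  have := Equiv.sum_comp σ P
  rwa [Fin.sum_univ_three, Fin.sum_univ_three] at this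

/-- A criterion for the section given by a tensor to vanish on `G₀`. -/
theorem IsSymm.T_eq_zero {C : Fin 4 → Fin 4 → Fin 4 → ℂ} (hC : IsSymm C)
    (h₁ : ∀ (P Q R : Pt W) (a b : ℂ), OnLine a b P Q R →
      tri C ![1, pX P, pY P, pX P ^ 2] ![1, pX Q, pY Q, pX Q ^ 2] ![1, pX R, pY R, pX R ^ 2] = 0)
    (h₂ : ∀ x y, y ^ 2 = x ^ 3 + sA W * x + sB W →
      tri C ![0, 0, 0, 1] ![1, x, y, x ^ 2] ![1, x, -y, x ^ 2] = 0)
    (h₃ : tri C ![0, 0, 0, 1] ![0, 0, 0, 1] ![0, 0, 0, 1] = 0) (P : Fin 3 → Pt W)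
    (h : P 0 + P 1 + P 2 = 0) : T C P = 0 := by
  by_cases h0 : ∃ i, P i = 0
  · obtain ⟨σ, hσ⟩ := exists_perm_front (p := fun Q => Q = 0) h0
    rw [← hC.T_comp P σ]
    rw [← sum_comp P σ] at h
    generalize P ∘ σ = R at *
    rw [hσ, zero_add] at h
    have h2 : R 2 = -R 1 := (neg_eq_of_add_eq_zero_right h).symm
    rw [T, hσ, h2, e4_zero]
    by_cases hR : R 1 = 0
    · rw [hR, neg_zero, e4_zero, h₃]
    · rw [e4_of_ne hR, e4_of_ne (neg_ne_zero.2 hR), pX_neg, pY_neg, h₂ _ _ (curve_eq hR)]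
  · push Not at h0
    obtain ⟨a, b, hl⟩ := onLine_of_sum_eq_zero (h0 0) (h0 1) (h0 2) h
    rw [T, e4_of_ne (h0 0), e4_of_ne (h0 1), e4_of_ne (h0 2), h₁ _ _ _ _ _ hl]

/-- On a line A, B and the third abscissa are polynomials in a, b and the other two abscissae, so
vanishing of each of the five tensors on affine collinear triples becomes a polynomial identity. -/
theorem T_F₁ (P : Fin 3 → Pt W) (h : P 0 + P 1 + P 2 = 0) : T (F₁ W) P = 0 := by
  refine isSymm_F₁.T_eq_zero (fun P Q R a b hl => ?_) (fun x y hc => ?_) ?_ P h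
  · have hA : sA W = pX P * pX Q + pX P * pX R + pX Q * pX R + 2 * a * b := by
      linear_combination -hl.e₂
    have hB : sB W = b ^ 2 - pX P * pX Q * pX R := by linear_combination hl.e₃
    have hR : pX R = a ^ 2 - pX P - pX Q := by linear_combination hl.e₁
    simp only [F₁, tri_add, tri_smul, tri_ms]
    simp [hA, hB, hR, -one_div]; ring
  · simp only [F₁, tri_add, tri_smul, tri_ms]
    simp; ring
  · simp only [F₁, tri_add, tri_smul, tri_ms]
    simp

theorem T_F₂ (P : Fin 3 → Pt W) (h : P 0 + P 1 + P 2 = 0) : T (F₂ W) P = 0 := by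
  refine isSymm_F₂.T_eq_zero (fun P Q R a b hl => ?_) (fun x y hc => ?_) ?_ P h
  · have hA : sA W = pX P * pX Q + pX P * pX R + pX Q * pX R + 2 * a * b := by
      linear_combination -hl.e₂
    have hB : sB W = b ^ 2 - pX P * pX Q * pX R := by linear_combination hl.e₃
    have hR : pX R = a ^ 2 - pX P - pX Q := by linear_combination hl.e₁
    simp only [F₂, tri_add, tri_smul, tri_ms]
    simp [hA, hB, hl.y₁, hl.y₂, hl.y₃, hR, -one_div]; ring
  · simp only [F₂, tri_add, tri_smul, tri_ms]
    simp
  · simp only [F₂, tri_add, tri_smul, tri_ms]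
    simp

theorem T_F₃ (P : Fin 3 → Pt W) (h : P 0 + P 1 + P 2 = 0) : T (F₃ W) P = 0 := by
  refine isSymm_F₃.T_eq_zero (fun P Q R a b hl => ?_) (fun x y hc => ?_) ?_ P h
  · have hA : sA W = pX P * pX Q + pX P * pX R + pX Q * pX R + 2 * a * b := by
      linear_combination -hl.e₂
    have hB : sB W = b ^ 2 - pX P * pX Q * pX R := by linear_combination hl.e₃
    have hR : pX R = a ^ 2 - pX P - pX Q := by linear_combination hl.e₁
    simp only [F₃, tri_add, tri_smul, tri_ms]
    simp [hA, hB, hl.y₁, hl.y₂, hl.y₃, hR, -one_div]; ring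
  · simp only [F₃, tri_add, tri_smul, tri_ms]
    simp
  · simp only [F₃, tri_add, tri_smul, tri_ms]
    simp

theorem T_F₄ (P : Fin 3 → Pt W) (h : P 0 + P 1 + P 2 = 0) : T (F₄ W) P = 0 := by
  refine isSymm_F₄.T_eq_zero (fun P Q R a b hl => ?_) (fun x y hc => ?_) ?_ P h
  · have hA : sA W = pX P * pX Q + pX P * pX R + pX Q * pX R + 2 * a * b := by
      linear_combination -hl.e₂
    have hB : sB W = b ^ 2 - pX P * pX Q * pX R := by linear_combination hl.e₃
    have hR : pX R = a ^ 2 - pX P - pX Q := by linear_combination hl.e₁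
    simp only [F₄, tri_add, tri_smul, tri_ms]
    simp [hA, hB, hl.y₁, hl.y₂, hl.y₃, hR, -one_div]; ring
  · simp only [F₄, tri_add, tri_smul, tri_ms]
    simp
    linear_combination -hc
  · simp only [F₄, tri_add, tri_smul, tri_ms]
    simp

theorem T_F₅ (P : Fin 3 → Pt W) (h : P 0 + P 1 + P 2 = 0) : T (F₅ W) P = 0 := by
  refine isSymm_F₅.T_eq_zero (fun P Q R a b hl => ?_) (fun x y hc => ?_) ?_ P h
  · have hA : sA W = pX P * pX Q + pX P * pX R + pX Q * pX R + 2 * a * b := by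
      linear_combination -hl.e₂
    have hB : sB W = b ^ 2 - pX P * pX Q * pX R := by linear_combination hl.e₃
    have hR : pX R = a ^ 2 - pX P - pX Q := by linear_combination hl.e₁
    simp only [F₅, tri_add, tri_smul, tri_ms]
    simp [hA, hB, hl.y₁, hl.y₂, hl.y₃, hR, -one_div]; ring
  · simp only [F₅, tri_add, tri_smul, tri_ms]
    simp; ring
  · simp only [F₅, tri_add, tri_smul, tri_ms]
    simp

/-! ### Derivatives of tensor sections when one point moves -/

theorem hasDerivAt_tri (C : Fin 4 → Fin 4 → Fin 4 → ℂ) {u : ℂ → Fin 4 → ℂ} {u' : Fin 4 → ℂ}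
    {t : ℂ} (hu : ∀ k, HasDerivAt (fun t => u t k) (u' k) t) (y z : Fin 4 → ℂ) :
    HasDerivAt (fun t => tri C (u t) y z) (tri C u' y z) t :=
  HasDerivAt.fun_sum fun i _ => HasDerivAt.fun_sum fun j _ => HasDerivAt.fun_sum fun k _ =>
    (((hu i).const_mul (C i j k)).mul_const (y j)).mul_const (z k)

theorem IsAffParam.hasDerivAt_e4 {γ : ℂ → Pt W} {x' y' : ℂ} (h : IsAffParam γ x' y') (k : Fin 4) :
    HasDerivAt (fun t => e4 (γ t) k) (![0, x', y', 2 * pX (γ 0) * x'] k) 0 := by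
  have he : ∀ᶠ t in 𝓝 0, e4 (γ t) k = ![1, pX (γ t), pY (γ t), pX (γ t) ^ 2] k := by
    filter_upwards [h.ne_zero] with t ht using by rw [e4_of_ne ht]
  refine HasDerivAt.congr_of_eventuallyEq ?_ he
  fin_cases k
  · exact hasDerivAt_const _ _
  · exact h.derivX
  · exact h.derivY
  · simpa using h.derivX.fun_pow 2

theorem T_eq_zero_of_isBasePoint [W.IsElliptic] {C : Fin 4 → Fin 4 → Fin 4 → ℂ} (hC : IsSymm C)
    (hG : ∀ P : Fin 3 → Pt W, P 0 + P 1 + P 2 = 0 → T C P = 0) {P : Fin 3 → Pt W}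
    (hb : IsBasePoint (quot W P)) : T C P = 0 := by
  by_contra h
  exact not_vanishesAt_of_T_ne_zero hC (s := ⟨sec W C, sec_mem hC hG⟩) rfl h (hb _)

/-- With the first point affine, H is a nonvanishing differentiable factor times T along the curve.
Since T vanishes at the start, the vanishing derivative of H becomes one of T. -/
theorem tri_deriv_eq_zero [W.IsElliptic] {C : Fin 4 → Fin 4 → Fin 4 → ℂ} (hC : IsSymm C)
    (hG : ∀ P : Fin 3 → Pt W, P 0 + P 1 + P 2 = 0 → T C P = 0) {γ : ℂ → Pt W} {x' y' : ℂ}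
    (hγ : IsAffParam γ x' y') {Q R : Pt W} (hs : γ 0 + Q + R = 0)
    (hb : IsBasePoint (quot W ![γ 0, Q, R])) :
    tri C ![0, x', y', 2 * pX (γ 0) * x'] (e4 Q) (e4 R) = 0 := by
  have hp : ∀ i, IsParam ((![γ, fun _ => Q, fun _ => R] : Fin 3 → ℂ → Pt W) i)
      ((![fun t => ![pX (γ t), pY (γ t), 1], fun _ => sc Q, fun _ => sc R] :
        Fin 3 → ℂ → Fin 3 → ℂ) i) ((![![x', y', 0], 0, 0] : Fin 3 → Fin 3 → ℂ) i) := by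
    intro i; fin_cases i
    · exact hγ.isParam
    · exact isParam_const Q
    · exact isParam_const R
  have hv : ∀ t, (fun i => (![γ, fun _ => Q, fun _ => R] : Fin 3 → ℂ → Pt W) i t) =
      ![γ t, Q, R] := by intro t; funext i; fin_cases i <;> rfl
  obtain ⟨c, L, hP⟩ := exists_mem_dom ![γ 0, Q, R]
  have hd := deriv_H_eq_zero_of_vanishesAt hC (s := ⟨sec W C, sec_mem hC hG⟩) rfl hp hs
    (by rw [hv]; exact hb _) (by rw [hv]; exact hP)
  have hdom := IsParam.eventually_mem hp (opn_dom c L) (by rw [hv]; exact hP)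
  have hz := (IsParam.differentiableAt hp (reg_zf (opn_dom c L) c (fun P hP i => (hP i).1) 0)
    (by rw [hv]; exact hP)).hasDerivAt
  simp only [hv] at hd hdom hz
  have hT := hasDerivAt_tri C hγ.hasDerivAt_e4 (e4 Q) (e4 R)
  have h0 : tri C (e4 (γ 0)) (e4 Q) (e4 R) = 0 := hG ![γ 0, Q, R] hs
  have hγ0 : γ 0 ≠ 0 := hγ.ne_zero.self_of_nhds
  have h1 := ((hz.fun_pow 4).mul_const (sfac c L Q * sfac c L R)).fun_mul hT
  have h2 := hd.unique (h1.congr_of_eventuallyEq ?_)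
  · rw [h0, mul_zero, zero_add] at h2
    refine (mul_eq_zero.1 h2.symm).resolve_left (mul_ne_zero (pow_ne_zero _ ?_)
      (mul_ne_zero (sfac_ne_zero (hP 1)) (sfac_ne_zero (hP 2))))
    exact fun h => hγ0 ((zf_eq_zero_iff (hP 0)).1 h)
  · filter_upwards [hdom, hγ.ne_zero] with t ht ht0
    rw [H_eq fun i => (ht i).1]
    have e0 : sfac c L (γ t) = zf c L (γ t) ^ 4 := by simp [sfac, ht0]
    change sfac c L (γ t) * sfac c L Q * sfac c L R * tri C (e4 (γ t)) (e4 Q) (e4 R) =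
      zf c L (γ t) ^ 4 * (sfac c L Q * sfac c L R) * tri C (e4 (γ t)) (e4 Q) (e4 R)
    rw [e0]; ring

/-! ### Common zeros of the explicit tensors -/

/-- The hypotheses arise when the ordinate over x₃ has the opposite sign to the other two relative
to the line. Either alternative consists of vanishing values, whose signs may then be changed to
make all three agree. -/
theorem mixed_signs {a b x₁ x₂ x₃ : ℂ}
    (h : (a * x₃ + b) * ((a * x₁ + b) + (a * x₂ + b)) = 0)
    (h' : (a * x₃ + b) * ((a * x₁ + b) * x₂ + (a * x₂ + b) * x₁) = 0) :
    a * x₃ + b = 0 ∨ (a * x₁ + b = 0 ∧ a * x₂ + b = 0) := by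
  by_cases h3 : a * x₃ + b = 0
  · exact Or.inl h3
  have h1 := (mul_eq_zero.1 h).resolve_left h3
  have h2 := (mul_eq_zero.1 h').resolve_left h3
  have h4 : (a * x₁ + b) * (x₂ - x₁) = 0 := by linear_combination h2 - x₁ * h1
  have h5 : a * x₁ + b = 0 := by
    rcases mul_eq_zero.1 h4 with h5 | h5
    · exact h5
    · rw [sub_eq_zero.1 h5] at h1; linear_combination h1 / 2
  exact Or.inr ⟨h5, by linear_combination h1 - h5⟩

/-- Inverts the elimination behind `F₁`: take a² = e₁ and solve for b. When a = 0 the hypothesis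
gives e₂ = A, and b is a square root of e₃ + B. -/
theorem exists_line_coeffs {A B e₁ e₂ e₃ : ℂ} (h : (e₂ - A) ^ 2 = 4 * e₁ * (e₃ + B)) :
    ∃ a b, e₁ = a ^ 2 ∧ e₂ = A - 2 * a * b ∧ e₃ = b ^ 2 - B := by
  obtain ⟨a, ha⟩ := IsAlgClosed.exists_pow_nat_eq e₁ two_pos
  by_cases h0 : a = 0
  · obtain ⟨b, hb⟩ := IsAlgClosed.exists_pow_nat_eq (e₃ + B) two_pos
    have h1 : e₁ = 0 := by rw [← ha, h0]; ring
    rw [h1] at h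
    have h2 : e₂ - A = 0 := by
      rw [← sq_eq_zero_iff, h]; ring
    exact ⟨a, b, ha.symm, by rw [h0]; linear_combination h2, by linear_combination -hb⟩
  · refine ⟨a, (A - e₂) / (2 * a), ha.symm, by field_simp; ring, ?_⟩
    field_simp
    rw [← ha] at h
    linear_combination -h

/-- `F₁` provides a line whose squared values at the three abscissae are those of the curve, so each
ordinate is ±(aX + b). `F₂` and `F₃` fix Σ YᵢYⱼ and Σ YᵢYⱼXₖ at their values on the line, and by
`mixed_signs` the signs can be taken equal. -/
theorem sum_eq_zero_of_T_affine [W.IsElliptic] {P Q R : Pt W} (hP : P ≠ 0) (hQ : Q ≠ 0)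
    (hR : R ≠ 0) (h1 : T (F₁ W) ![P, Q, R] = 0) (h2 : T (F₂ W) ![P, Q, R] = 0)
    (h3 : T (F₃ W) ![P, Q, R] = 0) : P + Q + R = 0 := by
  simp only [T, F₁, F₂, F₃, tri_add, tri_smul, tri_ms, Matrix.cons_val_zero, Matrix.cons_val_one,
    Matrix.cons_val, e4_of_ne hP, e4_of_ne hQ, e4_of_ne hR] at h1 h2 h3
  have cP := curve_eq hP
  have cQ := curve_eq hQ
  have cR := curve_eq hR
  obtain ⟨a, b, ha, hb, hc⟩ := exists_line_coeffs (A := sA W) (B := sB W)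
    (e₁ := pX P + pX Q + pX R) (e₂ := pX P * pX Q + pX P * pX R + pX Q * pX R)
    (e₃ := pX P * pX Q * pX R) (by linear_combination h1)
  -- A common sign s is absorbed by replacing (a, b) with (sa, sb), which preserves a², ab and b².
  have key : ∀ s : ℂ, s ^ 2 = 1 → pY P = s * (a * pX P + b) → pY Q = s * (a * pX Q + b) →
      pY R = s * (a * pX R + b) → P + Q + R = 0 := fun s hs k1 k2 k3 =>
    sum_eq_zero_of_onLine hP hQ hR (a := s * a) (b := s * b) ⟨by rw [k1]; ring, by rw [k2]; ring,
      by rw [k3]; ring, by linear_combination ha - a ^ 2 * hs,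
      by linear_combination hb + 2 * a * b * hs, by linear_combination hc - b ^ 2 * hs⟩
  have g2 : pY P * pY Q + pY P * pY R + pY Q * pY R =
      (a * pX P + b) * (a * pX Q + b) + (a * pX P + b) * (a * pX R + b) +
        (a * pX Q + b) * (a * pX R + b) := by
    linear_combination h2 + (pX P * pX Q + pX P * pX R + pX Q * pX R) * ha - (pX P + pX Q + pX R) * hb + 3 * hc
  have g3 : pY P * pY Q * pX R + pY P * pY R * pX Q + pY Q * pY R * pX P =
      (a * pX P + b) * (a * pX Q + b) * pX R + (a * pX P + b) * (a * pX R + b) * pX Q +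
        (a * pX Q + b) * (a * pX R + b) * pX P := by
    linear_combination h3 + h1 + 3 * (pX P * pX Q * pX R) * ha -
      (pX P * pX Q + pX P * pX R + pX Q * pX R) * hb + (pX P + pX Q + pX R) * hc
  clear h1 h2 h3
  have sP : pY P = a * pX P + b ∨ pY P = -(a * pX P + b) := sq_eq_sq_iff_eq_or_eq_neg.1
    (by linear_combination cP + pX P ^ 2 * ha - pX P * hb + hc)
  have sQ : pY Q = a * pX Q + b ∨ pY Q = -(a * pX Q + b) := sq_eq_sq_iff_eq_or_eq_neg.1
    (by linear_combination cQ + pX Q ^ 2 * ha - pX Q * hb + hc)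
  have sR : pY R = a * pX R + b ∨ pY R = -(a * pX R + b) := sq_eq_sq_iff_eq_or_eq_neg.1
    (by linear_combination cR + pX R ^ 2 * ha - pX R * hb + hc)
  have mR := mixed_signs (a := a) (b := b) (x₁ := pX P) (x₂ := pX Q) (x₃ := pX R)
  have mQ := mixed_signs (a := a) (b := b) (x₁ := pX P) (x₂ := pX R) (x₃ := pX Q)
  have mP := mixed_signs (a := a) (b := b) (x₁ := pX Q) (x₂ := pX R) (x₃ := pX P)
  have kp := key 1 (by ring)
  have km := key (-1) (by ring)
  generalize a * pX P + b = l₁ at *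
  generalize a * pX Q + b = l₂ at *
  generalize a * pX R + b = l₃ at *
  rcases sP with k1 | k1 <;> rcases sQ with k2 | k2 <;> rcases sR with k3 | k3 <;>
    rw [k1, k2, k3] at g2 g3
  · exact kp (by rw [k1]; ring) (by rw [k2]; ring) (by rw [k3]; ring)
  · rcases mR (by linear_combination -g2 / 2) (by linear_combination -g3 / 2) with h | ⟨h, h'⟩
    · exact kp (by rw [k1]; ring) (by rw [k2]; ring) (by rw [k3, h]; ring)
    · exact km (by rw [k1, h]; ring) (by rw [k2, h']; ring) (by rw [k3]; ring)
  · rcases mQ (by linear_combination -g2 / 2) (by linear_combination -g3 / 2) with h | ⟨h, h'⟩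
    · exact kp (by rw [k1]; ring) (by rw [k2, h]; ring) (by rw [k3]; ring)
    · exact km (by rw [k1, h]; ring) (by rw [k2]; ring) (by rw [k3, h']; ring)
  · rcases mP (by linear_combination -g2 / 2) (by linear_combination -g3 / 2) with h | ⟨h, h'⟩
    · exact km (by rw [k1, h]; ring) (by rw [k2]; ring) (by rw [k3]; ring)
    · exact kp (by rw [k1]; ring) (by rw [k2, h]; ring) (by rw [k3, h']; ring)
  · rcases mP (by linear_combination -g2 / 2) (by linear_combination -g3 / 2) with h | ⟨h, h'⟩
    · exact kp (by rw [k1, h]; ring) (by rw [k2]; ring) (by rw [k3]; ring)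
    · exact km (by rw [k1]; ring) (by rw [k2, h]; ring) (by rw [k3, h']; ring)
  · rcases mQ (by linear_combination -g2 / 2) (by linear_combination -g3 / 2) with h | ⟨h, h'⟩
    · exact km (by rw [k1]; ring) (by rw [k2, h]; ring) (by rw [k3]; ring)
    · exact kp (by rw [k1, h]; ring) (by rw [k2]; ring) (by rw [k3, h']; ring)
  · rcases mR (by linear_combination -g2 / 2) (by linear_combination -g3 / 2) with h | ⟨h, h'⟩
    · exact km (by rw [k1]; ring) (by rw [k2]; ring) (by rw [k3, h]; ring)
    · exact kp (by rw [k1, h]; ring) (by rw [k2, h']; ring) (by rw [k3]; ring)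
  · exact km (by rw [k1]; ring) (by rw [k2]; ring) (by rw [k3]; ring)

/-- For a triple {0, Q, R} with Q, R affine, `F₁` is (X(Q) − X(R))², so R = ±Q. If R = Q, then `F₄`
is 2Y(Q)², so Q has order two and again R = −Q. -/
theorem sum_eq_zero_of_T [W.IsElliptic] {P : Fin 3 → Pt W} (h1 : T (F₁ W) P = 0)
    (h2 : T (F₂ W) P = 0) (h3 : T (F₃ W) P = 0) (h4 : T (F₄ W) P = 0) : P 0 + P 1 + P 2 = 0 := by
  by_cases h0 : ∃ i, P i = 0
  · obtain ⟨σ, hσ⟩ := exists_perm_front (p := fun Q => Q = 0) h0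
    rw [← isSymm_F₁.T_comp P σ] at h1
    rw [← isSymm_F₄.T_comp P σ] at h4
    rw [← sum_comp P σ]
    clear h2 h3
    generalize P ∘ σ = R at *
    rw [hσ, zero_add]
    rw [T, hσ, e4_zero] at h1 h4
    simp only [F₁, F₄, tri_add, tri_smul, tri_ms] at h1 h4
    by_cases hQ : R 1 = 0 <;> by_cases hR : R 2 = 0
    · rw [hQ, hR, add_zero]
    -- `F₁` has value 1 on {0, 0, R} with R affine.
    · simp [hQ, e4_of_ne hR] at h1
    · simp [hR, e4_of_ne hQ] at h1
    · simp [e4_of_ne hQ, e4_of_ne hR] at h1 h4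
      have hX : pX (R 1) = pX (R 2) := by
        rw [← sub_eq_zero, ← sq_eq_zero_iff]
        linear_combination h1
      rcases eq_or_eq_neg_of_pX_eq hQ hR hX with h | h
      · have cR := curve_eq hR
        rw [h] at h4
        have hy : pY (R 2) = 0 := by
          rw [← sq_eq_zero_iff]; linear_combination (1 / 2 : ℂ) * h4 + (1 / 2 : ℂ) * cR
        have h5 : R 2 = -R 2 := pt_ext hR (neg_ne_zero.2 hR) (pX_neg _).symm
          (by rw [pY_neg, hy, neg_zero])
        rw [h]; nth_rw 1 [h5]; simp
      · rw [h]; simp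
  · push Not at h0
    have hv : P = ![P 0, P 1, P 2] := by funext i; fin_cases i <;> rfl
    rw [hv] at h1 h2 h3
    exact sum_eq_zero_of_T_affine (h0 0) (h0 1) (h0 2) h1 h2 h3

/-! ### First-order exclusion of base points on G₀ -/

/-- The third division polynomial. -/
def psi3 (W : WeierstrassCurve ℂ) (x : ℂ) : ℂ :=
  3 * x ^ 4 + 6 * sA W * x ^ 2 + 12 * sB W * x - sA W ^ 2

/-- Moving P with X′ = 1, the derivative of (e₂ − A)² − 4e₁(e₃ + B) on the line is −4(aX(Q) +
b)(aX(R) + b) = −4Y(Q)Y(R). -/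
theorem not_isBasePoint_affine [W.IsElliptic] {P Q R : Pt W} (hP : P ≠ 0) (hQ : Q ≠ 0)
    (hR : R ≠ 0) (hs : P + Q + R = 0) (hy : pY P ≠ 0)  (hb : IsBasePoint (quot W ![P, Q, R])) :
    pY Q * pY R = 0 := by
  obtain ⟨γ, x', y', rfl, hγ, h1, h2, -⟩ := exists_affParam hP
  have hx := h2 hy
  have hd := tri_deriv_eq_zero isSymm_F₁ T_F₁ hγ hs hb
  obtain ⟨a, b, hl⟩ := onLine_of_sum_eq_zero hP hQ hR hs
  simp only [F₁, tri_add, tri_smul, tri_ms, e4_of_ne hQ, e4_of_ne hR, hx] at hd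
  simp at hd
  rw [hl.y₂, hl.y₃]
  have hA : sA W = pX (γ 0) * pX Q + pX (γ 0) * pX R + pX Q * pX R + 2 * a * b := by
    linear_combination -hl.e₂
  have hB : sB W = b ^ 2 - pX (γ 0) * pX Q * pX R := by linear_combination hl.e₃
  have hX : pX (γ 0) = a ^ 2 - pX Q - pX R := by linear_combination hl.e₁
  rw [hA, hB, hX] at hd
  linear_combination (-1 / 4 : ℂ) * hd

theorem pY_eq_zero_of_eq_neg {Q : Pt W} (h : Q = -Q) : pY Q = 0 := by
  have := congrArg pY h
  rw [pY_neg] at this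
  linear_combination this / 2

/-- At a point of order two the velocity is purely in Y. The derivatives of `F₂` and `F₃` then give
Y(R) = −Y(Q) and Y(Q)(X(R) − X(Q)) = 0, so all three points have order two. The derivative of `F₅`
becomes Y′(3X² + A)(3X² + 4A), whose last factor is minus the square of the difference of the other
two abscissae. -/
theorem not_isBasePoint_torsion [W.IsElliptic] {P Q R : Pt W} (hP : P ≠ 0) (hQ : Q ≠ 0)
    (hR : R ≠ 0) (hs : P + Q + R = 0) (hy : pY P = 0) : ¬IsBasePoint (quot W ![P, Q, R]) := by
  intro hb
  have hQR : Q ≠ -R := by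
    intro h; rw [h, add_assoc, neg_add_cancel, add_zero] at hs; exact hP hs
  obtain ⟨γ, x', y', rfl, hγ, h1, -, h2⟩ := exists_affParam hP
  obtain ⟨hx, hy'⟩ := h2 hy
  have cP := curve_eq hP
  rw [hy] at cP
  have hρ := deriv_ne_zero_of_root (W := W) (r := pX (γ 0)) (by linear_combination -cP)
  have hy0 : y' ≠ 0 := by rintro rfl; apply hρ; rw [← hy']; ring
  have d2 := tri_deriv_eq_zero isSymm_F₂ T_F₂ hγ hs hb
  have d3 := tri_deriv_eq_zero isSymm_F₃ T_F₃ hγ hs hb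
  have d5 := tri_deriv_eq_zero isSymm_F₅ T_F₅ hγ hs hb
  simp only [F₂, F₃, F₅, tri_add, tri_smul, tri_ms, e4_of_ne hQ, e4_of_ne hR, hx] at d2 d3 d5
  simp at d2 d3 d5
  have k2 : pY R = -pY Q := by
    apply mul_left_cancel₀ hy0; linear_combination (1 / 2 : ℂ) * d2
  have k3 : pY Q * (pX R - pX Q) = 0 := by
    apply mul_left_cancel₀ hy0
    rw [k2] at d3; linear_combination (1 / 2 : ℂ) * d3
  have hyQ : pY Q = 0 := by
    rcases mul_eq_zero.1 k3 with h | h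
    · exact h
    · exact absurd (pt_ext hQ (neg_ne_zero.2 hR) (by rw [pX_neg]; exact (sub_eq_zero.1 h).symm)
        (by rw [pY_neg, k2, neg_neg])) hQR
  have hyR : pY R = 0 := by rw [k2, hyQ, neg_zero]
  have hXX : pX Q - pX R ≠ 0 := fun h => hQR (pt_ext hQ (neg_ne_zero.2 hR)
    (by rw [pX_neg]; exact sub_eq_zero.1 h) (by rw [pY_neg, hyR, hyQ, neg_zero]))
  obtain ⟨a, b, hl⟩ := onLine_of_sum_eq_zero hP hQ hR hs
  have l1 := hl.y₁
  have l2 := hl.y₂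
  have l3 := hl.y₃
  rw [hy] at l1; rw [hyQ] at l2; rw [hyR] at l3
  have ha : a = 0 := (mul_eq_zero.1 (show a * (pX Q - pX R) = 0 by
    linear_combination l3 - l2)).resolve_right hXX
  have hb0 : b = 0 := by rw [ha] at l1; linear_combination -l1
  have e1 := hl.e₁
  have e2 := hl.e₂
  rw [ha] at e1 e2
  have hR' : pX R = -pX (γ 0) - pX Q := by linear_combination e1
  rw [hR'] at d5 hXX e2
  have key : y' * ((3 * pX (γ 0) ^ 2 + sA W) * (3 * pX (γ 0) ^ 2 + 4 * sA W)) = 0 := by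
    have hB : sB W = -pX (γ 0) ^ 3 - sA W * pX (γ 0) := by linear_combination -cP
    have hA : sA W = - pX (γ 0) ^ 2 - pX (γ 0) * pX Q - pX Q ^ 2 := by linear_combination -e2
    rw [hB, hA] at d5
    rw [hA]
    linear_combination d5
  refine mul_ne_zero hy0 (mul_ne_zero hρ ?_) key
  have : 3 * pX (γ 0) ^ 2 + 4 * sA W = -(pX Q - (-pX (γ 0) - pX Q)) ^ 2 := by
    linear_combination -4 * e2
  rw [this]
  exact neg_ne_zero.2 (pow_ne_zero _ hXX)

/-- Moving Q, the derivative of `F₅` is (3X² + A)Y′ − 6XYX′. If Y ≠ 0, multiplying by 2Y and using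
2YY′ = 3X² + A gives −ψ₃(X). If Y = 0, then X′ = 0 and the derivative is nonzero. -/
theorem psi3_eq_zero_of_isBasePoint [W.IsElliptic] {Q : Pt W} (hQ : Q ≠ 0)
    (hb : IsBasePoint (quot W ![Q, 0, -Q])) : psi3 W (pX Q) = 0 := by
  obtain ⟨γ, x', y', rfl, hγ, h1, h2, h3⟩ := exists_affParam hQ
  have d5 := tri_deriv_eq_zero isSymm_F₅ T_F₅ hγ (by simp) hb
  simp only [F₅, tri_add, tri_smul, tri_ms, e4_of_ne (neg_ne_zero.2 hQ), e4_zero, pX_neg,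
    pY_neg] at d5
  simp at d5
  have cQ := curve_eq hQ
  by_cases hy : pY (γ 0) = 0
  · obtain ⟨hx, hy'⟩ := h3 hy
    rw [hy] at cQ
    have hρ := deriv_ne_zero_of_root (W := W) (r := pX (γ 0)) (by linear_combination -cQ)
    have hy0 : y' ≠ 0 := by rintro rfl; apply hρ; rw [← hy']; ring
    exfalso
    refine mul_ne_zero hy0 hρ ?_
    rw [hx, hy] at d5
    linear_combination d5
  · rw [h2 hy] at d5 h1
    rw [psi3]
    linear_combination -2 * pY (γ 0) * d5 + (3 * pX (γ 0) ^ 2 + sA W) * h1 - 12 * pX (γ 0) * cQ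

/-- Along [t : w : t³] the function is (t − ct³)/(L₀t + L₁w + L₂t³), so t and `zf` agree to first
order up to the unit L₁. -/
theorem hasDerivAt_zf_zeroParam {γ : ℂ → Pt W} {w : ℂ → ℂ}
    (hγ : IsParam γ (fun t => ![t, w t, t ^ 3]) ![1, 0, 0]) (hw : w 0 = 1) (c : ℂ) {L : Fin 3 → ℂ}
    (hL : L 1 ≠ 0) : HasDerivAt (fun t => zf c L (γ t)) (L 1)⁻¹ 0 := by
  have d0 : HasDerivAt (fun t : ℂ => t) 1 0 := hasDerivAt_id 0
  have d1 : HasDerivAt w 0 0 := hγ.deriv 1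
  have d2 : HasDerivAt (fun t : ℂ => t ^ 3) 0 0 := hγ.deriv 2
  have dl : HasDerivAt (fun t : ℂ => L 0 * t + L 1 * w t + L 2 * t ^ 3)
      (L 0 * 1 + L 1 * 0 + L 2 * 0) 0 :=
    ((d0.const_mul _).add (d1.const_mul _)).add (d2.const_mul _)
  have dz := (d0.sub (d2.const_mul c)).div dl (by simp [hw, hL])
  refine (dz.congr_of_eventuallyEq ?_).congr_deriv ?_
  · filter_upwards [hγ.prop] with t ht
    obtain ⟨l, hl, he⟩ := ht
    have : lin L (γ t) = l * (L 0 * t + L 1 * w t + L 2 * t ^ 3) := by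
      rw [lin, he, Fin.sum_univ_three]; simp; ring
    simp only [zf, xp, nc, this, he, Pi.smul_apply, smul_eq_mul, Pi.div_apply, Pi.sub_apply,
      mul_inv]
    simp
    field_simp
  · simp [hw]; field_simp

/-- As a section of 𝒪(4·0), Y has a simple zero at the origin, because its pole has order three. So
`F₅` vanishes only to first order when one point leaves {0, 0, 0}. -/
theorem not_isBasePoint_zero [W.IsElliptic] : ¬IsBasePoint (quot W ![0, 0, 0]) := by
  intro hb
  obtain ⟨γ, w, h0, hw, -, -, hγ, -⟩ := exists_zeroParam (W := W)
  have hp : ∀ i, IsParam ((![γ, fun _ => 0, fun _ => 0] : Fin 3 → ℂ → Pt W) i)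
      ((![fun t => ![t, w t, t ^ 3], fun _ => sc (0 : Pt W), fun _ => sc (0 : Pt W)] :
        Fin 3 → ℂ → Fin 3 → ℂ) i) ((![![1, 0, 0], 0, 0] : Fin 3 → Fin 3 → ℂ) i) := by
    intro i; fin_cases i
    · exact hγ
    · exact isParam_const 0
    · exact isParam_const 0
  have hv : ∀ t, (fun i => (![γ, fun _ => 0, fun _ => 0] : Fin 3 → ℂ → Pt W) i t) =
      ![γ t, 0, 0] := by intro t; funext i; fin_cases i <;> rfl
  obtain ⟨c, L, hP⟩ := exists_mem_dom (W := W) ![0, 0, 0]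
  have hP0 : ![γ 0, 0, 0] ∈ dom W c L := by rw [h0]; exact hP
  have hd := deriv_H_eq_zero_of_vanishesAt isSymm_F₅ (s := ⟨sec W _, sec_mem isSymm_F₅ T_F₅⟩) rfl
    hp (by simp [h0]) (by rw [hv, h0]; exact hb _) (by rw [hv]; exact hP0)
  have hL : L 1 ≠ 0 := by simpa [lin, Fin.sum_univ_three] using (hP 0).1
  have dz := hasDerivAt_zf_zeroParam hγ hw c hL
  have ho := opn_dom (W := W) c L
  have hl : ∀ P ∈ dom W c L, ∀ i, lin L (P i) ≠ 0 := fun P hP i => (hP i).1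
  have hm : Reg (dom W c L) fun P => nc L (P 0) 1 * mu W c (nc L (P 0)) :=
    (reg_nc ho hl 0 1).mul ((((reg_kap ho c hl 0).sub ho
      (((reg_zf ho c hl 0).pow ho 2).const_mul ho _)).sub ho
      (((reg_zf ho c hl 0).const_mul ho (3 * c ^ 2 + sA W)).mul (reg_nc ho hl 0 2))))
  have dm := (IsParam.differentiableAt hp hm (by rw [hv]; exact hP0)).hasDerivAt
  have hz0 : zf c L (γ 0) = 0 := by rw [h0]; exact (zf_eq_zero_iff (hP 0)).2 rfl
  have he := eps_eq (c := c) (hP 0).1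
  simp only [Matrix.cons_val_zero, e4_zero] at he
  have hs := sfac_ne_zero (hP 0)
  simp only [Matrix.cons_val_zero] at hs
  have hH : ∀ t, H (F₅ W) c L ![γ t, 0, 0] = 3 * sfac c L (0 : Pt W) ^ 2 * (zf c L (γ t) *
      (nc L (γ t) 1 * mu W c (nc L (γ t)))) := by
    intro t
    simp only [H, F₅, tri_add, tri_smul, tri_ms, Matrix.cons_val_zero, Matrix.cons_val_one,
      Matrix.cons_val, he, Pi.smul_apply, smul_eq_mul]
    simp [eps]
    ring
  simp only [hv, hH] at hd
  have h1 := hd.unique ((dz.fun_mul dm).const_mul _)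
  rw [hz0, zero_mul, add_zero] at h1
  refine mul_ne_zero (mul_ne_zero three_ne_zero (pow_ne_zero 2 hs))
    (mul_ne_zero (inv_ne_zero hL) ?_) h1.symm
  simp [h0, nc, mu, kap, xp, lin, Fin.sum_univ_three, hL]

/-- `F₁`–`F₄` put the point on G₀. If no point of the triple is 0, `not_isBasePoint_affine` forces
one of them to have order two, which `not_isBasePoint_torsion` excludes. Otherwise the triple is {0,
Q, −Q}, and `F₅` decides. -/
theorem exists_of_isBasePoint [W.IsElliptic] {p : SymPt W} (hb : IsBasePoint p) :
    ∃ Q : Pt W, Q ≠ 0 ∧ psi3 W (pX Q) = 0 ∧ p = quot W ![0, Q, -Q] := by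
  have hfront : ∀ (q : Pt W → Prop) (P : Fin 3 → Pt W), (∃ i, q (P i)) →
      ∃ P₀ P₁ P₂ : Pt W, q P₀ ∧ P₀ + P₁ + P₂ = P 0 + P 1 + P 2 ∧
        quot W P = quot W ![P₀, P₁, P₂] := by
    intro q P h
    obtain ⟨σ, hσ⟩ := exists_perm_front h
    refine ⟨_, _, _, hσ, sum_comp P σ, ?_⟩
    rw [← quot_comp P σ]
    congr 1; funext i; fin_cases i <;> rfl
  obtain ⟨P, rfl⟩ := quot_surjective p
  have hsum := sum_eq_zero_of_T (T_eq_zero_of_isBasePoint isSymm_F₁ T_F₁ hb)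
    (T_eq_zero_of_isBasePoint isSymm_F₂ T_F₂ hb) (T_eq_zero_of_isBasePoint isSymm_F₃ T_F₃ hb)
    (T_eq_zero_of_isBasePoint isSymm_F₄ T_F₄ hb)
  by_cases h0 : ∃ i, P i = 0
  · obtain ⟨P₀, P₁, P₂, rfl, hs, hq⟩ := hfront (fun Q => Q = 0) P h0
    rw [hsum, zero_add] at hs
    obtain rfl : P₂ = -P₁ := (neg_eq_of_add_eq_zero_right hs).symm
    rw [hq] at hb ⊢
    by_cases hQ : P₁ = 0
    · subst hQ
      rw [neg_zero] at hb
      exact absurd hb not_isBasePoint_zero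
    · refine ⟨P₁, hQ, psi3_eq_zero_of_isBasePoint hQ ?_, rfl⟩
      rw [← quot_comp _ (Equiv.swap 0 1)]
      convert hb using 2
      funext i; fin_cases i <;> rfl
  · exfalso
    push Not at h0
    obtain ⟨P₀, P₁, P₂, hy, hs, hq⟩ : ∃ P₀ P₁ P₂ : Pt W, pY P₀ = 0 ∧
        P₀ + P₁ + P₂ = P 0 + P 1 + P 2 ∧ quot W P = quot W ![P₀, P₁, P₂] := by
      refine hfront (fun Q => pY Q = 0) P ?_
      by_contra hc
      push Not at hc
      have hv : P = ![P 0, P 1, P 2] := by funext i; fin_cases i <;> rfl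
      rw [hv] at hb
      exact mul_ne_zero (hc 1) (hc 2) (not_isBasePoint_affine (h0 0) (h0 1) (h0 2) hsum (hc 0) hb)
    rw [hsum] at hs
    rw [hq] at hb
    have hn : ∀ R ∈ [P₀, P₁, P₂], R ≠ 0 := by
      obtain ⟨σ, hσ⟩ := quot_eq_iff.1 hq
      have hσ' : ∀ i, (![P₀, P₁, P₂] : Fin 3 → Pt W) i ≠ 0 := fun i => by
        have := congrFun hσ (σ.symm i)
        simp only [Function.comp, Equiv.apply_symm_apply] at this
        rw [← this]; exact h0 _
      intro R hR
      simp only [List.mem_cons, List.not_mem_nil, or_false] at hR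
      rcases hR with rfl | rfl | rfl
      · exact hσ' 0
      · exact hσ' 1
      · exact hσ' 2
    exact not_isBasePoint_torsion (hn _ (by simp)) (hn _ (by simp)) (hn _ (by simp)) hs hy hb

/-! ### Trivializations and the local shape of sections -/

theorem exists_tensor_ne_zero [W.IsElliptic] {P : Fin 3 → Pt W} (h : P 0 + P 1 + P 2 ≠ 0) :
    ∃ C, IsSymm C ∧ (∀ Q : Fin 3 → Pt W, Q 0 + Q 1 + Q 2 = 0 → T C Q = 0) ∧ T C P ≠ 0 := by
  by_contra hc
  push Not at hc
  exact h (sum_eq_zero_of_T (hc _ isSymm_F₁ T_F₁) (hc _ isSymm_F₂ T_F₂) (hc _ isSymm_F₃ T_F₃)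
    (hc _ isSymm_F₄ T_F₄))

theorem H_ne_zero_iff {C : Fin 4 → Fin 4 → Fin 4 → ℂ} {c : ℂ} {L : Fin 3 → ℂ} {P : Fin 3 → Pt W}
    (h : P ∈ dom W c L) : H C c L P ≠ 0 ↔ T C P ≠ 0 := by
  rw [H_eq fun i => (h i).1]
  simp [sfac_ne_zero (h 0), sfac_ne_zero (h 1), sfac_ne_zero (h 2)]

/-- The complement of G₀ is covered by the non-vanishing loci of tensors that vanish on G₀, so
openness needs no regularity of the group law. -/
theorem opn_sum_ne_zero [W.IsElliptic] : Opn {P : Fin 3 → Pt W | P 0 + P 1 + P 2 ≠ 0} := by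
  refine opn_of_local fun P hP => ?_
  obtain ⟨C, hC, hG, hT⟩ := exists_tensor_ne_zero hP
  obtain ⟨c, L, hd⟩ := exists_mem_dom P
  refine ⟨_, (reg_H (opn_dom c L) c (fun Q hQ i => (hQ i).1) C).opn_ne,
    ⟨hd, (H_ne_zero_iff hd).2 hT⟩, fun Q hQ hs => ?_⟩
  exact (H_ne_zero_iff hQ.1).1 hQ.2 (hG Q hs)

/-- Away from G₀ the ideal of G₀ is the unit ideal, generated by the constant 1. -/
theorem isTrivialization_one [W.IsElliptic] {c : ℂ} {L : Fin 3 → ℂ} {V : Set (SymPt W)}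
    (hV : (symCube W).IsOpn V) (hd : quot W ⁻¹' V ⊆ dom W c L) (hne : V.Nonempty)
    (hG : ∀ D ∈ V, D ∉ divG0 W) : IsTrivialization W V (descend (u0 c L)) fun _ => 1 := by
  refine ⟨hV, isLocalEquation_divD0 hV hd hne, isLocalEquation_of ?_ ?_ ?_ ?_⟩
  · exact reg_const (symOpn_iff.1 hV) 1
  · exact fun D hD hDG => absurd hDG (hG D hD)
  · obtain ⟨D, hD⟩ := hne
    obtain ⟨P, rfl⟩ := quot_surjective D
    exact ⟨P, hD, one_ne_zero⟩
  · exact fun O a hO _ ha _ P hP => ⟨O, subset_rfl, hO, hP, a, ha, fun Q _ => by simp⟩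

theorem isTrivialization_g0 [W.IsElliptic] {c : ℂ} {L l : Fin 3 → ℂ} {V : Set (SymPt W)}
    (hV : (symCube W).IsOpn V) (hd : quot W ⁻¹' V ⊆ dom W c L ∩ ddom W L l) (hne : V.Nonempty) :
    IsTrivialization W V (descend (u0 c L)) (descend (g0 L l)) :=
  ⟨hV, isLocalEquation_divD0 hV (fun _ h => (hd h).1) hne,
    isLocalEquation_divG0 hV (fun _ h => (hd h).2) hne⟩

theorem exists_mem_ddom {P : Fin 3 → Pt W} (hP : Function.Injective P) :
    ∃ c L l, P ∈ dom W c L ∩ ddom W L l := by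
  obtain ⟨c, L, hd⟩ := exists_mem_dom P
  obtain ⟨l, hl⟩ := exists_form
    (fun i : {x : Fin 3 × Fin 3 // x.1 ≠ x.2} => nc L (P i.1.1) - nc L (P i.1.2)) fun i h0 =>
      i.2 (hP (nc_smul_injective (l := 1) (hd _).1 (by rw [one_smul]; exact sub_eq_zero.1 h0)))
  have hr : ∀ i j, i ≠ j → ratio L l (P i) - ratio L l (P j) ≠ 0 := by
    intro i j hij
    have := hl ⟨(i, j), hij⟩
    simpa only [ratio, Pi.sub_apply, mul_sub, Finset.sum_sub_distrib] using this
  have h1 := hr 1 0 (by decide)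
  have h2 := hr 2 0 (by decide)
  have h3 := hr 2 1 (by decide)
  exact ⟨c, L, l, hd, fun i => (hd i).1, mul_ne_zero (mul_ne_zero h1 h2) h3⟩

open Classical in
/-- A section as a total function; the value on triples containing `0` is irrelevant. -/
def total (s : globalSections W) (D : SymPt W) : ℂ := if h : D ∉ divD0 W then s.1 ⟨D, h⟩ else 0

/-- The pullback of a section to the cube. -/
def pull (s : globalSections W) (P : Fin 3 → Pt W) : ℂ := total s (quot W P)

theorem pull_comp (s : globalSections W) (P : Fin 3 → Pt W) (σ : Equiv.Perm (Fin 3)) :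
    pull s (P ∘ σ) = pull s P := by rw [pull, quot_comp, pull]

theorem notMem_divD0 {P : Fin 3 → Pt W} (h : ∀ i, P i ≠ 0) : quot W P ∉ divD0 W := fun hc => by
  obtain ⟨i, hi⟩ := mem_divD0.1 hc; exact h i hi

theorem IsLocalExpr.pull_eq {s : globalSections W} {V : Set (SymPt W)} {u g h : SymPt W → ℂ}
    (he : IsLocalExpr s.1 V u g h) {P : Fin 3 → Pt W} (hP : ∀ i, P i ≠ 0) (hV : quot W P ∈ V) :
    pull s P * u (quot W P) ^ 4 = g (quot W P) * h (quot W P) := by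
  have h0 := notMem_divD0 hP
  rw [pull, total, dif_pos h0]
  exact he.2 _ h0 hV

theorem IsTrivialization.exists_local [W.IsElliptic] (s : globalSections W) {P : Fin 3 → Pt W}
    {c : ℂ} {L : Fin 3 → ℂ} {O : Set (Fin 3 → Pt W)} {g : SymPt W → ℂ} (hPO : P ∈ O)
    (hOs : ∀ Q ∈ O, ∀ σ : Equiv.Perm (Fin 3), Q ∘ σ ∈ O)
    (ht : IsTrivialization W (quot W '' O) (descend (u0 c L)) g) :
    ∃ (O' : Set (Fin 3 → Pt W)) (k : (Fin 3 → Pt W) → ℂ), Opn O' ∧ P ∈ O' ∧ O' ⊆ O ∧ Reg O' k ∧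
      (∀ Q ∈ O', (∀ i, Q i ≠ 0) → pull s Q * u0 c L Q ^ 4 = k Q) ∧
      ∀ Q ∈ O', Q 0 + Q 1 + Q 2 = 0 → k Q = 0 := by
  have huq : ∀ Q : Fin 3 → Pt W, descend (u0 c L) (quot W Q) = u0 c L Q :=
    fun Q => descend_quot (u0_comp c L Q)
  obtain ⟨V', ho, hPV, hs, h, hh, he⟩ := s.2 _ _ _ ht _ ⟨P, hPO, rfl⟩
  have ho' := symOpn_iff.1 ho
  have hs' : quot W ⁻¹' V' ⊆ O := by
    rw [← preimage_image_quot hOs]; exact Set.preimage_mono hs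
  refine ⟨quot W ⁻¹' V', fun Q => g (quot W Q) * h (quot W Q), ho', hPV, hs',
    (Reg.mono (symReg_iff.1 ht.eqG0.regular) ho' fun Q hQ => hs hQ).mul (symReg_iff.1 hh),
    fun Q hQ hQ0 => ?_, fun Q hQ hQs => ?_⟩
  · rw [← huq Q]
    exact IsLocalExpr.pull_eq ⟨hh, he⟩ hQ0 hQ
  · have : g (quot W Q) = 0 := ht.eqG0.vanish _ (hs hQ) (mem_divG0.2 hQs)
    simp [this]

/-- Trivializations are available off G₀ and at triples of distinct points. The triples on G₀ with a
repeated point are never needed to reconstruct a section. -/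
theorem exists_local [W.IsElliptic] (s : globalSections W) {P : Fin 3 → Pt W}
    (hP : P 0 + P 1 + P 2 ≠ 0 ∨ Function.Injective P) :
    ∃ (c : ℂ) (L : Fin 3 → ℂ) (O : Set (Fin 3 → Pt W)) (k : (Fin 3 → Pt W) → ℂ), Opn O ∧ P ∈ O ∧
      O ⊆ dom W c L ∧ Reg O k ∧ (∀ Q ∈ O, (∀ i, Q i ≠ 0) → pull s Q * u0 c L Q ^ 4 = k Q) ∧
      ∀ Q ∈ O, Q 0 + Q 1 + Q 2 = 0 → k Q = 0 := by
  rcases hP with hP | hP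
  · obtain ⟨c, L, hd⟩ := exists_mem_dom P
    have hsym : ∀ Q ∈ dom W c L ∩ {P : Fin 3 → Pt W | P 0 + P 1 + P 2 ≠ 0},
        ∀ σ : Equiv.Perm (Fin 3), Q ∘ σ ∈ dom W c L ∩ {P | P 0 + P 1 + P 2 ≠ 0} :=
      fun Q hQ σ => ⟨dom_comp Q hQ.1 σ, by
        simp only [Set.mem_ofPred_eq]; rw [sum_comp]; exact hQ.2⟩
    have hG : ∀ D ∈ quot W '' (dom W c L ∩ {P | P 0 + P 1 + P 2 ≠ 0}), D ∉ divG0 W := by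
      rintro _ ⟨Q, hQ, rfl⟩ hG
      exact hQ.2 (mem_divG0.1 hG)
    obtain ⟨O, k, h1, h2, h3, h4⟩ := IsTrivialization.exists_local s (P := P)
      (O := dom W c L ∩ {P | P 0 + P 1 + P 2 ≠ 0}) ⟨hd, hP⟩ hsym
      (isTrivialization_one (symOpn_image ((opn_dom c L).inter opn_sum_ne_zero) hsym)
        ((preimage_image_quot hsym).trans_subset Set.inter_subset_left) ⟨_, P, ⟨hd, hP⟩, rfl⟩ hG)
    exact ⟨c, L, O, k, h1, h2, h3.trans Set.inter_subset_left, h4⟩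
  · obtain ⟨c, L, l, hd⟩ := exists_mem_ddom hP
    have hsym : ∀ Q ∈ dom W c L ∩ ddom W L l,
        ∀ σ : Equiv.Perm (Fin 3), Q ∘ σ ∈ dom W c L ∩ ddom W L l :=
      fun Q hQ σ => ⟨dom_comp Q hQ.1 σ, ddom_comp Q hQ.2 σ⟩
    obtain ⟨O, k, h1, h2, h3, h4⟩ := IsTrivialization.exists_local s (P := P) hd hsym
      (isTrivialization_g0 (symOpn_image ((opn_dom c L).inter (opn_ddom L l)) hsym)
        (preimage_image_quot hsym).subset ⟨_, P, hd, rfl⟩)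
    exact ⟨c, L, O, k, h1, h2, h3.trans Set.inter_subset_left, h4⟩

/-! ### Restriction of a section to a slice -/

/-- The coordinate ring of the affine curve is the ring of its regular functions: a function
which is locally a quotient of polynomials is a polynomial. -/
theorem exists_polynomial_of_local [W.IsElliptic] {φ : Pt W → ℂ}
    (h : ∀ X : Pt W, X ≠ 0 → ∃ G D : MvPolynomial (Fin 2) ℂ, eval ![pX X, pY X] D ≠ 0 ∧
      ∀ Y : Pt W, Y ≠ 0 → eval ![pX Y, pY Y] D * φ Y = eval ![pX Y, pY Y] G) :
    ∃ p q : Polynomial ℂ, ∀ Y : Pt W, Y ≠ 0 → φ Y = p.eval (pX Y) + q.eval (pX Y) * pY Y := by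
  -- This is the ideal of denominators of φ. Locality says that it has no zero on the curve, and the
  -- Nullstellensatz then puts 1 in it.
  let I : Ideal (MvPolynomial (Fin 2) ℂ) :=
    { carrier := {D | ∃ G : MvPolynomial (Fin 2) ℂ, ∀ Y : Pt W, Y ≠ 0 →
        eval ![pX Y, pY Y] D * φ Y = eval ![pX Y, pY Y] G}
      zero_mem' := ⟨0, by simp⟩
      add_mem' := by
        rintro a b ⟨G, hG⟩ ⟨G', hG'⟩
        exact ⟨G + G', fun Y hY => by rw [map_add, map_add, add_mul, hG Y hY, hG' Y hY]⟩
      smul_mem' := by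
        rintro c a ⟨G, hG⟩
        exact ⟨c * G, fun Y hY => by rw [smul_eq_mul, map_mul, map_mul, mul_assoc, hG Y hY]⟩ }
  have hz : zeroLocus ℂ I = ∅ := by
    rw [Set.eq_empty_iff_forall_notMem]
    intro v hv
    -- The curve equation is itself a denominator, with numerator zero, so zeros of I in the plane
    -- lie on the curve.
    have hcurve : (X 1 ^ 2 - X 0 ^ 3 - C (sA W) * X 0 - C (sB W) : MvPolynomial (Fin 2) ℂ) ∈ I :=
      ⟨0, fun Y hY => by
        have := curve_eq hY
        have h0 : eval ![pX Y, pY Y]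
            (X 1 ^ 2 - X 0 ^ 3 - C (sA W) * X 0 - C (sB W) : MvPolynomial (Fin 2) ℂ) = 0 := by
          simp only [map_sub, map_mul, map_pow, eval_X, eval_C, Matrix.cons_val_zero,
            Matrix.cons_val_one]
          linear_combination this
        rw [h0, zero_mul, map_zero]⟩
    have h1 := hv _ hcurve
    simp at h1
    obtain ⟨Q, hQ, hX, hY⟩ := exists_pt (W := W) (x := v 0) (y := v 1) (by linear_combination h1)
    obtain ⟨G, D, hD, hG⟩ := h Q hQ
    apply hD
    have h2 := hv D ⟨G, hG⟩
    have : ![pX Q, pY Q] = v := by funext i; fin_cases i <;> simp [hX, hY]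
    rw [this]
    simpa [coe_aeval_eq_eval] using h2
  have htop : (1 : MvPolynomial (Fin 2) ℂ) ∈ I := by
    have h1 := vanishingIdeal_zeroLocus_eq_radical (k := ℂ) (K := ℂ) I
    rw [hz, vanishingIdeal_empty] at h1
    have h2 : I.radical = ⊤ := h1.symm
    rw [Ideal.radical_eq_top.1 h2]
    trivial
  obtain ⟨G, hG⟩ := htop
  obtain ⟨p, q, hpq⟩ := poly_form W G
  exact ⟨p, q, fun Y hY => by rw [← hpq Y hY, ← hG Y hY, map_one, one_mul]⟩

/-- Pairs for which a triple containing them with sum zero has distinct members. -/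
structure Good (Q R : Pt W) : Prop where
  ne₁ : Q ≠ 0
  ne₂ : R ≠ 0
  ne : Q ≠ R
  sum : Q + R ≠ 0
  sum₁ : Q + R + Q ≠ 0
  sum₂ : Q + R + R ≠ 0

theorem Good.symm {Q R : Pt W} (h : Good Q R) : Good R Q :=
  ⟨h.ne₂, h.ne₁, h.ne.symm, by rw [add_comm]; exact h.sum, by rw [add_comm R Q]; exact h.sum₂,
    by rw [add_comm R Q]; exact h.sum₁⟩

theorem Good.injective {X Q R : Pt W} (h : Good Q R) (hs : X + Q + R = 0) :
    Function.Injective ![X, Q, R] := by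
  have h1 : X ≠ Q := fun h1 => h.sum₁ (by rw [← hs, h1]; abel)
  have h2 : X ≠ R := fun h1 => h.sum₂ (by rw [← hs, h1]; abel)
  have h3 := h.ne
  intro i j hij
  fin_cases i <;> fin_cases j <;> first | rfl | (exfalso; simp at hij; tauto)

/-- If Q + 2R = 0, the tangent at R passes through Q, so (Y(R) − Y(Q))² = (X(Q) + 2X(R))(X(R) −
X(Q))². Reduced by the curve equation this is p(X) + q(X)Y = 0 with p of leading term −X³. -/
theorem finite_halves [W.IsElliptic] {Q : Pt W} (hQ : Q ≠ 0) : {R : Pt W | Q + R + R = 0}.Finite := by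
  let q : Polynomial ℂ := Polynomial.C (-2 * pY Q)
  let p : Polynomial ℂ := Polynomial.C (-1) * Polynomial.X ^ 3 + Polynomial.C (3 * pX Q) * Polynomial.X ^ 2 +
    Polynomial.C (sA W) * Polynomial.X + Polynomial.C (sB W + pY Q ^ 2 - pX Q ^ 3)
  have hp : p ≠ 0 := by
    intro h0
    have h1 := congrArg (fun p => Polynomial.coeff p 3) h0
    simp only [p, Polynomial.coeff_add, Polynomial.coeff_C_mul, Polynomial.coeff_X_pow,
      Polynomial.coeff_X, Polynomial.coeff_C, Polynomial.coeff_zero] at h1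
    norm_num at h1
  refine ((finite_zeros (W := W) (p := p) (q := q) fun h => hp h.1).union
    (Set.finite_singleton (0 : Pt W))).subset fun R hR => ?_
  by_cases h0 : R = 0
  · exact Or.inr h0
  refine Or.inl ⟨h0, ?_⟩
  obtain ⟨a, b, hl⟩ := onLine_of_sum_eq_zero hQ h0 h0 hR
  have hc := curve_eq h0
  have e : (pY R - pY Q) ^ 2 = (pX Q + pX R + pX R) * (pX R - pX Q) ^ 2 := by
    rw [hl.y₁, hl.y₂, hl.e₁]; ring
  simp [p, q]
  linear_combination e - hc

theorem finite_not_good [W.IsElliptic] {Q : Pt W} (hQ : Q ≠ 0) : {R : Pt W | ¬Good Q R}.Finite := by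
  refine ((finite_halves hQ).union (Set.toFinite {0, Q, -Q, -(Q + Q)})).subset fun R hR => ?_
  by_contra hc
  simp only [Set.mem_union, Set.mem_insert_iff, Set.mem_singleton_iff, not_or,
    Set.mem_ofPred_eq] at hc
  exact hR ⟨hQ, hc.2.1, Ne.symm hc.2.2.1, fun h => hc.2.2.2.1 (neg_eq_of_add_eq_zero_right h).symm,
    fun h => hc.2.2.2.2 (neg_eq_of_add_eq_zero_right (by rw [← h]; abel)).symm, hc.1⟩

theorem update_zero (X Y Q R : Pt W) : Function.update ![X, Q, R] 0 Y = ![Y, Q, R] := by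
  funext i; fin_cases i <;> rfl

/-- The slices of a section are regular on the affine curve. -/
theorem pull_slice_local [W.IsElliptic] (s : globalSections W) {Q R X : Pt W} (h : Good Q R) (hX : X ≠ 0) :
    ∃ G D : MvPolynomial (Fin 2) ℂ, eval ![pX X, pY X] D ≠ 0 ∧ ∀ Y : Pt W, Y ≠ 0 →
      eval ![pX Y, pY Y] D * pull s ![Y, Q, R] = eval ![pX Y, pY Y] G := by
  have hP : X + Q + R ≠ 0 ∨ Function.Injective ![X, Q, R] :=
    (em (X + Q + R = 0)).symm.imp_right h.injective
  obtain ⟨c, L, O, k, hO, hPO, hOd, hk, he, -⟩ := exists_local s (P := ![X, Q, R]) hP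
  have hO' := hO.inter (opn_ne_zero (W := W))
  have hne : ∀ i, (![X, Q, R] : Fin 3 → Pt W) i ≠ 0 := by
    intro i; fin_cases i
    exacts [hX, h.ne₁, h.ne₂]
  have hu : ∀ P ∈ O ∩ {P | ∀ i, P i ≠ 0}, u0 c L P ^ 4 ≠ 0 := fun P hP => pow_ne_zero _ fun h0 => by
    obtain ⟨i, hi⟩ := (u0_eq_zero_iff (hOd hP.1)).1 h0
    exact hP.2 i hi
  have hr := (hk.mono hO' Set.inter_subset_left).div (Reg.pow hO' (reg_u0 hO' c
    fun P hP i => (hOd hP.1 i).1) 4) hu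
  obtain ⟨e, d, M, N, D, hM, hN, hD, hMP, hf⟩ := hr.exists_frac ⟨hPO, hne⟩
  obtain ⟨G₁, h1⟩ := exists_slice (M * N) 0 ![X, Q, R]
  obtain ⟨G₂, h2⟩ := exists_slice (M * D) 0 ![X, Q, R]
  refine ⟨G₁, G₂, ?_, fun Y hY => ?_⟩
  · rw [← h2 X hX, update_zero, sev_mul]
    exact mul_ne_zero hMP (hf _ hMP).2.1
  · rw [← h1 Y hY, ← h2 Y hY, update_zero, sev_mul, sev_mul]
    by_cases h0 : sev M ![Y, Q, R] = 0
    · rw [h0]; ring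
    · obtain ⟨hU, hD0, hq⟩ := hf _ h0
      rw [← he _ hU.1 hU.2, mul_div_cancel_right₀ _ (hu _ hU)] at hq
      rw [hq]; field_simp

/-- The expression is the reversed polynomial at t², whose value at 0 is the leading coefficient. -/
theorem tendsto_eval_inv (p : Polynomial ℂ) :
    Tendsto (fun t : ℂ => t ^ (2 * p.natDegree) * p.eval (t ^ 2)⁻¹) (𝓝[≠] 0)
      (𝓝 p.leadingCoeff) := by
  have h1 : Tendsto (fun t : ℂ => p.reverse.eval (t ^ 2)) (𝓝[≠] 0) (𝓝 p.leadingCoeff) := by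
    have : Continuous fun t : ℂ => p.reverse.eval (t ^ 2) :=
      p.reverse.continuous.comp (continuous_pow 2)
    have h2 := this.tendsto 0
    simp only [ne_eq, OfNat.ofNat_ne_zero, not_false_eq_true, zero_pow,
      ← Polynomial.coeff_zero_eq_eval_zero, Polynomial.coeff_zero_reverse] at h2
    exact h2.mono_left nhdsWithin_le_nhds
  refine h1.congr' ?_
  filter_upwards [self_mem_nhdsWithin] with t ht
  have ht2 : (t ^ 2)⁻¹ ≠ 0 := inv_ne_zero (pow_ne_zero _ ht)
  let _ := invertibleOfNonzero ht2
  have h3 := Polynomial.eval₂_reverse_mul_pow (RingHom.id ℂ) (t ^ 2)⁻¹ p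
  rw [invOf_eq_inv, inv_inv] at h3
  have ht0 : t ≠ 0 := ht
  change _ = t ^ (2 * p.natDegree) * Polynomial.eval₂ (RingHom.id ℂ) (t ^ 2)⁻¹ p
  rw [← h3, pow_mul]
  change Polynomial.eval₂ (RingHom.id ℂ) (t ^ 2) _ = _
  rw [inv_pow, mul_left_comm, mul_inv_cancel₀ (pow_ne_zero _ (pow_ne_zero _ ht0)), mul_one]

theorem natDegree_le_of_tendsto {p : Polynomial ℂ} {n : ℕ} {ℓ : ℂ}
    (h : Tendsto (fun t : ℂ => t ^ n * p.eval (t ^ 2)⁻¹) (𝓝[≠] 0) (𝓝 ℓ)) :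
    2 * p.natDegree ≤ n := by
  by_contra hc
  push Not at hc
  have h0 : Tendsto (fun t : ℂ => t ^ (2 * p.natDegree - n)) (𝓝[≠] 0) (𝓝 0) := by
    have := ((continuous_pow (M := ℂ) (2 * p.natDegree - n)).tendsto 0).mono_left
      (nhdsWithin_le_nhds (s := {0}ᶜ))
    rwa [zero_pow (by omega)] at this
  have h1 := h0.mul h
  have h2 := tendsto_nhds_unique (h1.congr fun t => by
    rw [← mul_assoc, ← pow_add, Nat.sub_add_cancel hc.le]) (tendsto_eval_inv p)
  rw [zero_mul] at h2
  rw [Polynomial.leadingCoeff_eq_zero.1 h2.symm] at hc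
  simp at hc

/-- A regular function on the affine curve with at most a fourfold pole at zero is a combination
of `1`, `X`, `Y` and `X²`. -/
theorem exists_coeffs_of_tendsto {p q : Polynomial ℂ} {γ : ℂ → Pt W} {w : ℂ → ℂ} (hw : w 0 = 1)
    (hw' : ContinuousAt w 0) (hwn : ∀ t, w (-t) = w t)
    (hγ : ∀ᶠ t in 𝓝[≠] 0, γ t ≠ 0 ∧ pX (γ t) = (t ^ 2)⁻¹ ∧ pY (γ t) = w t * (t ^ 3)⁻¹) {ℓ : ℂ}
    (h : Tendsto (fun t => t ^ 4 * (p.eval (pX (γ t)) + q.eval (pX (γ t)) * pY (γ t)))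
      (𝓝[≠] 0) (𝓝 ℓ)) :
    ∃ v : Fin 4 → ℂ, ∀ Y : Pt W, Y ≠ 0 →
      p.eval (pX Y) + q.eval (pX Y) * pY Y = ∑ k, v k * e4 Y k := by
  have hneg : Tendsto (fun t : ℂ => -t) (𝓝[≠] 0) (𝓝[≠] 0) := by
    refine tendsto_nhdsWithin_iff.2 ⟨?_, ?_⟩
    · have := (continuous_neg (G := ℂ)).tendsto 0
      rw [neg_zero] at this
      exact this.mono_left nhdsWithin_le_nhds
    · filter_upwards [self_mem_nhdsWithin] with t ht
      simpa using ht
  have h' := h.comp hneg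
  -- Replacing t by −t fixes X and negates Y, since w is even. The half sum isolates p and the half
  -- difference isolates q, bounding their degrees by 2 and 0.
  have hp : 2 * p.natDegree ≤ 4 := by
    refine natDegree_le_of_tendsto (((h.add h').const_mul (1 / 2)).congr' ?_)
    filter_upwards [hγ, hneg.eventually hγ] with t ⟨_, h1, h2⟩ ⟨_, h3, h4⟩
    simp only [Function.comp, h1, h2, h3, h4, hwn]
    have e2 : (-t) ^ 2 = t ^ 2 := by ring
    have e3 : (-t) ^ 3 = -t ^ 3 := by ring
    rw [e2, e3, inv_neg]; ring
  have hwt : Tendsto (fun t => (w t)⁻¹) (𝓝[≠] 0) (𝓝 1⁻¹) := by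
    have := hw'.tendsto
    rw [hw] at this
    exact (this.mono_left nhdsWithin_le_nhds).inv₀ one_ne_zero
  have hw0 : ∀ᶠ t in 𝓝[≠] 0, w t ≠ 0 :=
    (hw'.eventually_ne (by rw [hw]; exact one_ne_zero)).filter_mono nhdsWithin_le_nhds
  have hq : 2 * q.natDegree ≤ 1 := by
    refine natDegree_le_of_tendsto ((((h.sub h').const_mul (1 / 2)).mul hwt).congr' ?_)
    filter_upwards [hγ, hneg.eventually hγ, hw0, self_mem_nhdsWithin]
      with t ⟨_, h1, h2⟩ ⟨_, h3, h4⟩ h5 h6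
    have h7 : t ≠ 0 := h6
    simp only [Function.comp, h1, h2, h3, h4, hwn]
    have e2 : (-t) ^ 2 = t ^ 2 := by ring
    have e3 : (-t) ^ 3 = -t ^ 3 := by ring
    rw [e2, e3, inv_neg]
    field_simp
    ring
  refine ⟨![p.coeff 0, p.coeff 1, q.coeff 0, p.coeff 2], fun Y hY => ?_⟩
  rw [e4_of_ne hY, Polynomial.eval_eq_sum_range' (n := 3) (by omega),
    Polynomial.eval_eq_sum_range' (n := 1) (by omega)]
  simp [Finset.sum_range_succ, Fin.sum_univ_four]
  ring

theorem isParam_vec {γ : ℂ → Pt W} {cc : ℂ → Fin 3 → ℂ} {c' : Fin 3 → ℂ} (h : IsParam γ cc c')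
    (Q R : Pt W) : ∀ i, IsParam ((![γ, fun _ => Q, fun _ => R] : Fin 3 → ℂ → Pt W) i)
      ((![cc, fun _ => sc Q, fun _ => sc R] : Fin 3 → ℂ → Fin 3 → ℂ) i)
      ((![c', 0, 0] : Fin 3 → Fin 3 → ℂ) i) := by
  intro i; fin_cases i
  exacts [h, isParam_const Q, isParam_const R]

theorem vec_apply (γ : ℂ → Pt W) (Q R : Pt W) (t : ℂ) :
    (fun i => (![γ, fun _ => Q, fun _ => R] : Fin 3 → ℂ → Pt W) i t) = ![γ t, Q, R] := by
  funext i; fin_cases i <;> rfl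

/-- Since Q + R ≠ 0, the triple {0, Q, R} is off G₀ and the section times u₀⁴ extends regularly
there. As u₀ is t times a factor with nonzero limit, the pole in t has order at most four. -/
theorem tendsto_pull_slice [W.IsElliptic] (s : globalSections W) {Q R : Pt W} (hQ : Q ≠ 0)
    (hR : R ≠ 0) (hs : Q + R ≠ 0) {γ : ℂ → Pt W} {w : ℂ → ℂ} (h0 : γ 0 = 0) (hw : w 0 = 1)
    (hγ : IsParam γ (fun t => ![t, w t, t ^ 3]) ![1, 0, 0]) (hγ0 : ∀ᶠ t in 𝓝[≠] 0, γ t ≠ 0) :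
    ∃ ℓ, Tendsto (fun t => t ^ 4 * pull s ![γ t, Q, R]) (𝓝[≠] 0) (𝓝 ℓ) := by
  obtain ⟨c, L, O, k, hO, hPO, hOd, hk, he, -⟩ := exists_local s (P := ![0, Q, R])
    (Or.inl (by simpa using hs))
  have hp := isParam_vec hγ Q R
  have hPO' : (fun i => (![γ, fun _ => Q, fun _ => R] : Fin 3 → ℂ → Pt W) i 0) ∈ O := by
    rw [vec_apply, h0]; exact hPO
  have hd := hOd hPO
  have hL : L 1 ≠ 0 := by simpa [lin, Fin.sum_univ_three] using (hd 0).1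
  have dk := (IsParam.differentiableAt hp hk hPO').continuousAt.tendsto
  have hm := IsParam.eventually_mem hp hO hPO'
  simp only [vec_apply] at dk hm
  have dz := (hasDerivAt_iff_tendsto_slope.1 (hasDerivAt_zf_zeroParam hγ hw c hL)).inv₀
    (inv_ne_zero hL)
  have hz0 : zf c L (γ 0) = 0 := by rw [h0]; exact (zf_eq_zero_iff (hd 0)).2 rfl
  have hz1 : zf c L Q ≠ 0 := fun h => hQ ((zf_eq_zero_iff (hd 1)).1 h)
  have hz2 : zf c L R ≠ 0 := fun h => hR ((zf_eq_zero_iff (hd 2)).1 h)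
  refine ⟨_, (((dk.mono_left nhdsWithin_le_nhds).mul (dz.pow 4)).mul_const
    ((zf c L Q * zf c L R) ^ 4)⁻¹).congr' ?_⟩
  filter_upwards [hm.filter_mono nhdsWithin_le_nhds, hγ0, self_mem_nhdsWithin] with t ht ht0 ht1
  have hne : ∀ i, (![γ t, Q, R] : Fin 3 → Pt W) i ≠ 0 := by
    intro i; fin_cases i
    exacts [ht0, hQ, hR]
  have hzt : zf c L (γ t) ≠ 0 := fun h => ht0 ((zf_eq_zero_iff (hOd ht 0)).1 h)
  have ht1 : t ≠ 0 := ht1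
  rw [← he _ ht hne, slope_def_field, hz0, u0, Fin.prod_univ_three]
  simp only [Matrix.cons_val_zero, Matrix.cons_val_one, Matrix.cons_val]
  field_simp
  ring

/-- A slice is regular on the affine curve with at most a fourfold pole at 0, hence a section of
𝒪(4·0). -/
theorem pull_slice_mem_span [W.IsElliptic] (s : globalSections W) {Q R : Pt W} (h : Good Q R) :
    ∃ v : Fin 4 → ℂ, ∀ X : Pt W, X ≠ 0 → pull s ![X, Q, R] = ∑ k, v k * e4 X k := by
  obtain ⟨p, q, hpq⟩ := exists_polynomial_of_local (φ := fun X => pull s ![X, Q, R])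
    fun X hX => pull_slice_local s h hX
  obtain ⟨γ, w, h0, hw, hwd, hwn, hγ, hγ0⟩ := exists_zeroParam (W := W)
  obtain ⟨ℓ, hℓ⟩ := tendsto_pull_slice s h.ne₁ h.ne₂ h.sum h0 hw hγ (hγ0.mono fun t ht => ht.1)
  obtain ⟨v, hv⟩ := exists_coeffs_of_tendsto (p := p) (q := q) hw hwd.continuousAt hwn hγ0
    (hℓ.congr' (hγ0.mono fun t ht => by simp only [hpq _ ht.1]))
  exact ⟨v, fun X hX => (hpq X hX).trans (hv X hX)⟩

/-! ### Interpolation: sections are given by tensors -/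

/-- Four points P, −P, Q, R suffice: the evaluation matrix of 1, X, Y, X² has determinant, up to
sign, 2Y(P) times the Vandermonde product of the three abscissae. The inverse matrix recovers
coefficients from values. -/
theorem exists_interpolation [W.IsElliptic] {S : Set (Pt W)} (hS : S.Finite) :
    ∃ (A : Fin 4 → Pt W) (N : Matrix (Fin 4) (Fin 4) ℂ), (∀ i, A i ∉ S ∧ A i ≠ 0) ∧
      ∀ (φ : Pt W → ℂ) (v : Fin 4 → ℂ), (∀ X : Pt W, X ≠ 0 → φ X = ∑ k, v k * e4 X k) →
        ∀ X : Pt W, X ≠ 0 → φ X = ∑ k, (∑ i, N k i * φ (A i)) * e4 X k := by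
  have hy : {Q : Pt W | Q ≠ 0 ∧ pY Q = 0}.Finite := by
    refine (finite_zeros (W := W) (p := 0) (q := 1) (by simp)).subset fun Q hQ => ⟨hQ.1, ?_⟩
    simpa using hQ.2
  -- Both P and −P have to avoid S, and Y(P) ≠ 0 is needed for the determinant.
  obtain ⟨P, -, hP⟩ := (infinite_pt (W := W)).exists_notMem_finite
    (((hS.union (hS.preimage (f := fun Q => -Q) neg_injective.injOn)).union
      (Set.finite_singleton 0)).union hy)
  simp only [Set.mem_union, Set.mem_preimage, Set.mem_singleton_iff, Set.mem_ofPred_eq, not_or,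
    not_and] at hP
  obtain ⟨⟨⟨hP1, hP2⟩, hP3⟩, hP4⟩ := hP
  obtain ⟨Q, -, hQ⟩ := (infinite_pt (W := W)).exists_notMem_finite
    ((hS.union (Set.finite_singleton 0)).union (finite_pX_eq (pX P)))
  simp only [Set.mem_union, Set.mem_singleton_iff, Set.mem_ofPred_eq, not_or, not_and] at hQ
  obtain ⟨⟨hQ1, hQ2⟩, hQ3⟩ := hQ
  obtain ⟨R, -, hR⟩ := (infinite_pt (W := W)).exists_notMem_finite
    (((hS.union (Set.finite_singleton 0)).union (finite_pX_eq (pX P))).union (finite_pX_eq (pX Q)))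
  simp only [Set.mem_union, Set.mem_singleton_iff, Set.mem_ofPred_eq, not_or, not_and] at hR
  obtain ⟨⟨⟨hR1, hR2⟩, hR3⟩, hR4⟩ := hR
  let M : Matrix (Fin 4) (Fin 4) ℂ := Matrix.of fun i k => e4 ((![P, -P, Q, R] : Fin 4 → Pt W) i) k
  have hdet : M.det = 2 * pY P * (pX Q - pX P) * (pX R - pX P) * (pX R - pX Q) ∨
      M.det = -(2 * pY P * (pX Q - pX P) * (pX R - pX P) * (pX R - pX Q)) := by
    simp [M, Matrix.det_succ_row_zero, Fin.sum_univ_succ, Fin.succAbove, e4_of_ne hP3,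
      e4_of_ne (neg_ne_zero.2 hP3), e4_of_ne hQ2, e4_of_ne hR2, pX_neg, pY_neg]
    left; ring
  have hne : 2 * pY P * (pX Q - pX P) * (pX R - pX P) * (pX R - pX Q) ≠ 0 :=
    mul_ne_zero (mul_ne_zero (mul_ne_zero (mul_ne_zero two_ne_zero (hP4 hP3))
      (sub_ne_zero.2 (hQ3 hQ2))) (sub_ne_zero.2 (hR3 hR2))) (sub_ne_zero.2 (hR4 hR2))
  have hM : IsUnit M.det := by
    rw [isUnit_iff_ne_zero]
    rcases hdet with h | h <;> rw [h]
    exacts [hne, neg_ne_zero.2 hne]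
  have hA : ∀ i, (![P, -P, Q, R] : Fin 4 → Pt W) i ∉ S ∧ (![P, -P, Q, R] : Fin 4 → Pt W) i ≠ 0 := by
    intro i; fin_cases i
    exacts [⟨hP1, hP3⟩, ⟨hP2, neg_ne_zero.2 hP3⟩, ⟨hQ1, hQ2⟩, ⟨hR1, hR2⟩]
  refine ⟨![P, -P, Q, R], M⁻¹, hA, fun φ v hφ X hX => ?_⟩
  have hv : M.mulVec v = fun i => φ ((![P, -P, Q, R] : Fin 4 → Pt W) i) := by
    funext i
    rw [hφ _ (hA i).2]
    change ∑ k, e4 ((![P, -P, Q, R] : Fin 4 → Pt W) i) k * v k = _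
    exact Finset.sum_congr rfl fun k _ => mul_comm _ _
  have hv' : M⁻¹.mulVec (fun i => φ ((![P, -P, Q, R] : Fin 4 → Pt W) i)) = v := by
    rw [← hv, Matrix.mulVec_mulVec, Matrix.nonsing_inv_mul _ hM, Matrix.one_mulVec]
  rw [hφ X hX]
  refine Finset.sum_congr rfl fun k _ => ?_
  rw [← hv']
  rfl

theorem pull_swap01 (s : globalSections W) (X Q R : Pt W) :
    pull s ![Q, X, R] = pull s ![X, Q, R] := by
  rw [← pull_comp s ![X, Q, R] (Equiv.swap 0 1)]
  congr 1; funext i; fin_cases i <;> rfl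

theorem pull_swap12 (s : globalSections W) (X Q R : Pt W) :
    pull s ![X, R, Q] = pull s ![X, Q, R] := by
  rw [← pull_comp s ![X, Q, R] (Equiv.swap 1 2)]
  congr 1; funext i; fin_cases i <;> rfl

/-- A Künneth argument by hand: interpolate in the first variable at the Aᵢ, then in the second at
the Bⱼ; the remaining slices are linear in the four basis functions. The genericity conditions make
every slice that occurs one of a `Good` pair. -/
theorem exists_tri_eq_pull [W.IsElliptic] (s : globalSections W) :
    ∃ (A : Fin 4 → Pt W) (C : Fin 4 → Fin 4 → Fin 4 → ℂ), (∀ i, A i ≠ 0) ∧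
      ∀ X Y Z : Pt W, X ≠ 0 → Good Y Z → (∀ i, Good (A i) Z) →
        pull s ![X, Y, Z] = tri C (e4 X) (e4 Y) (e4 Z) := by
  obtain ⟨A, N, hA, hN⟩ := exists_interpolation (W := W) Set.finite_empty
  obtain ⟨B, N', hB, hN'⟩ := exists_interpolation (W := W)
    (Set.finite_iUnion fun i => finite_not_good (hA i).2)
  have hAB : ∀ i j, Good (A i) (B j) := by
    intro i j
    have := (hB j).1
    simp only [Set.mem_iUnion, Set.mem_ofPred_eq, not_exists, not_not] at this
    exact this i
  choose a ha using fun i j => pull_slice_mem_span s (hAB i j)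
  -- Here `a i j` are the coefficients of the slice X ↦ {X, Aᵢ, Bⱼ}.
  refine ⟨A, fun k l m => ∑ i, N k i * ∑ j, N' l j * a i j m, fun i => (hA i).2,
    fun X Y Z hX hYZ hZ => ?_⟩
  obtain ⟨v, hv⟩ := pull_slice_mem_span s hYZ
  rw [hN (fun X => pull s ![X, Y, Z]) v hv X hX, tri]
  refine Finset.sum_congr rfl fun k _ => ?_
  have h1 : ∀ i, pull s ![A i, Y, Z] =
      ∑ l, ∑ m, (∑ j, N' l j * a i j m) * e4 Y l * e4 Z m := by
    intro i
    obtain ⟨v', hv'⟩ := pull_slice_mem_span s (hZ i)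
    rw [← pull_swap01, hN' (fun Y => pull s ![Y, A i, Z]) v' hv' Y hYZ.ne₁]
    refine Finset.sum_congr rfl fun l _ => ?_
    have h2 : ∀ j, pull s ![B j, A i, Z] = ∑ m, a i j m * e4 Z m := by
      intro j
      rw [← ha i j Z hYZ.ne₂, pull_swap01, ← pull_swap12, pull_swap01]
    simp only [h2, Finset.mul_sum, Finset.sum_mul]
    rw [Finset.sum_comm]
    exact Finset.sum_congr rfl fun _ _ => Finset.sum_congr rfl fun _ _ => by ring
  simp only [h1, Finset.mul_sum, Finset.sum_mul]
  rw [Finset.sum_comm]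
  refine Finset.sum_congr rfl fun l _ => ?_
  rw [Finset.sum_comm]
  refine Finset.sum_congr rfl fun m _ => Finset.sum_congr rfl fun i _ =>
    Finset.sum_congr rfl fun j _ => ?_
  ring

/-- The symmetrization of a tensor. -/
def symz (C : Fin 4 → Fin 4 → Fin 4 → ℂ) : Fin 4 → Fin 4 → Fin 4 → ℂ := fun i j k =>
  (C i j k + C i k j + C j i k + C j k i + C k i j + C k j i) / 6

theorem isSymm_symz (C : Fin 4 → Fin 4 → Fin 4 → ℂ) : IsSymm (symz C) :=
  ⟨fun i j k => by simp only [symz]; ring, fun i j k => by simp only [symz]; ring⟩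

theorem tri_symz (C : Fin 4 → Fin 4 → Fin 4 → ℂ) (x y z : Fin 4 → ℂ) : tri (symz C) x y z =
    (tri C x y z + tri C x z y + tri C y x z + tri C y z x + tri C z x y + tri C z y x) / 6 := by
  simp only [tri, Fin.sum_univ_four, symz]
  ring

/-- A regular function vanishing at generic triples vanishes. -/
theorem Reg.eq_zero_of_generic [W.IsElliptic] {U : Set (Fin 3 → Pt W)} {f : (Fin 3 → Pt W) → ℂ}
    (hf : Reg U f) {S₂ : Set (Pt W)} {S₁ : Pt W → Set (Pt W)} {S₀ : Pt W → Pt W → Set (Pt W)}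
    (h₂ : S₂.Finite) (h₁ : ∀ Z, Z ∉ S₂ → (S₁ Z).Finite)
    (h₀ : ∀ Y Z, Z ∉ S₂ → Y ∉ S₁ Z → (S₀ Y Z).Finite)
    (h : ∀ X Y Z, Z ∉ S₂ → Y ∉ S₁ Z → X ∉ S₀ Y Z → ![X, Y, Z] ∈ U → f ![X, Y, Z] = 0) :
    ∀ P ∈ U, f P = 0 := by
  intro P hP
  obtain ⟨e, d, M, N, D, hM, hN, hD, hMP, hq⟩ := hf.exists_frac hP
  by_contra hc
  have hMN : IsMultihom (M * N) (e + d) := hM.mul hN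
  have h0 : sev (M * N) P ≠ 0 := by
    rw [sev_mul]
    refine mul_ne_zero hMP fun hN0 => hc ?_
    rw [(hq P hMP).2.2, hN0, zero_div]
  have step : ∀ (i : Fin 3) (Q : Fin 3 → Pt W) (S : Set (Pt W)), S.Finite → sev (M * N) Q ≠ 0 →
      ∃ X ∉ S, sev (M * N) (Function.update Q i X) ≠ 0 := by
    intro i Q S hS hQ
    have hfin := finite_slice hMN i Q (Q₀ := Q i) (by rwa [Function.update_eq_self])
    obtain ⟨X, -, hX⟩ := (infinite_pt (W := W)).exists_notMem_finite (hS.union hfin)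
    exact ⟨X, fun h => hX (Or.inl h), fun h => hX (Or.inr h)⟩
  obtain ⟨Z, hZ, k2⟩ := step 2 P S₂ h₂ h0
  obtain ⟨Y, hY, k1⟩ := step 1 _ (S₁ Z) (h₁ Z hZ) k2
  obtain ⟨X, hX, k0⟩ := step 0 _ (S₀ Y Z) (h₀ Y Z hZ hY) k1
  have hv : Function.update (Function.update (Function.update P 2 Z) 1 Y) 0 X = ![X, Y, Z] := by
    funext i; fin_cases i <;> rfl
  rw [hv, sev_mul] at k0
  obtain ⟨hU, hD0, hfq⟩ := hq _ (left_ne_zero_of_mul k0)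
  rw [h X Y Z hZ hY hX hU] at hfq
  exact div_ne_zero (right_ne_zero_of_mul k0) hD0 hfq.symm

/-- The section `s` is locally given by the tensor `C`. -/
def Represents (C : Fin 4 → Fin 4 → Fin 4 → ℂ) (s : globalSections W) : Prop :=
  ∀ (c : ℂ) (L : Fin 3 → ℂ) (O : Set (Fin 3 → Pt W)) (k : (Fin 3 → Pt W) → ℂ),
    Opn O → O ⊆ dom W c L → Reg O k →
    (∀ Q ∈ O, (∀ i, Q i ≠ 0) → pull s Q * u0 c L Q ^ 4 = k Q) → ∀ Q ∈ O, k Q = H C c L Q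

/-- Every section is locally given by a symmetric tensor. -/
theorem exists_tensor [W.IsElliptic] (s : globalSections W) :
    ∃ C, IsSymm C ∧ Represents C s := by
  obtain ⟨A, C, hA, hC⟩ := exists_tri_eq_pull s
  refine ⟨symz C, isSymm_symz C, fun c L O k hO hd hk he Q hQ => ?_⟩
  let S : Set (Pt W) := {0} ∪ ⋃ i, {Z | ¬Good (A i) Z}
  have hS : S.Finite := (Set.finite_singleton 0).union
    (Set.finite_iUnion fun i => finite_not_good (hA i))
  have hS0 : ∀ Z, Z ∉ S → Z ≠ 0 ∧ ∀ i, Good (A i) Z := by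
    intro Z hZ
    simpa [S] using hZ
  refine sub_eq_zero.1 ((hk.sub hO (reg_H hO c (fun P hP i => (hd hP i).1) (symz C))).eq_zero_of_generic
    (S₂ := S) (S₁ := fun Z => S ∪ {Y | ¬Good Z Y})
    (S₀ := fun Y Z => S ∪ ({X | ¬Good Z X} ∪ {X | ¬Good Y X})) hS
    (fun Z hZ => hS.union (finite_not_good (hS0 Z hZ).1))
    (fun Y Z hZ hY => hS.union ((finite_not_good (hS0 Z hZ).1).union
      (finite_not_good (hS0 Y fun h => hY (Or.inl h)).1))) (fun X Y Z hZ hY hX hU => ?_) Q hQ)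
  simp only [Set.mem_union, Set.mem_ofPred_eq, not_or, not_not] at hY hX
  obtain ⟨z0, zA⟩ := hS0 Z hZ
  obtain ⟨y0, yA⟩ := hS0 Y hY.1
  obtain ⟨x0, xA⟩ := hS0 X hX.1
  have gYZ := hY.2.symm
  have gXZ := hX.2.1.symm
  have gXY := hX.2.2.symm
  have hne : ∀ i, (![X, Y, Z] : Fin 3 → Pt W) i ≠ 0 := by
    intro i; fin_cases i
    exacts [x0, y0, z0]
  -- All six orderings of the triple are generic, so each term of the symmetrization equals the same
  -- value of the section.
  have hT : T (symz C) ![X, Y, Z] = pull s ![X, Y, Z] := by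
    change tri (symz C) (e4 X) (e4 Y) (e4 Z) = _
    rw [tri_symz, ← hC X Y Z x0 gYZ zA, ← hC X Z Y x0 gYZ.symm yA, ← hC Y X Z y0 gXZ zA,
      ← hC Y Z X y0 gXZ.symm xA, ← hC Z X Y z0 gXY yA, ← hC Z Y X z0 gXY.symm xA]
    have e1 := pull_swap12 s X Y Z
    have e2 := pull_swap01 s X Y Z
    have e3 := pull_swap12 s Y X Z
    have e4 := pull_swap01 s X Z Y
    have e5 := pull_swap12 s Z X Y
    rw [e5, e3, e4, e1, e2]
    ring
  rw [H_eq_of_ne (fun i => (hd hU i).1) hne, hT, he _ hU hne, sub_self]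

/-- The tensor of a section vanishes on collinear triples of distinct affine points. -/
theorem exists_tensor_vanishing [W.IsElliptic] (s : globalSections W) :
    ∃ C, IsSymm C ∧ Represents C s ∧
      ∀ P : Fin 3 → Pt W, Function.Injective P → P 0 + P 1 + P 2 = 0 → T C P = 0 := by
  obtain ⟨C, hC, h⟩ := exists_tensor s
  refine ⟨C, hC, h, fun P hP hs => ?_⟩
  obtain ⟨c, L, O, k, hO, hPO, hOd, hk, he, hv⟩ := exists_local s (Or.inr hP)
  have h1 := h c L O k hO hOd hk he P hPO
  rw [hv P hPO hs] at h1
  by_contra hT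
  exact (H_ne_zero_iff (hOd hPO)).2 hT h1.symm

/-! ### Linear relations between the coefficients of a tensor vanishing on collinear triples -/

theorem finite_sum_pow_eq_zero {n : ℕ} {g : Fin n → ℂ} {j : Fin n} (hj : g j ≠ 0) :
    {b : ℂ | ∑ i, g i * b ^ (i : ℕ) = 0}.Finite := by
  let p : Polynomial ℂ := ∑ i, Polynomial.C (g i) * Polynomial.X ^ (i : ℕ)
  have hp : p ≠ 0 := by
    intro h0
    have h1 := congrArg (fun p => Polynomial.coeff p j) h0
    simp only [p, Polynomial.finsetSum_coeff, Polynomial.coeff_C_mul, Polynomial.coeff_X_pow,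
      Polynomial.coeff_zero] at h1
    rw [Finset.sum_eq_single j] at h1
    · simp at h1; exact hj h1
    · intro i _ hi
      rw [if_neg fun h => hi (Fin.ext h.symm), mul_zero]
    · simp
  refine p.roots.toFinset.finite_toSet.subset fun b hb => ?_
  simp only [Finset.mem_coe, Multiset.mem_toFinset, Polynomial.mem_roots hp, Polynomial.IsRoot, p,
    Polynomial.eval_finsetSum, Polynomial.eval_mul, Polynomial.eval_C, Polynomial.eval_pow,
    Polynomial.eval_X]
  exact hb

theorem coeff_eq_zero_of_cofinite {n : ℕ} {g : Fin n → ℂ} {S : Set ℂ} (hS : S.Finite)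
    (h : ∀ b ∉ S, ∑ i, g i * b ^ (i : ℕ) = 0) (j : Fin n) : g j = 0 := by
  by_contra hj
  obtain ⟨b, hb⟩ := (hS.union (finite_sum_pow_eq_zero hj)).exists_notMem
  exact hb (Or.inr (h b fun hbS => hb (Or.inl hbS)))

theorem exists_roots (e₁ e₂ e₃ : ℂ) : ∃ x y z : ℂ, x + y + z = e₁ ∧ x * y + x * z + y * z = e₂ ∧
    x * y * z = e₃ := by
  let p : Polynomial ℂ := Polynomial.X ^ 3 - Polynomial.C e₁ * Polynomial.X ^ 2 +
    Polynomial.C e₂ * Polynomial.X - Polynomial.C e₃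
  have hp : p.degree ≠ 0 := by
    have : p.degree = 3 := by simp only [p]; compute_degree!
    rw [this]; decide
  obtain ⟨x, hx⟩ := IsAlgClosed.exists_root p hp
  simp only [Polynomial.IsRoot, p, Polynomial.eval_sub, Polynomial.eval_add, Polynomial.eval_pow,
    Polynomial.eval_mul, Polynomial.eval_X, Polynomial.eval_C] at hx
  obtain ⟨d, hd⟩ := IsAlgClosed.exists_pow_nat_eq ((e₁ - x) ^ 2 - 4 * (e₂ - x * (e₁ - x))) two_pos
  refine ⟨x, (e₁ - x + d) / 2, (e₁ - x - d) / 2, by ring, ?_, ?_⟩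
  · linear_combination -(1 / 4 : ℂ) * hd
  · linear_combination -(x / 4) * hd + hx

/-- The abscissae are the roots, with multiplicity, of X³ + AX + B − (aX + b)². -/
theorem exists_onLine [W.IsElliptic] (a b : ℂ) : ∃ P Q R : Pt W, P ≠ 0 ∧ Q ≠ 0 ∧ R ≠ 0 ∧
    OnLine a b P Q R := by
  obtain ⟨x, y, z, h1, h2, h3⟩ := exists_roots (a ^ 2) (sA W - 2 * a * b) (b ^ 2 - sB W)
  obtain ⟨P, hP, hPX, hPY⟩ := exists_pt (W := W) (x := x) (y := a * x + b)
    (by linear_combination -x ^ 2 * h1 + x * h2 - h3)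
  obtain ⟨Q, hQ, hQX, hQY⟩ := exists_pt (W := W) (x := y) (y := a * y + b)
    (by linear_combination -y ^ 2 * h1 + y * h2 - h3)
  obtain ⟨R, hR, hRX, hRY⟩ := exists_pt (W := W) (x := z) (y := a * z + b)
    (by linear_combination -z ^ 2 * h1 + z * h2 - h3)
  exact ⟨P, Q, R, hP, hQ, hR, by rw [hPX, hPY], by rw [hQX, hQY], by rw [hRX, hRY],
    by rw [hPX, hQX, hRX, h1], by rw [hPX, hQX, hRX, h2], by rw [hPX, hQX, hRX, h3]⟩

variable (W) in
/-- The discriminant of the cubic cut out on a line, as a polynomial in the intercept. -/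
def lineDisc (a : ℂ) : Fin 5 → ℂ :=
  ![a ^ 4 * sA W ^ 2 - 4 * sA W ^ 3 + 4 * a ^ 6 * sB W - 18 * a ^ 2 * sA W * sB W - 27 * sB W ^ 2,
    -4 * a ^ 5 * sA W + 24 * a * sA W ^ 2 + 36 * a ^ 3 * sB W,
    -30 * a ^ 2 * sA W + 54 * sB W, -4 * a ^ 3, -27]

theorem OnLine.lineDisc_eq {a b : ℂ} {P Q R : Pt W} (h : OnLine a b P Q R) :
    ∑ i, lineDisc W a i * b ^ (i : ℕ) =
      ((pX P - pX Q) * (pX P - pX R) * (pX Q - pX R)) ^ 2 := by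
  have hA : sA W = pX P * pX Q + pX P * pX R + pX Q * pX R + 2 * a * b := by
    linear_combination -h.e₂
  have hB : sB W = b ^ 2 - pX P * pX Q * pX R := by linear_combination h.e₃
  have hR : pX R = a ^ 2 - pX P - pX Q := by linear_combination h.e₁
  simp only [lineDisc, Fin.sum_univ_five]
  simp [hA, hB, hR]
  ring

/-- The polynomial in the slope and intercept of a line given by the restriction of a symmetric
tensor to the lines. -/
def lineCoeff (W : WeierstrassCurve ℂ) (C : Fin 4 → Fin 4 → Fin 4 → ℂ) : Fin 5 → Fin 5 → ℂ :=
  ![![C 0 0 0 + sA W * C 1 1 0 - sB W * C 1 1 1 - 2 * sA W * C 3 0 0 +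
        3 * sB W * C 3 1 0 + sA W ^ 2 * C 3 3 0 - sA W * sB W * C 3 3 1 + sB W ^ 2 * C 3 3 3,
      2 * sA W * C 2 1 0 - 3 * sB W * C 2 1 1 + 3 * sB W * C 3 2 0 - sA W * sB W * C 3 3 2,
      C 1 0 0 + sA W * C 2 2 0 - 3 * sB W * C 2 2 1 + sA W * C 3 1 0 - sB W * C 3 1 1 + 2 * sB W * C 3 3 0,
      C 2 0 0 - sB W * C 2 2 2 + sA W * C 3 2 0 - 2 * sB W * C 3 2 1,
      C 3 0 0 - sB W * C 3 2 2],
    ![3 * C 2 0 0 + sA W * C 2 1 1 - 4 * sA W * C 3 2 0 + 3 * sB W * C 3 2 1 + sA W ^ 2 * C 3 3 2,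
      -2 * C 1 1 0 + 2 * sA W * C 2 2 1 + 4 * C 3 0 0 + 3 * sB W * C 3 2 2 -
        4 * sA W * C 3 3 0 + 2 * sB W * C 3 3 1,
      -2 * C 2 1 0 + sA W * C 2 2 2 + sA W * C 3 2 1 + 4 * sB W * C 3 3 2,
      -2 * C 3 1 0 + sA W * C 3 2 2,
      0],
    ![C 1 1 1 + 3 * C 2 2 0 - 3 * C 3 1 0 - 2 * sA W * C 3 2 2 + sA W * C 3 3 1 - 2 * sB W * C 3 3 3,
      C 2 1 1 + 5 * C 3 2 0 - 3 * sA W * C 3 3 2,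
      C 3 1 1 + 2 * C 3 3 0,
      0,
      0],
    ![C 2 2 2 - 3 * C 3 2 1,
      C 3 2 2 - 2 * C 3 3 1,
      0,
      0,
      0],
    ![C 3 3 3,
      0,
      0,
      0,
      0]]

/-- A symmetric function of the three points of a line is a polynomial in a and b by Vieta;
`lineCoeff W C j i` is the coefficient of bʲaⁱ. The entries of C are first brought to weakly
decreasing index order. -/
theorem IsSymm.T_onLine {C : Fin 4 → Fin 4 → Fin 4 → ℂ} (hC : IsSymm C) {a b : ℂ} {P Q R : Pt W}
    (hP : P ≠ 0) (hQ : Q ≠ 0) (hR : R ≠ 0) (h : OnLine a b P Q R) :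
    T C ![P, Q, R] = ∑ j, (∑ i, lineCoeff W C j i * a ^ (i : ℕ)) * b ^ (j : ℕ) := by
  have hA : sA W = pX P * pX Q + pX P * pX R + pX Q * pX R + 2 * a * b := by
    linear_combination -h.e₂
  have hB : sB W = b ^ 2 - pX P * pX Q * pX R := by linear_combination h.e₃
  have hR' : pX R = a ^ 2 - pX P - pX Q := by linear_combination h.e₁
  simp only [T, tri, Fin.sum_univ_four, Fin.sum_univ_five, lineCoeff, Matrix.cons_val_zero,
    Matrix.cons_val_one, Matrix.cons_val, e4_of_ne hP, e4_of_ne hQ, e4_of_ne hR, h.y₁, h.y₂, h.y₃]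
  simp only [
    hC.swap₂ 0 0 1, hC.swap₂ 0 0 2, hC.swap₂ 0 0 3, hC.swap₁ 0 1 0, hC.swap₁ 0 1 1, hC.swap₁ 0 1 2,
    hC.swap₁ 0 1 3, hC.swap₁ 0 2 0, hC.swap₁ 0 2 1, hC.swap₁ 0 2 2, hC.swap₁ 0 2 3, hC.swap₁ 0 3 0,
    hC.swap₁ 0 3 1, hC.swap₁ 0 3 2, hC.swap₁ 0 3 3, hC.swap₂ 1 0 1, hC.swap₂ 1 0 2, hC.swap₂ 1 0 3,
    hC.swap₂ 1 1 2, hC.swap₂ 1 1 3, hC.swap₁ 1 2 0, hC.swap₁ 1 2 1, hC.swap₁ 1 2 2, hC.swap₁ 1 2 3,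
    hC.swap₁ 1 3 0, hC.swap₁ 1 3 1, hC.swap₁ 1 3 2, hC.swap₁ 1 3 3, hC.swap₂ 2 0 1, hC.swap₂ 2 0 2,
    hC.swap₂ 2 0 3, hC.swap₂ 2 1 2, hC.swap₂ 2 1 3, hC.swap₂ 2 2 3, hC.swap₁ 2 3 0, hC.swap₁ 2 3 1,
    hC.swap₁ 2 3 2, hC.swap₁ 2 3 3, hC.swap₂ 3 0 1, hC.swap₂ 3 0 2, hC.swap₂ 3 0 3, hC.swap₂ 3 1 2,
    hC.swap₂ 3 1 3, hC.swap₂ 3 2 3]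
  simp only [hA, hB, hR', Fin.val_zero, Fin.val_one, Fin.val_two, pow_zero, pow_one]
  have v3 : ((3 : Fin 5) : ℕ) = 3 := rfl
  have v4 : ((4 : Fin 5) : ℕ) = 4 := rfl
  rw [v3, v4]
  ring

/-- For fixed slope, all but finitely many intercepts give three distinct abscissae, where the
tensor vanishes. So the polynomial vanishes coefficientwise in b, and then in a. -/
theorem IsSymm.lineCoeff_eq_zero [W.IsElliptic] {C : Fin 4 → Fin 4 → Fin 4 → ℂ} (hC : IsSymm C)
    (h : ∀ P : Fin 3 → Pt W, Function.Injective P → P 0 + P 1 + P 2 = 0 → T C P = 0)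
    (j i : Fin 5) : lineCoeff W C j i = 0 := by
  refine coeff_eq_zero_of_cofinite Set.finite_empty (fun a _ => ?_) i
  refine coeff_eq_zero_of_cofinite
    (g := fun j => ∑ i, lineCoeff W C j i * a ^ (i : ℕ))
    -- The coefficient of b⁴ in the discriminant is −27 for every slope.
    (finite_sum_pow_eq_zero (g := lineDisc W a) (j := 4)
    (by simp [lineDisc])) (fun b hb => ?_) j
  obtain ⟨P, Q, R, hP, hQ, hR, hl⟩ := exists_onLine (W := W) a b
  rw [← hC.T_onLine hP hQ hR hl]
  simp only [Set.mem_ofPred_eq, hl.lineDisc_eq, sq_eq_zero_iff, mul_eq_zero, sub_eq_zero,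
    not_or] at hb
  obtain ⟨⟨h1, h2⟩, h3⟩ := hb
  refine h _ (fun i j hij => ?_) (sum_eq_zero_of_onLine hP hQ hR hl)
  have k1 : P ≠ Q := fun h => h1 (by rw [h])
  have k2 : P ≠ R := fun h => h2 (by rw [h])
  have k3 : Q ≠ R := fun h => h3 (by rw [h])
  fin_cases i <;> fin_cases j <;> first | rfl | (exfalso; simp at hij; tauto)

/-- The bilinear form obtained by restricting a tensor vanishing on collinear triples to the
triples containing zero. -/
theorem IsSymm.tri_zero_eq [W.IsElliptic] {C : Fin 4 → Fin 4 → Fin 4 → ℂ} (hC : IsSymm C)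
    (h : ∀ P : Fin 3 → Pt W, Function.Injective P → P 0 + P 1 + P 2 = 0 → T C P = 0) :
    ∃ κ₁ κ₂ κ₃ : ℂ, ∀ x₁ y₁ x₂ y₂ : ℂ,
      tri C ![0, 0, 0, 1] ![1, x₁, y₁, x₁ ^ 2] ![1, x₂, y₂, x₂ ^ 2] =
        κ₁ * (2 * sB W + sA W * (x₁ + x₂) + 2 * y₁ * y₂ + x₁ ^ 2 * x₂ + x₁ * x₂ ^ 2) +
        κ₂ * (x₁ - x₂) ^ 2 +
        κ₃ * (sA W * (y₁ + y₂) + 3 * (y₁ * x₂ ^ 2 + x₁ ^ 2 * y₂)) := by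
  -- Negating Y negates a and b, so i + j has the parity of the number of Y indices: the relations
  -- r₁–r₅ concern even entries, o₁–o₆ odd ones.
  have hl := hC.lineCoeff_eq_zero h
  have r1 := hl 0 4
  have r2 := hl 1 3
  have r3 := hl 2 2
  have r4 := hl 3 1
  have r5 := hl 4 0
  have o1 := hl 0 3
  have o2 := hl 1 2
  have o3 := hl 2 1
  have o4 := hl 3 0
  have o5 := hl 0 1
  have o6 := hl 1 0
  simp only [lineCoeff, Matrix.cons_val_zero, Matrix.cons_val_one,
    Matrix.cons_val] at r1 r2 r3 r4 r5 o1 o2 o3 o4 o5 o6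
  -- The relations `q1`, `q2` form a 2 × 2 linear system whose determinant is −12(4A³ + 27B²), so
  -- both unknowns vanish.
  have q1 : 4 * sA W ^ 2 * C 3 2 1 + 18 * sB W * (C 3 2 0 - C 3 3 2 * sA W / 3) = 0 := by
    linear_combination o5 + sA W * o2 + 3 * sB W * o3 - sA W ^ 2 * o4
  have q2 : 18 * sB W * C 3 2 1 - 12 * sA W * (C 3 2 0 - C 3 3 2 * sA W / 3) = 0 := by
    linear_combination o6 - 3 * o1 - sA W * o3 - 3 * sB W * o4
  have hd : C 3 2 1 = 0 := by
    refine (mul_eq_zero.1 (?_ : (4 * sA W ^ 3 + 27 * sB W ^ 2) * C 3 2 1 = 0)).resolve_left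
      disc_ne_zero
    linear_combination sA W * q1 + 3 / 2 * sB W * q2
  have hc : C 3 2 0 = C 3 3 2 * sA W / 3 := by
    rw [← sub_eq_zero]
    refine (mul_eq_zero.1 (?_ : (4 * sA W ^ 3 + 27 * sB W ^ 2) *
      (C 3 2 0 - C 3 3 2 * sA W / 3) = 0)).resolve_left disc_ne_zero
    linear_combination 3 / 2 * sB W * q1 - sA W ^ 2 / 3 * q2
  refine ⟨C 3 2 2 / 2, C 3 3 0, C 3 3 2 / 3, fun x₁ y₁ x₂ y₂ => ?_⟩
  simp only [tri, Fin.sum_univ_four, Matrix.cons_val_zero, Matrix.cons_val_one, Matrix.cons_val]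
  simp only [
    hC.swap₂ 3 0 1, hC.swap₂ 3 0 2, hC.swap₂ 3 0 3, hC.swap₂ 3 1 2, hC.swap₂ 3 1 3, hC.swap₂ 3 2 3]
  have h331 : C 3 3 1 = C 3 2 2 / 2 := by linear_combination -r4 / 2
  have h310 : C 3 1 0 = sA W * C 3 2 2 / 2 := by linear_combination -r2 / 2
  have h300 : C 3 0 0 = sB W * C 3 2 2 := by linear_combination r1
  have h311 : C 3 1 1 = -2 * C 3 3 0 := by linear_combination r3
  rw [hd, hc, r5, h331, h310, h300, h311]
  ring

/-! ### Local expressions at a triple of distinct points -/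

/-- `h` is the expression of the section `s` on `V` with respect to the standard local equations
`u0` and `g0`. -/
structure IsExpr (c : ℂ) (L l : Fin 3 → ℂ) (s : globalSections W) (V : Set (SymPt W))
    (h : SymPt W → ℂ) : Prop where
  opn : (symCube W).IsOpn V
  sub : quot W ⁻¹' V ⊆ dom W c L ∩ ddom W L l
  expr : IsLocalExpr s.1 V (descend (u0 c L)) (descend (g0 L l)) h

theorem IsExpr.isTrivialization [W.IsElliptic] {c : ℂ} {L l : Fin 3 → ℂ} {s : globalSections W}
    {V : Set (SymPt W)} {h : SymPt W → ℂ} (he : IsExpr c L l s V h) (hne : V.Nonempty) :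
    IsTrivialization W V (descend (u0 c L)) (descend (g0 L l)) :=
  isTrivialization_g0 he.opn he.sub hne

theorem IsExpr.mono {c : ℂ} {L l : Fin 3 → ℂ} {s : globalSections W}
    {V V' : Set (SymPt W)} {h : SymPt W → ℂ} (he : IsExpr c L l s V h)
    (hV' : (symCube W).IsOpn V') (hs : V' ⊆ V) : IsExpr c L l s V' h :=
  ⟨hV', (Set.preimage_mono hs).trans he.sub,
    Reg.mono (symReg_iff.1 he.expr.1) (symOpn_iff.1 hV') (Set.preimage_mono hs),
    fun D hD hDV => he.expr.2 D hD (hs hDV)⟩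

theorem IsExpr.add {c : ℂ} {L l : Fin 3 → ℂ} {s s' : globalSections W}
    {V : Set (SymPt W)} {h h' : SymPt W → ℂ} (he : IsExpr c L l s V h)
    (he' : IsExpr c L l s' V h') : IsExpr c L l (s + s') V fun D => h D + h' D :=
  ⟨he.opn, he.sub, Reg.add (symReg_iff.1 he.expr.1) (symReg_iff.1 he'.expr.1), fun D hD hDV => by
    have e1 := he.expr.2 D hD hDV
    have e2 := he'.expr.2 D hD hDV
    simp only [Submodule.coe_add, Pi.add_apply, add_mul, mul_add, e1, e2]⟩

theorem IsExpr.smul {c : ℂ} {L l : Fin 3 → ℂ} {s : globalSections W}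
    {V : Set (SymPt W)} {h : SymPt W → ℂ} (he : IsExpr c L l s V h) (r : ℂ) :
    IsExpr c L l (r • s) V fun D => r * h D :=
  ⟨he.opn, he.sub, Reg.const_mul (symOpn_iff.1 he.opn) (symReg_iff.1 he.expr.1) r,
    fun D hD hDV => by
      have e1 := he.expr.2 D hD hDV
      simp only [Submodule.coe_smul, Pi.smul_apply, smul_eq_mul, mul_assoc, e1]
      ring⟩

theorem exists_isExpr [W.IsElliptic] {c : ℂ} {L l : Fin 3 → ℂ} {P : Fin 3 → Pt W}
    (hP : P ∈ dom W c L ∩ ddom W L l) (s : globalSections W) :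
    ∃ V h, IsExpr c L l s V h ∧ quot W P ∈ V := by
  have hsym : ∀ Q ∈ dom W c L ∩ ddom W L l,
      ∀ σ : Equiv.Perm (Fin 3), Q ∘ σ ∈ dom W c L ∩ ddom W L l :=
    fun Q hQ σ => ⟨dom_comp Q hQ.1 σ, ddom_comp Q hQ.2 σ⟩
  have ho := symOpn_image ((opn_dom (W := W) c L).inter (opn_ddom L l)) hsym
  have hp := preimage_image_quot hsym
  obtain ⟨V, h1, h2, h3, h, hh⟩ := s.2 _ _ _ (isTrivialization_g0 ho hp.subset ⟨_, P, hP, rfl⟩) _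
    ⟨P, hP, rfl⟩
  exact ⟨V, h, ⟨h1, (Set.preimage_mono h3).trans hp.subset, hh⟩, h2⟩

theorem opn_generic [W.IsElliptic] :
    Opn ({P : Fin 3 → Pt W | ∀ i, P i ≠ 0} ∩ {P | P 0 + P 1 + P 2 ≠ 0}) :=
  opn_ne_zero.inter opn_sum_ne_zero

/-- Off D₀ and G₀ the expression is determined by the section, and regular functions agreeing on a
nonempty open set agree. -/
theorem IsExpr.unique [W.IsElliptic] {c : ℂ} {L l : Fin 3 → ℂ} {s : globalSections W}
    {V : Set (SymPt W)} {h h' : SymPt W → ℂ} (he : IsExpr c L l s V h)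
    (he' : IsExpr c L l s V h') {D : SymPt W} (hD : D ∈ V) : h D = h' D := by
  obtain ⟨Q, rfl⟩ := quot_surjective D
  have ho := symOpn_iff.1 he.opn
  obtain ⟨P₀, hP₀⟩ := exists_sum_ne_zero (W := W)
  refine sub_eq_zero.1 (((symReg_iff.1 he.expr.1).sub ho (symReg_iff.1 he'.expr.1)).eq_zero
    opn_generic ⟨P₀, hP₀⟩ (fun R hR hR0 => ?_) Q hD)
  have hg : descend (g0 L l) (quot W R) ≠ 0 := by
    rw [descend_quot fun σ => g0_comp L l R σ, Ne, g0_eq_zero_iff (he.sub hR).2]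
    exact hR0.2
  have e1 := he.expr.pull_eq hR0.1 hR
  rw [he'.expr.pull_eq hR0.1 hR] at e1
  exact sub_eq_zero.2 (mul_left_cancel₀ hg e1.symm)

theorem IsExpr.g0_mul [W.IsElliptic] {c : ℂ} {L l : Fin 3 → ℂ} {s : globalSections W}
    {V : Set (SymPt W)} {h : SymPt W → ℂ} (he : IsExpr c L l s V h)
    {C : Fin 4 → Fin 4 → Fin 4 → ℂ} (hC : Represents C s) {Q : Fin 3 → Pt W}
    (hQ : quot W Q ∈ V) : g0 L l Q * h (quot W Q) = H C c L Q := by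
  have ho := symOpn_iff.1 he.opn
  refine hC c L (quot W ⁻¹' V) (fun Q => g0 L l Q * h (quot W Q)) ho (fun R hR => (he.sub hR).1)
    ((reg_g0 ho fun R hR => (he.sub hR).2).mul (symReg_iff.1 he.expr.1)) (fun R hR hR0 => ?_) Q hQ
  have := he.expr.pull_eq hR0 hR
  rwa [descend_quot fun σ => u0_comp c L R σ, descend_quot fun σ => g0_comp L l R σ] at this

theorem represents_sec [W.IsElliptic] {C : Fin 4 → Fin 4 → Fin 4 → ℂ} (hC : IsSymm C)
    (hG : ∀ P : Fin 3 → Pt W, P 0 + P 1 + P 2 = 0 → T C P = 0) :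
    Represents C (⟨sec W C, sec_mem hC hG⟩ : globalSections W) := by
  intro c L O k hO hd hk he Q hQ
  refine sub_eq_zero.1 ((hk.sub hO (reg_H hO c (fun P hP i => (hd hP i).1) C)).eq_zero
    opn_ne_zero exists_ne_zero (fun R hR hR0 => ?_) Q hQ)
  have hp : pull (⟨sec W C, sec_mem hC hG⟩ : globalSections W) R = T C R := by
    rw [pull, total, dif_pos (notMem_divD0 hR0)]
    exact descend_quot (hC.T_comp R)
  rw [← he R hR hR0, H_eq_of_ne (fun i => (hd hR i).1) hR0, hp, sub_self]

/-! ### Directional derivatives of sections -/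

/-- The derivative of the local expression of a section along a curve in the cube. -/
theorem exists_derivAlong [W.IsElliptic] {c : ℂ} {L l : Fin 3 → ℂ} {γ : Fin 3 → ℂ → Pt W}
    {cc : Fin 3 → ℂ → Fin 3 → ℂ} {c' : Fin 3 → Fin 3 → ℂ} (hγ : ∀ i, IsParam (γ i) (cc i) (c' i))
    (hP : (fun i => γ i 0) ∈ dom W c L ∩ ddom W L l) :
    ∃ δ : Module.Dual ℂ (globalSections W), ∀ s V h, IsExpr c L l s V h →
      quot W (fun i => γ i 0) ∈ V → HasDerivAt (fun t => h (quot W fun i => γ i t)) (δ s) 0 := by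
  choose V h he hV using exists_isExpr hP
  have hd : ∀ s V h, IsExpr c L l s V h → quot W (fun i => γ i 0) ∈ V →
      DifferentiableAt ℂ (fun t => h (quot W fun i => γ i t)) 0 := fun s V h he hV =>
    IsParam.differentiableAt hγ (symReg_iff.1 he.expr.1) hV
  have hu : ∀ s V₁ h₁, IsExpr c L l s V₁ h₁ → quot W (fun i => γ i 0) ∈ V₁ →
      HasDerivAt (fun t => h₁ (quot W fun i => γ i t))
        (deriv (fun t => h s (quot W fun i => γ i t)) 0) 0 := by
    intro s V₁ h₁ he₁ hV₁
    have ho := symOpn_inter he₁.opn (he s).opn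
    refine (hd s _ _ (he s) (hV s)).hasDerivAt.congr_of_eventuallyEq ?_
    filter_upwards [IsParam.eventually_mem hγ (symOpn_iff.1 ho) ⟨hV₁, hV s⟩] with t ht
    exact (he₁.mono ho Set.inter_subset_left).unique ((he s).mono ho Set.inter_subset_right) ht
  refine ⟨{ toFun := fun s => deriv (fun t => h s (quot W fun i => γ i t)) 0
            map_add' := fun s s' => ?_
            map_smul' := fun r s => ?_ }, hu⟩
  · have ho := symOpn_inter (he s).opn (he s').opn
    exact (hu (s + s') _ _ (((he s).mono ho Set.inter_subset_left).add
      ((he s').mono ho Set.inter_subset_right)) ⟨hV s, hV s'⟩).unique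
      ((hu s _ _ (he s) (hV s)).add (hu s' _ _ (he s') (hV s')))
  · exact (hu (r • s) _ _ ((he s).smul r) (hV s)).unique ((hu s _ _ (he s) (hV s)).const_mul r)

/-- By the Leibniz rule, derivatives along curves kill 𝔪²; they thus detect linear independence in
𝔪/𝔪². -/
theorem hasDerivAt_of_inSqMaxIdeal {γ : Fin 3 → ℂ → Pt W} {cc : Fin 3 → ℂ → Fin 3 → ℂ}
    {c' : Fin 3 → Fin 3 → ℂ} (hγ : ∀ i, IsParam (γ i) (cc i) (c' i)) {a : SymPt W → ℂ}
    (ha : (symCube W).InSqMaxIdeal (quot W fun i => γ i 0) a) :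
    HasDerivAt (fun t => a (quot W fun i => γ i t)) 0 0 := by
  obtain ⟨V, hV, hpV, n, b, c, hbc, he⟩ := ha
  have hd : HasDerivAt (fun t => ∑ i, b i (quot W fun j => γ j t) * c i (quot W fun j => γ j t))
      (∑ i : Fin n, 0) 0 := by
    refine HasDerivAt.fun_sum fun i _ => ?_
    obtain ⟨hb, hc, hb0, hc0⟩ := hbc i
    have d1 := (IsParam.differentiableAt hγ (symReg_iff.1 hb) hpV).hasDerivAt
    have d2 := (IsParam.differentiableAt hγ (symReg_iff.1 hc) hpV).hasDerivAt
    have := d1.fun_mul d2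
    simp only [Function.comp, hb0, hc0, mul_zero, zero_mul, add_zero] at this
    exact this
  rw [Finset.sum_const_zero] at hd
  refine hd.congr_of_eventuallyEq ?_
  filter_upwards [IsParam.eventually_mem hγ (symOpn_iff.1 hV) hpV] with t ht using he _ ht

/-! ### Sections along the triples containing zero -/

/-- The unit relating `g0` to a difference of coordinates on triples containing zero. -/
def gUnit (L l : Fin 3 → ℂ) (P : Fin 3 → Pt W) : ℂ :=
  (L 1)⁻¹ * nc L (P 1) 2 * nc L (P 2) 2 / vander L l P

/-- The unit relating `H` to the tensor on triples containing zero. -/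
def tUnit (c : ℂ) (L : Fin 3 → ℂ) (P : Fin 3 → Pt W) : ℂ :=
  (L 1)⁻¹ ^ 4 * (zf c L (P 1) * zf c L (P 2)) ^ 4

theorem lin_zero (L : Fin 3 → ℂ) : lin L (0 : Pt W) = L 1 := by
  simp [lin, Fin.sum_univ_three]

theorem nc_two {L : Fin 3 → ℂ} {Q : Pt W} (hQ : Q ≠ 0) : nc L Q 2 = (lin L Q)⁻¹ := by
  simp [nc, sc_of_ne hQ]

/-- With first row proportional to [0 : 1 : 0] the determinant is a difference of abscissae, so on
{0} × E × E the equation of G₀ is X(R) − X(Q) up to a unit. -/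
theorem g0_vec {L l : Fin 3 → ℂ} {Q R : Pt W} (hQ : Q ≠ 0) (hR : R ≠ 0) :
    g0 L l ![0, Q, R] = gUnit L l ![0, Q, R] * (pX R - pX Q) := by
  have h := det3_nc (L := L) ![0, Q, R]
  rw [g0, h, gUnit]
  simp only [Matrix.cons_val_zero, Matrix.cons_val_one, Matrix.cons_val, lin_zero, nc_two hQ,
    nc_two hR, sc_zero, sc_of_ne hQ, sc_of_ne hR, det3]
  ring

theorem H_vec {C : Fin 4 → Fin 4 → Fin 4 → ℂ} {c : ℂ} {L : Fin 3 → ℂ} {Q R : Pt W} (hQ : Q ≠ 0)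
    (hR : R ≠ 0) (hd : ![0, Q, R] ∈ dom W c L) : H C c L ![0, Q, R] =
      tUnit c L ![0, Q, R] * tri C ![0, 0, 0, 1] ![1, pX Q, pY Q, pX Q ^ 2]
        ![1, pX R, pY R, pX R ^ 2] := by
  rw [H_eq fun i => (hd i).1, T]
  have e0 : sfac c L (0 : Pt W) = (L 1)⁻¹ ^ 4 := by simp [sfac, lin_zero]
  have e1 : sfac c L Q = zf c L Q ^ 4 := by simp [sfac, hQ]
  have e2 : sfac c L R = zf c L R ^ 4 := by simp [sfac, hR]
  change sfac c L (0 : Pt W) * sfac c L Q * sfac c L R * tri C (e4 (0 : Pt W)) (e4 Q) (e4 R) = _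
  rw [e0, e1, e2, e4_zero, e4_of_ne hQ, e4_of_ne hR, tUnit]
  simp only [Matrix.cons_val_one, Matrix.cons_val]
  ring

theorem reg_gUnit {L l : Fin 3 → ℂ} : Reg (ddom W L l) (gUnit L l) :=
  (((reg_nc (opn_ddom L l) (fun _ h => h.1) 1 2).const_mul (opn_ddom L l) (L 1)⁻¹).mul
    (reg_nc (opn_ddom L l) (fun _ h => h.1) 2 2)).div (reg_vander (opn_ddom L l) l fun _ h => h.1)
    fun _ h => h.2

theorem reg_tUnit {c : ℂ} {L : Fin 3 → ℂ} : Reg (dom W c L) (tUnit c L) :=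
  (Reg.pow (opn_dom c L) ((reg_zf (opn_dom c L) c (fun _ hP i => (hP i).1) 1).mul
    (reg_zf (opn_dom c L) c (fun _ hP i => (hP i).1) 2)) 4).const_mul (opn_dom c L) _

theorem gUnit_ne_zero {L l : Fin 3 → ℂ} {Q R : Pt W} (hQ : Q ≠ 0) (hR : R ≠ 0)
    (hd : ![0, Q, R] ∈ ddom W L l) : gUnit L l ![0, Q, R] ≠ 0 := by
  have h0 : lin L (0 : Pt W) ≠ 0 := hd.1 0
  rw [lin_zero] at h0
  refine div_ne_zero (mul_ne_zero (mul_ne_zero (inv_ne_zero h0) ?_) ?_) hd.2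
  · exact (nc_two (L := L) hQ).symm ▸ inv_ne_zero (hd.1 1)
  · exact (nc_two (L := L) hR).symm ▸ inv_ne_zero (hd.1 2)

theorem tUnit_ne_zero {c : ℂ} {L : Fin 3 → ℂ} {Q R : Pt W} (hQ : Q ≠ 0) (hR : R ≠ 0)
    (hd : ![0, Q, R] ∈ dom W c L) : tUnit c L ![0, Q, R] ≠ 0 := by
  have h0 : lin L (0 : Pt W) ≠ 0 := (hd 0).1
  rw [lin_zero] at h0
  exact mul_ne_zero (pow_ne_zero _ (inv_ne_zero h0)) (pow_ne_zero _ (mul_ne_zero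
    (fun h => hQ ((zf_eq_zero_iff (hd 1)).1 h)) (fun h => hR ((zf_eq_zero_iff (hd 2)).1 h))))

theorem vec_zero_apply (γ η : ℂ → Pt W) (t : ℂ) :
    (fun i => (![fun _ => 0, γ, η] : Fin 3 → ℂ → Pt W) i t) = ![0, γ t, η t] := by
  funext i; fin_cases i <;> rfl

theorem isParam_vec_zero {γ η : ℂ → Pt W} {x' y' u' v' : ℂ} (hγ : IsAffParam γ x' y')
    (hη : IsAffParam η u' v') : ∀ i, IsParam ((![fun _ => 0, γ, η] : Fin 3 → ℂ → Pt W) i)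
      ((![fun _ => sc (0 : Pt W), fun t => ![pX (γ t), pY (γ t), 1],
        fun t => ![pX (η t), pY (η t), 1]] : Fin 3 → ℂ → Fin 3 → ℂ) i)
      ((![0, ![x', y', 0], ![u', v', 0]] : Fin 3 → Fin 3 → ℂ) i) := by
  intro i; fin_cases i
  exacts [isParam_const 0, hγ.isParam, hη.isParam]

/-- The expression of a section on a curve of triples containing zero that meets `G₀`
transversally. -/
theorem IsExpr.eventually_vec [W.IsElliptic] {c : ℂ} {L l : Fin 3 → ℂ} {s : globalSections W}
    {V : Set (SymPt W)} {h : SymPt W → ℂ} (he : IsExpr c L l s V h)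
    {C : Fin 4 → Fin 4 → Fin 4 → ℂ} (hC : Represents C s) {γ η : ℂ → Pt W} {x' y' u' v' : ℂ}
    (hγ : IsAffParam γ x' y') (hη : IsAffParam η u' v') (hV : quot W ![0, γ 0, η 0] ∈ V)
    (hne : u' ≠ x') {K : ℂ → ℂ} (hK : ContinuousAt K 0)
    (hT : ∀ᶠ t in 𝓝 0, tri C ![0, 0, 0, 1] ![1, pX (γ t), pY (γ t), pX (γ t) ^ 2]
      ![1, pX (η t), pY (η t), pX (η t) ^ 2] = (pX (η t) - pX (γ t)) * K t) :
    ∀ᶠ t in 𝓝 0, gUnit L l ![0, γ t, η t] * h (quot W ![0, γ t, η t]) =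
      tUnit c L ![0, γ t, η t] * K t := by
  have hp := isParam_vec_zero hγ hη
  have hV' : quot W (fun i => (![fun _ => 0, γ, η] : Fin 3 → ℂ → Pt W) i 0) ∈ V := by
    rw [vec_zero_apply]; exact hV
  have ch := (IsParam.differentiableAt hp (symReg_iff.1 he.expr.1) hV').continuousAt
  have cg := (IsParam.differentiableAt hp reg_gUnit (he.sub hV').2).continuousAt
  have ct := (IsParam.differentiableAt hp reg_tUnit (he.sub hV').1).continuousAt
  have hm := IsParam.eventually_mem hp (symOpn_iff.1 he.opn) hV'
  simp only [vec_zero_apply, Function.comp] at ch cg ct hm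
  have dm : HasDerivAt (fun t => pX (η t) - pX (γ t)) (u' - x') 0 := hη.derivX.sub hγ.derivX
  have hm0 : ∀ᶠ t in 𝓝[≠] 0, pX (η t) - pX (γ t) ≠ 0 := by
    have := dm.eventually_ne (c := 0) (sub_ne_zero.2 hne)
    exact this
  -- The difference of abscissae has nonzero derivative, so it can be cancelled for small t ≠ 0;
  -- continuity then covers t = 0.
  have hpunct : ∀ᶠ t in 𝓝[≠] 0, gUnit L l ![0, γ t, η t] * h (quot W ![0, γ t, η t]) =
      tUnit c L ![0, γ t, η t] * K t := by
    filter_upwards [hm.filter_mono nhdsWithin_le_nhds, hm0, hT.filter_mono nhdsWithin_le_nhds,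
      hγ.ne_zero.filter_mono nhdsWithin_le_nhds, hη.ne_zero.filter_mono nhdsWithin_le_nhds]
      with t h1 h2 h3 h4 h5
    have e := he.g0_mul hC h1
    rw [g0_vec h4 h5, H_vec h4 h5 (he.sub h1).1, h3] at e
    apply mul_left_cancel₀ h2
    linear_combination e
  have hz : gUnit L l ![0, γ 0, η 0] * h (quot W ![0, γ 0, η 0]) =
      tUnit c L ![0, γ 0, η 0] * K 0 :=
    tendsto_nhds_unique
      ((cg.mul ch).tendsto.mono_left nhdsWithin_le_nhds |>.congr' hpunct)
      ((ct.mul hK).tendsto.mono_left nhdsWithin_le_nhds)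
  rw [eventually_nhdsWithin_iff] at hpunct
  filter_upwards [hpunct] with t ht
  by_cases h : t = 0
  · rw [h]; exact hz
  · exact ht h

/-- Along the curve h is a unit times the quotient K. As K vanishes at 0, only the value of the unit
enters the derivative. -/
theorem IsExpr.eq_zero_and_hasDerivAt [W.IsElliptic] {c : ℂ} {L l : Fin 3 → ℂ}
    {s : globalSections W} {V : Set (SymPt W)} {h : SymPt W → ℂ} (he : IsExpr c L l s V h)
    {C : Fin 4 → Fin 4 → Fin 4 → ℂ} (hC : Represents C s) {γ η : ℂ → Pt W} {x' y' u' v' : ℂ}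
    (hγ : IsAffParam γ x' y') (hη : IsAffParam η u' v') (hV : quot W ![0, γ 0, η 0] ∈ V)
    (hne : u' ≠ x') {K : ℂ → ℂ} {K' : ℂ} (hK : HasDerivAt K K' 0)
    (hK0 : K 0 = 0)
    (hT : ∀ᶠ t in 𝓝 0, tri C ![0, 0, 0, 1] ![1, pX (γ t), pY (γ t), pX (γ t) ^ 2]
      ![1, pX (η t), pY (η t), pX (η t) ^ 2] = (pX (η t) - pX (γ t)) * K t) :
    h (quot W ![0, γ 0, η 0]) = 0 ∧ HasDerivAt (fun t => h (quot W ![0, γ t, η t]))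
      (tUnit c L ![0, γ 0, η 0] / gUnit L l ![0, γ 0, η 0] * K') 0 := by
  have hev := he.eventually_vec hC hγ hη hV hne hK.continuousAt hT
  have hg := gUnit_ne_zero hγ.ne_zero.self_of_nhds hη.ne_zero.self_of_nhds (he.sub hV).2
  have hz := hev.self_of_nhds
  rw [hK0, mul_zero] at hz
  refine ⟨(mul_eq_zero.1 hz).resolve_left hg, ?_⟩
  have hp := isParam_vec_zero hγ hη
  have hV' : quot W (fun i => (![fun _ => 0, γ, η] : Fin 3 → ℂ → Pt W) i 0) ∈ V := by
    rw [vec_zero_apply]; exact hV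
  have dg := (IsParam.differentiableAt hp reg_gUnit (he.sub hV').2).hasDerivAt
  have dt := (IsParam.differentiableAt hp reg_tUnit (he.sub hV').1).hasDerivAt
  simp only [vec_zero_apply] at dg dt
  have hgne : ∀ᶠ t in 𝓝 0, gUnit L l ![0, γ t, η t] ≠ 0 := dg.continuousAt.eventually_ne hg
  refine (((dt.fun_mul hK).fun_div dg hg).congr_of_eventuallyEq ?_).congr_deriv ?_
  · filter_upwards [hev, hgne] with t h1 h2
    rw [← h1]; field_simp
  · rw [hK0]; field_simp; ring

/-! ### The four base points -/

/-- With f the cubic, ψ₃ = 12Xf − (f′)², so a common zero of ψ₃ and f would be a double root of f.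
-/
theorem pY_ne_zero_of_psi3 [W.IsElliptic] {Q : Pt W} (hQ : Q ≠ 0) (h : psi3 W (pX Q) = 0) :
    pY Q ≠ 0 := by
  intro hy
  have hc := curve_eq hQ
  rw [hy] at hc
  refine deriv_ne_zero_of_root (W := W) (r := pX Q) (by linear_combination -hc) ?_
  rw [← sq_eq_zero_iff]
  rw [psi3] at h
  linear_combination -h - 12 * pX Q * hc

theorem isAffParam_const {Q : Pt W} (hQ : Q ≠ 0) : IsAffParam (fun _ => Q) 0 0 :=
  ⟨Eventually.of_forall fun _ => hQ, hasDerivAt_const _ _, hasDerivAt_const _ _⟩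

theorem IsAffParam.neg {γ : ℂ → Pt W} {x' y' : ℂ} (h : IsAffParam γ x' y') :
    IsAffParam (fun t => -γ t) x' (-y') := by
  refine ⟨h.ne_zero.mono fun t ht => neg_ne_zero.2 ht, ?_, ?_⟩
  · simpa only [pX_neg] using h.derivX
  · simpa only [pY_neg] using h.derivY.fun_neg

/-- A curve through a point of order three, together with the difference quotient of `Y`. -/
theorem exists_torsionParam [W.IsElliptic] {Q : Pt W} (hQ : Q ≠ 0) (h : psi3 W (pX Q) = 0) :
    ∃ (γ : ℂ → Pt W) (D : ℂ → ℂ), γ 0 = Q ∧ IsAffParam γ 1 (D 0) ∧ HasDerivAt D 0 0 ∧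
      D 0 ^ 2 = 3 * pX Q ∧ 2 * pY Q * D 0 = 3 * pX Q ^ 2 + sA W ∧
      ∀ᶠ t in 𝓝 0, pY (γ t) - pY Q = (pX (γ t) - pX Q) * D t := by
  have hy := pY_ne_zero_of_psi3 hQ h
  obtain ⟨γ, x', y', rfl, hγ, h1, h2, -⟩ := exists_affParam hQ
  rw [h2 hy] at h1 hγ
  rw [mul_one] at h1
  have hc := curve_eq hQ
  -- With X′ = 1, ψ₃ = 12XY² − (2YY′)² = 4Y²(3X − Y′²). Thus ψ₃ = 0 says that the tangent slope
  -- squared is the sum of three equal abscissae, i.e. that Q is a flex.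
  have hy' : y' ^ 2 = 3 * pX (γ 0) := by
    have : 4 * pY (γ 0) ^ 2 ≠ 0 := mul_ne_zero (by norm_num) (pow_ne_zero _ hy)
    apply mul_left_cancel₀ this
    rw [psi3] at h
    linear_combination (2 * pY (γ 0) * y' + (3 * pX (γ 0) ^ 2 + sA W)) * h1 - h -
      12 * pX (γ 0) * hc
  have d1 : HasDerivAt (fun t => pX (γ t) ^ 2 + pX (γ t) * pX (γ 0) + (pX (γ 0) ^ 2 + sA W))
      (2 * pX (γ 0) + pX (γ 0)) 0 := by
    refine (((hγ.derivX.fun_pow 2).fun_add (hγ.derivX.mul_const (pX (γ 0)))).add_const _).congr_deriv ?_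
    simp
  have d2 : HasDerivAt (fun t => pY (γ t) + pY (γ 0)) y' 0 := hγ.derivY.add_const _
  have hyy : pY (γ 0) + pY (γ 0) ≠ 0 := by rw [← two_mul]; exact mul_ne_zero two_ne_zero hy
  have hD0 : (pX (γ 0) ^ 2 + pX (γ 0) * pX (γ 0) + (pX (γ 0) ^ 2 + sA W)) /
      (pY (γ 0) + pY (γ 0)) = y' := by
    rw [div_eq_iff hyy]; linear_combination -h1
  refine ⟨γ, fun t => (pX (γ t) ^ 2 + pX (γ t) * pX (γ 0) + (pX (γ 0) ^ 2 + sA W)) /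
    (pY (γ t) + pY (γ 0)), rfl, ?_, ?_, ?_, ?_, ?_⟩
  · simp only [hD0]; exact hγ
  -- At a flex the chord slope is stationary, so D has derivative zero.
  · refine (d1.fun_div d2 hyy).congr_deriv ?_
    rw [div_eq_zero_iff]
    left
    linear_combination y' * h1 - 2 * pY (γ 0) * hy'
  · simp only [hD0]; exact hy'
  · simp only [hD0]; exact h1
  · filter_upwards [d2.continuousAt.eventually_ne hyy, hγ.ne_zero] with t ht ht0
    have ct := curve_eq ht0
    field_simp
    linear_combination ct - hc

/-- The coefficients of the restriction of a tensor to the triples containing zero. -/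
def ZeroCoeffs (W : WeierstrassCurve ℂ) (C : Fin 4 → Fin 4 → Fin 4 → ℂ) (κ₁ κ₂ κ₃ : ℂ) : Prop :=
  ∀ x₁ y₁ x₂ y₂ : ℂ, tri C ![0, 0, 0, 1] ![1, x₁, y₁, x₁ ^ 2] ![1, x₂, y₂, x₂ ^ 2] =
    κ₁ * (2 * sB W + sA W * (x₁ + x₂) + 2 * y₁ * y₂ + x₁ ^ 2 * x₂ + x₁ * x₂ ^ 2) +
    κ₂ * (x₁ - x₂) ^ 2 + κ₃ * (sA W * (y₁ + y₂) + 3 * (y₁ * x₂ ^ 2 + x₁ ^ 2 * y₂))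

theorem zeroCoeffs_F₁ : ZeroCoeffs W (F₁ W) 0 1 0 := by
  intro x₁ y₁ x₂ y₂
  simp only [F₁, tri_add, tri_smul, tri_ms]
  simp
  ring

theorem zeroCoeffs_F₅ : ZeroCoeffs W (F₅ W) 0 0 1 := by
  intro x₁ y₁ x₂ y₂
  simp only [F₅, tri_add, tri_smul, tri_ms]
  simp
  ring

/-- The derivatives of the expression of a section at a base point in two directions. -/
theorem exists_derivs [W.IsElliptic] {Q : Pt W} (hQ : Q ≠ 0) (h : psi3 W (pX Q) = 0) {c : ℂ}
    {L l : Fin 3 → ℂ} (hP : ![0, Q, -Q] ∈ dom W c L ∩ ddom W L l) :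
    ∃ (γ η : ℂ → Pt W) (x' y' : ℂ) (τ : ℂ), τ ≠ 0 ∧ γ 0 = Q ∧ η 0 = -Q ∧ IsAffParam γ x' y' ∧
      IsAffParam η x' (-y') ∧
      ∀ s C κ₁ κ₂ κ₃, Represents C s → ZeroCoeffs W C κ₁ κ₂ κ₃ → ∀ V h, IsExpr c L l s V h →
        quot W ![0, Q, -Q] ∈ V → h (quot W ![0, Q, -Q]) = 0 ∧
        HasDerivAt (fun t => h (quot W ![0, γ t, -Q]))
          (τ * (3 * pY Q * κ₃ - (κ₁ * pX Q + κ₂))) 0 ∧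
        HasDerivAt (fun t => h (quot W ![0, Q, η t]))
          (τ * (3 * pY Q * κ₃ + (κ₁ * pX Q + κ₂))) 0 := by
  obtain ⟨γ, D, rfl, hγ, hD, hD2, hD1, hDe⟩ := exists_torsionParam hQ h
  have hτ : tUnit c L ![0, γ 0, -γ 0] / gUnit L l ![0, γ 0, -γ 0] ≠ 0 :=
    div_ne_zero (tUnit_ne_zero hQ (neg_ne_zero.2 hQ) hP.1)
      (gUnit_ne_zero hQ (neg_ne_zero.2 hQ) hP.2)
  refine ⟨γ, fun t => -γ t, 1, D 0, _, hτ, rfl, rfl, hγ, hγ.neg, ?_⟩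
  intro s C κ₁ κ₂ κ₃ hC hκ V h he hV
  have hc := curve_eq hQ
  -- On the curve the κ₁ form is (Y₁ + Y₂)² − (X₁ + X₂)(X₁ − X₂)². With second point −Q it is the
  -- square of the abscissa difference times D² − (X₁ + X₂), whose last factor is X(Q) at t = 0
  -- because D² = 3X(Q).
  have dn : HasDerivAt (fun t => pX (γ t) - pX (γ 0)) 1 0 := hγ.derivX.sub_const _
  have dE : HasDerivAt (fun t => κ₁ * ((pX (γ t) - pX (γ 0)) *
      (D t ^ 2 - (pX (γ t) + pX (γ 0)))) + κ₂ * (pX (γ t) - pX (γ 0))) (κ₁ * pX (γ 0) + κ₂) 0 := by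
    refine (((dn.fun_mul ((hD.fun_pow 2).fun_sub (hγ.derivX.add_const (pX (γ 0))))).const_mul κ₁).fun_add
      (dn.const_mul κ₂)).congr_deriv ?_
    simp only [sub_self, zero_mul, add_zero, one_mul, mul_one]
    linear_combination κ₁ * hD2
  have d5 : HasDerivAt (fun t => κ₃ * ((sA W + 3 * pX (γ 0) ^ 2) * D t -
      3 * pY (γ 0) * (pX (γ t) + pX (γ 0)))) (-(3 * pY (γ 0) * κ₃)) 0 := by
    refine (((hD.const_mul (sA W + 3 * pX (γ 0) ^ 2)).fun_sub
      ((hγ.derivX.add_const (pX (γ 0))).const_mul (3 * pY (γ 0)))).const_mul κ₃).congr_deriv ?_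
    ring
  -- The κ₁ and κ₂ parts keep a factor of the abscissa difference after division; only the κ₃ part
  -- needs the flex condition to vanish at (Q, −Q).
  have z5 : (sA W + 3 * pX (γ 0) ^ 2) * D 0 - 3 * pY (γ 0) * (pX (γ 0) + pX (γ 0)) = 0 := by
    linear_combination 2 * pY (γ 0) * hD2 - D 0 * hD1
  obtain ⟨h0, r1⟩ := he.eq_zero_and_hasDerivAt hC hγ (isAffParam_const (neg_ne_zero.2 hQ)) hV
    zero_ne_one (d5.fun_neg.fun_sub dE) (by simp only [z5]; ring) (by
      filter_upwards [hDe, hγ.ne_zero] with t ht ht0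
      have ct := curve_eq ht0
      rw [hκ, pX_neg, pY_neg]
      linear_combination κ₁ * ((pY (γ t) - pY (γ 0) + (pX (γ t) - pX (γ 0)) * D t) * ht - ct - hc)
        + κ₃ * (sA W + 3 * pX (γ 0) ^ 2) * ht)
  obtain ⟨-, r2⟩ := he.eq_zero_and_hasDerivAt hC (isAffParam_const hQ) hγ.neg hV
    one_ne_zero (d5.fun_neg.fun_add dE) (by simp only [z5]; ring) (by
      filter_upwards [hDe, hγ.ne_zero] with t ht ht0
      have ct := curve_eq ht0
      rw [hκ, pX_neg, pY_neg]
      linear_combination κ₁ * ((pY (γ t) - pY (γ 0) + (pX (γ t) - pX (γ 0)) * D t) * ht - ct - hc)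
        - κ₃ * (sA W + 3 * pX (γ 0) ^ 2) * ht)
  exact ⟨h0, r1.congr_deriv (by ring), r2.congr_deriv (by ring)⟩

theorem injective_of_psi3 [W.IsElliptic] {Q : Pt W} (hQ : Q ≠ 0) (h : psi3 W (pX Q) = 0) :
    Function.Injective ![0, Q, -Q] := by
  have h1 : Q ≠ -Q := fun h1 => pY_ne_zero_of_psi3 hQ h (pY_eq_zero_of_eq_neg h1)
  have h2 : -Q ≠ 0 := neg_ne_zero.2 hQ
  intro i j hij
  fin_cases i <;> fin_cases j <;> first | rfl | (exfalso; simp at hij; tauto)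

/-- Vanishing for all sections comes from `exists_derivs`, applied to the tensor of the section. The
two curves move Q and −Q separately inside D₀; the κ₃ term enters both derivatives with the same
sign and the κ₁, κ₂ terms with opposite signs, so the two linear forms are independent. -/
theorem isSimpleBasePoint_of_psi3 [W.IsElliptic] {Q : Pt W} (hQ : Q ≠ 0)
    (h : psi3 W (pX Q) = 0) : IsSimpleBasePoint (quot W ![0, Q, -Q]) := by
  obtain ⟨c, L, l, hP⟩ := exists_mem_ddom (injective_of_psi3 hQ h)
  obtain ⟨γ, η, x', y', τ, hτ, hγ0, hη0, hγ, hη, hmain⟩ := exists_derivs hQ h hP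
  have hvan : ∀ s V h, IsExpr c L l s V h → quot W ![0, Q, -Q] ∈ V →
      h (quot W ![0, Q, -Q]) = 0 := by
    intro s V h he hV
    obtain ⟨C, hC, hr, hv⟩ := exists_tensor_vanishing s
    obtain ⟨κ₁, κ₂, κ₃, hκ⟩ := hC.tri_zero_eq hv
    exact (hmain s C κ₁ κ₂ κ₃ hr hκ V h he hV).1
  refine ⟨fun s => ?_, ?_⟩
  · obtain ⟨V, h, he, hV⟩ := exists_isExpr hP s
    exact ⟨V, _, _, h, he.isTrivialization ⟨_, hV⟩, hV, he.expr, hvan s V h he hV⟩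
  have p₁ := isParam_vec_zero hγ (isAffParam_const (neg_ne_zero.2 hQ))
  have p₂ := isParam_vec_zero (isAffParam_const hQ) hη
  have e₁ := vec_zero_apply γ fun _ => -Q
  have e₂ := vec_zero_apply (fun _ => Q) η
  have b₁ := e₁ 0
  have b₂ := e₂ 0
  simp only [hγ0] at b₁
  simp only [hη0] at b₂
  obtain ⟨δ₁, hδ₁⟩ := exists_derivAlong (c := c) (L := L) (l := l) p₁ (by rw [b₁]; exact hP)
  obtain ⟨δ₂, hδ₂⟩ := exists_derivAlong (c := c) (L := L) (l := l) p₂ (by rw [b₂]; exact hP)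
  simp only [b₁, e₁] at hδ₁
  simp only [b₂, e₂] at hδ₂
  have hval : ∀ s C κ₁ κ₂ κ₃, Represents C s → ZeroCoeffs W C κ₁ κ₂ κ₃ →
      δ₁ s = τ * (3 * pY Q * κ₃ - (κ₁ * pX Q + κ₂)) ∧
      δ₂ s = τ * (3 * pY Q * κ₃ + (κ₁ * pX Q + κ₂)) := by
    intro s C κ₁ κ₂ κ₃ hr hκ
    obtain ⟨V, h, he, hV⟩ := exists_isExpr hP s
    obtain ⟨-, h1, h2⟩ := hmain s C κ₁ κ₂ κ₃ hr hκ V h he hV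
    exact ⟨(hδ₁ s V h he hV).unique h1, (hδ₂ s V h he hV).unique h2⟩
  -- The open set is the non-vanishing of the 2 × 2 determinant of the derivatives. On (`F₁`, `F₅`)
  -- it is −6τ²Y(Q), nonzero because Q does not have order two.
  refine ⟨{s | δ₁ s.1 * δ₂ s.2 - δ₁ s.2 * δ₂ s.1 ≠ 0}, ⟨{X (δ₁ ∘ₗ LinearMap.fst ℂ _ _) *
    X (δ₂ ∘ₗ LinearMap.snd ℂ _ _) - X (δ₁ ∘ₗ LinearMap.snd ℂ _ _) *
    X (δ₂ ∘ₗ LinearMap.fst ℂ _ _)}, by simp⟩, ?_, ?_⟩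
  · refine ⟨(⟨sec W (F₁ W), sec_mem isSymm_F₁ T_F₁⟩, ⟨sec W (F₅ W), sec_mem isSymm_F₅ T_F₅⟩), ?_⟩
    obtain ⟨a1, a2⟩ := hval _ _ _ _ _ (represents_sec isSymm_F₁ T_F₁) zeroCoeffs_F₁
    obtain ⟨a3, a4⟩ := hval _ _ _ _ _ (represents_sec isSymm_F₅ T_F₅) zeroCoeffs_F₅
    simp only [Set.mem_ofPred_eq, a1, a2, a3, a4]
    have : -6 * τ ^ 2 * pY Q ≠ 0 := mul_ne_zero (mul_ne_zero (by norm_num) (pow_ne_zero _ hτ))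
      (pY_ne_zero_of_psi3 hQ h)
    intro h0
    apply this
    linear_combination h0
  · rintro ⟨s₁, s₂⟩ hs
    obtain ⟨V₁, h₁, he₁, hV₁⟩ := exists_isExpr hP s₁
    obtain ⟨V₂, h₂, he₂, hV₂⟩ := exists_isExpr hP s₂
    have ho := symOpn_inter he₁.opn he₂.opn
    have hm₁ := he₁.mono ho Set.inter_subset_left
    have hm₂ := he₂.mono ho Set.inter_subset_right
    refine ⟨V₁ ∩ V₂, _, _, h₁, h₂, hm₁.isTrivialization ⟨_, hV₁, hV₂⟩, ⟨hV₁, hV₂⟩, hm₁.expr,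
      hm₂.expr, hvan s₁ _ _ he₁ hV₁, hvan s₂ _ _ he₂ hV₂, fun α β hαβ => ?_⟩
    have k₁ := hasDerivAt_of_inSqMaxIdeal p₁ (by rw [b₁]; exact hαβ)
    have k₂ := hasDerivAt_of_inSqMaxIdeal p₂ (by rw [b₂]; exact hαβ)
    simp only [e₁] at k₁
    simp only [e₂] at k₂
    have q₁ := k₁.unique (((hδ₁ s₁ _ _ he₁ hV₁).const_mul α).fun_add
      ((hδ₁ s₂ _ _ he₂ hV₂).const_mul β))
    have q₂ := k₂.unique (((hδ₂ s₁ _ _ he₁ hV₁).const_mul α).fun_add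
      ((hδ₂ s₂ _ _ he₂ hV₂).const_mul β))
    constructor
    · refine (mul_eq_zero.1 (?_ : α * (δ₁ s₁ * δ₂ s₂ - δ₁ s₂ * δ₂ s₁) = 0)).resolve_right hs
      linear_combination δ₁ s₂ * q₂ - δ₂ s₂ * q₁
    · refine (mul_eq_zero.1 (?_ : β * (δ₁ s₁ * δ₂ s₂ - δ₁ s₂ * δ₂ s₁) = 0)).resolve_right hs
      linear_combination δ₂ s₁ * q₁ - δ₁ s₁ * q₂

/-! ### Counting the base points -/

/-- Since ψ₃′ = 12f and ψ₃ = 12Xf − (f′)², a multiple root of ψ₃ would be a multiple root of f. So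
the quartic is separable. -/
theorem encard_psi3_eq_zero [W.IsElliptic] : {x | psi3 W x = 0}.encard = 4 := by
  let p : Polynomial ℂ := Polynomial.C 3 * Polynomial.X ^ 4 +
    Polynomial.C (6 * sA W) * Polynomial.X ^ 2 + Polynomial.C (12 * sB W) * Polynomial.X +
    Polynomial.C (-sA W ^ 2)
  have hdeg : p.natDegree = 4 := by simp only [p]; compute_degree!
  have hp0 : p ≠ 0 := by intro h; rw [h] at hdeg; simp at hdeg
  have heval : ∀ x, p.eval x = psi3 W x := by
    intro x
    simp only [p, psi3, Polynomial.eval_add, Polynomial.eval_mul, Polynomial.eval_C,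
      Polynomial.eval_pow, Polynomial.eval_X]
    ring
  have hder : ∀ x, p.derivative.eval x = 12 * (x ^ 3 + sA W * x + sB W) := by
    intro x
    simp only [p, Polynomial.derivative_add, Polynomial.derivative_C_mul,
      Polynomial.derivative_X_pow, Polynomial.derivative_X, Polynomial.derivative_C,
      Polynomial.eval_add, Polynomial.eval_mul, Polynomial.eval_C, Polynomial.eval_pow,
      Polynomial.eval_X, Polynomial.eval_one, Polynomial.eval_zero]
    push_cast
    ring
  have hsep : p.Separable := by
    rw [Polynomial.Separable, Polynomial.isCoprime_iff_aeval_ne_zero_of_isAlgClosed ℂ ℂ]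
    intro x
    by_contra! hc
    obtain ⟨h1, h2⟩ := hc
    rw [Polynomial.coe_aeval_eq_eval] at h1 h2
    rw [heval, psi3] at h1
    rw [hder] at h2
    have h3 : x ^ 3 + sA W * x + sB W = 0 := by linear_combination h2 / 12
    refine deriv_ne_zero_of_root h3 ?_
    rw [← sq_eq_zero_iff]
    linear_combination 12 * x * h3 - h1
  have hset : {x | psi3 W x = 0} = (p.roots.toFinset : Set ℂ) := by
    ext x
    simp [Polynomial.mem_roots hp0, Polynomial.IsRoot, heval]
  rw [hset, Set.encard_coe_eq_coe_finsetCard,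
    Multiset.toFinset_card_of_nodup (Polynomial.nodup_roots hsep),
    ← (IsAlgClosed.splits p).natDegree_eq_card_roots, hdeg]
  rfl

theorem isBasePoint_iff [W.IsElliptic] {p : SymPt W} :
    IsBasePoint p ↔ ∃ Q : Pt W, Q ≠ 0 ∧ psi3 W (pX Q) = 0 ∧ p = quot W ![0, Q, -Q] :=
  ⟨exists_of_isBasePoint, by
    rintro ⟨Q, hQ, h, rfl⟩
    exact (isSimpleBasePoint_of_psi3 hQ h).1⟩

/-- The triple {0, Q, −Q} is unchanged under Q ↦ −Q and determines X(Q), so base points correspond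
to the roots of ψ₃. -/
theorem encard_basePoints [W.IsElliptic] : {p : SymPt W | IsBasePoint p}.encard = 4 := by
  have hex : ∀ x : ℂ, ∃ Q : Pt W, Q ≠ 0 ∧ pX Q = x := by
    intro x
    obtain ⟨y, hy⟩ := IsAlgClosed.exists_pow_nat_eq (x ^ 3 + sA W * x + sB W) two_pos
    obtain ⟨Q, hQ, hX, -⟩ := exists_pt hy
    exact ⟨Q, hQ, hX⟩
  choose q hq hqX using hex
  have himage : {p : SymPt W | IsBasePoint p} =
      (fun x => quot W ![0, q x, -q x]) '' {x | psi3 W x = 0} := by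
    ext p
    simp only [Set.mem_ofPred_eq, isBasePoint_iff, Set.mem_image]
    constructor
    · rintro ⟨Q, hQ, h, rfl⟩
      refine ⟨pX Q, h, ?_⟩
      rcases eq_or_eq_neg_of_pX_eq (hq (pX Q)) hQ (hqX _) with h1 | h1
      · rw [h1]
      · rw [h1, neg_neg, ← quot_comp ![0, Q, -Q] (Equiv.swap 1 2)]
        congr 1
        funext i; fin_cases i <;> rfl
    · rintro ⟨x, hx, rfl⟩
      exact ⟨q x, hq x, by rw [hqX]; exact hx, rfl⟩
  have hinj : Set.InjOn (fun x => quot W ![0, q x, -q x]) {x | psi3 W x = 0} := by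
    intro x _ y _ hxy
    obtain ⟨σ, hσ⟩ := quot_eq_iff.1 hxy
    have h1 : q x = ![0, q y, -q y] (σ 1) := congrFun hσ 1
    have h2 : ∀ i, (![0, q y, -q y] : Fin 3 → Pt W) i = 0 ∨
        pX ((![0, q y, -q y] : Fin 3 → Pt W) i) = y := by
      intro i; fin_cases i
      · exact Or.inl rfl
      · exact Or.inr (hqX y)
      · exact Or.inr ((pX_neg _).trans (hqX y))
    rcases h2 (σ 1) with h3 | h3
    · exact absurd (h1.trans h3) (hq x)
    · rw [← hqX x, h1, h3]
  rw [himage, hinj.encard_image, encard_psi3_eq_zero]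

end SymmetricCube

end

theorem mainTheorem8 (W : WeierstrassCurve ℂ) [W.IsElliptic] :
    {p : SymmetricCube.SymPt W | SymmetricCube.IsBasePoint p}.encard = 4 ∧
      ∀ p : SymmetricCube.SymPt W, SymmetricCube.IsBasePoint p →
        SymmetricCube.IsSimpleBasePoint p ∧ p ∈ SymmetricCube.divG0 W := by
  refine ⟨SymmetricCube.encard_basePoints, fun p hp => ?_⟩
  obtain ⟨Q, hQ, h, rfl⟩ := SymmetricCube.exists_of_isBasePoint hp
  exact ⟨SymmetricCube.isSimpleBasePoint_of_psi3 hQ h, SymmetricCube.mem_divG0.2 (by simp)⟩
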